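/- Let $X_1, X_2, \dots$ be a (strictly) stationary and ergodic sequence of real random variables on a probability space, whose common distribution has a density, with $\mathbb{P}(X_1 = X_2) = 0$. For $n \ge 1$ put $X_{k,n} = X_k$ for $1 \le k \le n$ and $X_{0,n} = X_{k,n} = \infty$ for $k > n$. Let $K_n(t)$, $t \in \mathbb{R}$, be the subgraph of the infinite path $v_0 - v_1 - v_2 - \cdots$ that consists of the vertices $v_i$ with $X_{i,n} \le t$ and the edges $\{v_i, v_{i+1}\}$ with $\max(X_{i,n}, X_{i+1,n}) \le t$. Its $0$-dimensional persistence diagram is the multiset $PD_0$ of points of $\Delta = \{(b,d) : -\infty < b < d \le \infty\} \subset [-\infty,\infty]^2$ with $(H_0(K_n(t);\mathbb{Z}/2))_{t} \cong \bigoplus_{(b,d) \in PD_0} I(b,d)$ as persistence modules, where $I(b,d)$ is the interval module of $[b,d)$. Let $\xi_{0,n} = \sum_{(b,d) \in PD_0} \delta_{(b,d)}$, a measure on $\Delta$. For a measure $\mu$ on $\Delta$ let $\tilde\mu$ be its restriction to $\tilde\Delta = \Delta \cap \mathbb{R}^2$, and write $\tilde\mu(\Delta)$ for $\tilde\mu(\tilde\Delta)$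 and $\mu(f) = \int f \, d\mu$. Let $\Delta_\ell = \{(b,d) \in \Delta : d - b > \ell\}$, $f_I(b,d) = d-b$, $f_e(b,d) = (d-b)\log(d-b)$ and $$E_n = -\sum_{(b,d) \in \tilde\xi_{0,n}} \frac{d-b}{L_n} \log\Big(\frac{d-b}{L_n}\Big), \quad L_n = \sum_{(b,d) \in \tilde\xi_{0,n}} (d-b), \qquad A_n^L = \int_0^L \log \xi_{0,n}(\Delta_\ell) \, d\ell .$$ Suppose that for each of the functions $g(u) = u$ and $g(u) = u \log u + 1$ on $[0,\infty)$ (with $0 \log 0 = 0$) there is an $\epsilon > 0$ with $\mathbb{E}[g(2|X_1|)^{1+\epsilon}] < \infty$. Then there is a (necessarily unique) probability measure $\xi_0$ on $\Delta$ such that, almost surely, $\xi_{0,n}/\xi_{0,n}(\Delta) \Rightarrow \xi_0$ weakly on $\Delta$ and $\tilde\xi_{0,n}/\tilde\xi_{0,n}(\Delta) \Rightarrow \tilde\xi_0$ weakly on $\tilde\Delta$ as $n \to \infty$. The functions $f_I$ and $f_e$ are integrable with respect to $\tilde\xi_0$, and $$E_n - \log \tilde\xi_{0,n}(\Delta) \to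 -\frac{\tilde\xi_0(f_e)}{\tilde\xi_0(f_I)} + \log \tilde\xi_0(f_I) \quad \text{almost surely as } n \to \infty.$$ Moreover, for every $L > 0$ with $\xi_0(\Delta_L) > 0$, $$L \log \xi_{0,n}(\Delta) - A_n^L \to -\int_0^L \log \xi_0(\Delta_\ell) \, d\ell \quad \text{almost surely as } n \to \infty.$$ -/

import Mathlib

open MeasureTheory Filter Topology Set
open scoped BoundedContinuousFunction DirectSum

namespace SublevelPH

noncomputable section

/-! ### Zero-dimensional sublevel set homology of a path -/

/-- The index set of the vertices `vᵢ` of the subcomplex `K(t)` of the infinite path with vertices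
`v₀, v₁, …` and edges `{vᵢ, vᵢ₊₁}`, when `vᵢ` has the value `xᵢ`. -/
abbrev Vertex (x : ℕ → EReal) (t : ℝ) : Type := {i : ℕ // x i ≤ (t : EReal)}

/-- The index set of the edges of `K(t)`; the edge `{vᵢ, vᵢ₊₁}` is indexed by `i`. -/
abbrev Edge (x : ℕ → EReal) (t : ℝ) : Type := {i : ℕ // max (x i) (x (i + 1)) ≤ (t : EReal)}

/-- The left endpoint of an edge. -/
def Edge.left {x : ℕ → EReal} {t : ℝ} (e : Edge x t) : Vertex x t :=
  ⟨e.1, (le_max_left _ _).trans e.2⟩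

/-- The right endpoint of an edge. -/
def Edge.right {x : ℕ → EReal} {t : ℝ} (e : Edge x t) : Vertex x t :=
  ⟨e.1 + 1, (le_max_right _ _).trans e.2⟩

/-- The boundary map `∂₁ : C₁(K(t)) → C₀(K(t))`, with coefficients in `ℤ/2`. -/
def boundary (x : ℕ → EReal) (t : ℝ) : (Edge x t →₀ ZMod 2) →ₗ[ZMod 2] (Vertex x t →₀ ZMod 2) :=
  Finsupp.linearCombination (ZMod 2) fun e => Finsupp.single e.left 1 + Finsupp.single e.right 1

/-- `H₀(K(t)) = Z₀(K(t)) / B₀(K(t))`, where `Z₀ = C₀` (as `∂₀ = 0`) and `B₀` is the image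
of `∂₁`. -/
abbrev H0 (x : ℕ → EReal) (t : ℝ) : Type :=
  (Vertex x t →₀ ZMod 2) ⧸ LinearMap.range (boundary x t)

/-- The inclusion of the vertices of `K(s)` in those of `K(t)`, `s ≤ t`. -/
def Vertex.incl {x : ℕ → EReal} {s t : ℝ} (h : s ≤ t) (v : Vertex x s) : Vertex x t :=
  ⟨v.1, v.2.trans (EReal.coe_le_coe_iff.2 h)⟩

/-- The inclusion of the edges of `K(s)` in those of `K(t)`, `s ≤ t`. -/
def Edge.incl {x : ℕ → EReal} {s t : ℝ} (h : s ≤ t) (e : Edge x s) : Edge x t :=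
  ⟨e.1, e.2.trans (EReal.coe_le_coe_iff.2 h)⟩

theorem boundary_incl (x : ℕ → EReal) {s t : ℝ} (h : s ≤ t) :
    LinearMap.range (boundary x s) ≤ (LinearMap.range (boundary x t)).comap
      (Finsupp.lmapDomain (ZMod 2) (ZMod 2) (Vertex.incl h)) := by
  rintro _ ⟨c, rfl⟩
  refine ⟨Finsupp.lmapDomain (ZMod 2) (ZMod 2) (Edge.incl h) c, ?_⟩
  induction c using Finsupp.induction_linear with
  | zero => simp
  | add c d hc hd => simp only [map_add, hc, hd]
  | single e a =>
    simp [boundary, Edge.left, Edge.right, Edge.incl, Vertex.incl, Finsupp.mapDomain_single,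
      Finsupp.mapDomain_add]

/-- The map `H₀(K(s)) → H₀(K(t))` induced by the inclusion `K(s) ⊆ K(t)`. -/
def H0Map (x : ℕ → EReal) {s t : ℝ} (h : s ≤ t) : H0 x s →ₗ[ZMod 2] H0 x t :=
  Submodule.mapQ _ _ (Finsupp.lmapDomain (ZMod 2) (ZMod 2) (Vertex.incl h)) (boundary_incl x h)

/-! ### Persistence diagrams -/

/-- `Δ = {(b, d) : -∞ < b < d ≤ ∞}`, with the topology and Borel sets inherited from `[-∞, ∞]²`. -/
def Delta : Set (EReal × EReal) := {p | ⊥ < p.1 ∧ p.1 < p.2}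

/-- `Δ ∩ ℝ²`, as a subset of `Δ`. -/
def DeltaFin : Set Delta := {p | p.1.2 ≠ ⊤}

/-- `Δ_ℓ = {(b, d) ∈ Δ : d - b > ℓ}`. -/
def DeltaGT (l : ℝ) : Set Delta := {p | (l : EReal) < p.1.2 - p.1.1}

/-- The lifetime `d - b` of a point with finite death (it is only used on such points). -/
def lifetime (p : Delta) : ℝ := (p.1.2 - p.1.1).toReal

/-- The space at time `t` of the interval module `I(b, d)`: `ℤ/2` if `b ≤ t < d`, and `0`
otherwise. -/
def intervalSpace (p : Delta) (t : ℝ) : Submodule (ZMod 2) (ZMod 2) :=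
  open Classical in if p.1.1 ≤ (t : EReal) ∧ (t : EReal) < p.1.2 then ⊤ else ⊥

theorem intervalSpace_eq_top {p : Delta} {s t : ℝ} (h : s ≤ t)
    (hp : p.1.1 ≤ (s : EReal) ∧ (t : EReal) < p.1.2) : intervalSpace p t = ⊤ :=
  if_pos ⟨hp.1.trans (EReal.coe_le_coe_iff.2 h), hp.2⟩

/-- The structure map from time `s` to time `t` of the interval module `I(b, d)`: the identity of
`ℤ/2` if `b ≤ s ≤ t < d`, and `0` otherwise. -/
def intervalMap (p : Delta) {s t : ℝ} (h : s ≤ t) :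
    intervalSpace p s →ₗ[ZMod 2] intervalSpace p t :=
  open Classical in
  if hp : p.1.1 ≤ (s : EReal) ∧ (t : EReal) < p.1.2 then
    Submodule.inclusion ((intervalSpace_eq_top h hp).symm ▸ le_top)
  else 0

/-- `D` is a persistence diagram of the filtration `(K(t))`: there are isomorphisms
`H₀(K(t)) ≅ ⨁_{(b, d) ∈ D} I(b, d)_t`, `t ∈ ℝ`, that commute with the structure maps. The points of
the multiset `D` are indexed with multiplicity by the type `D.ToType`. -/
def IsPersistenceDiagram (x : ℕ → EReal) (D : Multiset Delta) : Prop :=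
  ∃ e : ∀ t : ℝ, H0 x t ≃ₗ[ZMod 2] ⨁ i : D.ToType, intervalSpace i.1 t,
    ∀ (s t : ℝ) (h : s ≤ t) (c : H0 x s) (i : D.ToType),
      e t (H0Map x h c) i = intervalMap i.1 h (e s c i)

open Classical in
/-- The persistence diagram `PD₀`, which exists and is unique as a multiset when only finitely
many of the `xᵢ` are different from `∞`. -/
def diagram (x : ℕ → EReal) : Multiset Delta :=
  if h : ∃ D, IsPersistenceDiagram x D then h.choose else 0

/-- The measure `ξ₀ = ∑_{(b, d) ∈ PD₀} δ_{(b, d)}` on `Δ`. -/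
def diagramMeasure (x : ℕ → EReal) : Measure Delta :=
  ((diagram x).map fun p => Measure.dirac p).sum

/-- The restriction of a measure on `Δ` to the Borel sets of `Δ ∩ ℝ²`. -/
def finPart (μ : Measure Delta) : Measure DeltaFin := μ.comap Subtype.val

open Classical in
/-- The points of the diagram with finite death. -/
def finPoints (x : ℕ → EReal) : Multiset Delta := (diagram x).filter fun p => p ∈ DeltaFin

/-- The sum of the lifetimes of the points with finite death. -/
def totalLifetime (x : ℕ → EReal) : ℝ := ((finPoints x).map lifetime).sum

/-- Persistent entropy (excluding the infinite bar). -/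
def persistentEntropy (x : ℕ → EReal) : ℝ :=
  -((finPoints x).map fun p =>
    lifetime p / totalLifetime x * Real.log (lifetime p / totalLifetime x)).sum

/-- The truncated ALPS statistic `∫₀ᴸ log ξ₀(Δ_ℓ) dℓ`. -/
def truncatedALPS (x : ℕ → EReal) (L : ℝ) : ℝ :=
  ∫ l in (0 : ℝ)..L, Real.log ((diagramMeasure x).real (DeltaGT l))

/-! ### Stochastic processes -/

/-- The values `X_{k,n}` at the vertices `v_k` for the sample `X₁, …, Xₙ`: `X_{0,n} = ∞`,
`X_{k,n} = X_k` for `1 ≤ k ≤ n` and `X_{k,n} = ∞` for `k > n`. The process is indexed from `0`,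
so `X_k` is `X (k - 1)`. -/
def sample {Ω : Type*} (X : ℕ → Ω → ℝ) (n : ℕ) (ω : Ω) (k : ℕ) : EReal :=
  if 1 ≤ k ∧ k ≤ n then (X (k - 1) ω : EReal) else ⊤

/-- `X` is (strictly) stationary and ergodic: the left shift on `ℝ^ℕ` preserves the law of
the process and is ergodic for it. -/
def IsStationaryErgodic {Ω : Type*} [MeasurableSpace Ω] (X : ℕ → Ω → ℝ) (P : Measure Ω) : Prop :=
  Ergodic (fun (x : ℕ → ℝ) (i : ℕ) => x (i + 1)) (P.map fun ω i => X i ω)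

/-- Weak convergence of measures, by bounded continuous test functions. -/
def WeaklyTendsto {S : Type*} [TopologicalSpace S] [MeasurableSpace S]
    (ν : ℕ → Measure S) (ν' : Measure S) : Prop :=
  ∀ f : S →ᵇ ℝ, Tendsto (fun n => ∫ p, f p ∂ν n) atTop (𝓝 (∫ p, f p ∂ν'))

/-- `μ / μ(S)`. -/
def normalized {S : Type*} [MeasurableSpace S] (μ : Measure S) : Measure S := (μ univ)⁻¹ • μ

/-- The moment condition `E[g(2|X₁|)^{1+ε}] < ∞` for some `ε > 0`. -/
def MomentCondition {Ω : Type*} [MeasurableSpace Ω] (X : ℕ → Ω → ℝ) (P : Measure Ω)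
    (g : ℝ → ℝ) : Prop :=
  ∃ ε : ℝ, 0 < ε ∧ Integrable (fun ω => g (2 * |X 0 ω|) ^ (1 + ε)) P

end

end SublevelPH

/-! The diagram is made explicit by the elder rule. Order the vertices by value: the vertex `i`
carries the bar from `x i` to the level at which it is joined to an older vertex. The class of `i`
plus that of such an older vertex generates one interval module, and together these classes
decompose `H₀` (`exists_equiv_of_elder`). The diagram is unique because the ranks of the structure
maps count bars in quadrants, and the counts on quadrants determine the diagram
(`finrank_range_H0Map`, `measure_ext_of_quadrant`).

The key point is that these counts are ergodic sums. The bars born by time `s` and alive at time `t`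
correspond to the components of `K(t)` with a vertex of value at most `s`. Mark each component by
its last such vertex: these are the indices of value at most `s` from which the path exceeds `t`
before it takes a value at most `s` again (`card_quadrant`). Up to an error of 1 at the end of the
sample, this counts the visits of the shift to `upcrossing s t`. Similarly, the number of bars is up
to 2 the number of local minima, whose frequency `p` is positive (`measure_localMin_pos`).
Birkhoff's theorem, proved here by the maximal sum argument, then gives almost sure convergence of
the normalized diagrams on rational quadrants.

For these values to come from a probability measure on `Δ`, no mass may escape. The averages that
are needed are collected in `IsTypical`; beyond it every argument is deterministic. In the compact
square `[-∞, ∞]²` a subsequence of the normalized diagrams converges. Mass cannot reach the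
diagonal: a bar that contains no point of a finite set `F` of rationals starts, away from the ends
of the sample, at a local minimum not separated from its neighbours by `F`, and such minima are rare
when `F` is large. Nor can it reach the lines on which birth or death is a given rational or
infinite number, since `X₁` has no atoms; deaths are controlled because they have the same
distribution as the maxima over edges (`sum_death_eq`). So the limit lives on finite bars and has
the prescribed values on rational quadrants (`exists_limit`). These values are common to all typical
sequences, and rational rectangles form a π-system with arbitrarily small neighbourhoods, so every
typical sequence has this weak limit, along the full sequence.

Entropy is a function of the averages of `ℓ` and `ℓ log ℓ` over the lifetimes `ℓ`. As `ℓ ≤ 2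
max(|b|, |d|)`, the moment condition makes both uniformly integrable (`sum_finBars_excess_le`), so
the averages converge. For the ALPS statistic, the masses of `Δ_ℓ` converge for almost every `ℓ`,
and `ξ₀(Δ_L) > 0` bounds their logarithms on `[0, L]`. -/

namespace SublevelPH

/-! ### Birkhoff's ergodic theorem -/

section Birkhoff

variable {α : Type*}

/-- The running maximum of the Birkhoff sums `S₀ = 0, S₁, …, Sₙ`. -/
def maxBirkhoffSum (T : α → α) (f : α → ℝ) : ℕ → α → ℝ
  | 0, _ => 0
  | n + 1, a => max 0 (f a + maxBirkhoffSum T f n (T a))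

theorem maxBirkhoffSum_nonneg (T : α → α) (f : α → ℝ) (n : ℕ) (a : α) :
    0 ≤ maxBirkhoffSum T f n a := by
  cases n <;> simp [maxBirkhoffSum]

theorem maxBirkhoffSum_le_succ (T : α → α) (f : α → ℝ) (n : ℕ) (a : α) :
    maxBirkhoffSum T f n a ≤ maxBirkhoffSum T f (n + 1) a := by
  induction n generalizing a with
  | zero => simp [maxBirkhoffSum]
  | succ n ih =>
    rw [maxBirkhoffSum, maxBirkhoffSum]
    gcongr
    exact ih _

theorem monotone_maxBirkhoffSum (T : α → α) (f : α → ℝ) (a : α) :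
    Monotone fun n => maxBirkhoffSum T f n a :=
  monotone_nat_of_le_succ fun n => maxBirkhoffSum_le_succ T f n a

theorem birkhoffSum_le_maxBirkhoffSum (T : α → α) (f : α → ℝ) (n : ℕ) (a : α) :
    birkhoffSum T f n a ≤ maxBirkhoffSum T f n a := by
  induction n generalizing a with
  | zero => simp [maxBirkhoffSum]
  | succ n ih =>
    rw [birkhoffSum_succ', maxBirkhoffSum]
    exact le_max_of_le_right (by gcongr; exact ih _)

variable [MeasurableSpace α] {T : α → α} {f : α → ℝ} {μ : Measure α}

theorem measurable_maxBirkhoffSum (hT : Measurable T) (hf : Measurable f) (n : ℕ) :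
    Measurable (maxBirkhoffSum T f n) := by
  induction n with
  | zero => exact measurable_const
  | succ n ih => exact measurable_const.max (hf.add (ih.comp hT))

theorem integrable_maxBirkhoffSum (hT : MeasurePreserving T μ μ) (hf : Integrable f μ)
    (n : ℕ) : Integrable (maxBirkhoffSum T f n) μ := by
  induction n with
  | zero => exact integrable_zero _ _ _
  | succ n ih =>
    exact (integrable_zero _ _ _).sup (hf.add (hT.integrable_comp_of_integrable ih))

/-- For an ergodic map, Birkhoff sums of a function with negative integral are bounded above. -/
theorem ae_bddAbove_birkhoffSum (hT : Ergodic T μ) (hfm : Measurable f) (hf : Integrable f μ)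
    (hneg : ∫ a, f a ∂μ < 0) :
    ∀ᵐ a ∂μ, BddAbove (range fun n => maxBirkhoffSum T f n a) := by
  set M := maxBirkhoffSum T f with hM
  set A : Set α := {a | BddAbove (range fun n => M n a)} with hA
  have hMm : ∀ n, Measurable (M n) := measurable_maxBirkhoffSum hT.measurable hfm
  have hAm : MeasurableSet A := measurableSet_bddAbove_range hMm
  have hinv : T ⁻¹' A = A := by
    ext a
    simp only [hA, mem_preimage, mem_ofPred_eq]
    constructor
    · rintro ⟨c, hc⟩
      refine ⟨max 0 (f a + c), ?_⟩
      rintro _ ⟨n, rfl⟩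
      cases n with
      | zero => exact le_max_left _ _
      | succ n =>
        change max 0 (f a + M n (T a)) ≤ _
        gcongr
        exact hc ⟨n, rfl⟩
    · rintro ⟨c, hc⟩
      refine ⟨c - f a, ?_⟩
      rintro _ ⟨n, rfl⟩
      have h1 : max 0 (f a + M n (T a)) ≤ c := hc ⟨n + 1, rfl⟩
      have h2 := (le_max_right _ _).trans h1
      simp only
      linarith
  rcases hT.toPreErgodic.ae_mem_or_ae_notMem hAm hinv with h | h
  · exact h
  exfalso
  have hint : ∀ n, Integrable (M n) μ := integrable_maxBirkhoffSum hT.toMeasurePreserving hf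
  -- The integrand is `max (-M n (T a)) (f a)`: it is bounded by `|f a|`, and equals `f a` once `M n
  -- (T a) ≥ -f a`, which happens because the sums are unbounded at almost every point.
  have hlim : Tendsto (fun n => ∫ a, (M (n + 1) a - M n (T a)) ∂μ) atTop (𝓝 (∫ a, f a ∂μ)) := by
    refine tendsto_integral_of_dominated_convergence (fun a => |f a|) (fun n => ?_) hf.abs
      (fun n => ae_of_all _ fun a => ?_) ?_
    · exact ((hMm _).sub ((hMm _).comp hT.measurable)).aestronglyMeasurable
    · have h0 := maxBirkhoffSum_nonneg T f n (T a)
      change |max 0 (f a + M n (T a)) - M n (T a)| ≤ |f a|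
      rw [abs_le]
      rcases max_cases 0 (f a + M n (T a)) with ⟨h1, h2⟩ | ⟨h1, h2⟩ <;> rw [h1]
      · have := neg_abs_le (f a)
        have := abs_nonneg (f a)
        constructor <;> linarith
      · have := neg_abs_le (f a)
        have := le_abs_self (f a)
        constructor <;> linarith
    · filter_upwards [h] with a ha
      have ha' : T a ∉ A := fun h' => ha (by rw [← hinv]; exact h')
      have ht : Tendsto (fun n => M n (T a)) atTop atTop :=
        tendsto_atTop_atTop_of_monotone' (monotone_maxBirkhoffSum T f (T a)) ha'
      refine tendsto_const_nhds.congr' ?_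
      filter_upwards [ht.eventually_ge_atTop (-f a)] with n hn
      change f a = max 0 (f a + M n (T a)) - M n (T a)
      rw [max_eq_right (by linarith)]
      ring
  -- By invariance of `μ` the integrals in `hlim` are those of `M (n + 1) - M n ≥ 0`.
  have hge : 0 ≤ ∫ a, f a ∂μ := by
    refine ge_of_tendsto' hlim fun n => ?_
    have hc : Integrable (fun a => M n (T a)) μ :=
      hT.toMeasurePreserving.integrable_comp_of_integrable (hint n)
    rw [integral_sub (hint _) hc]
    have : ∫ a, M n (T a) ∂μ = ∫ a, M n a ∂μ := by
      have h3 := integral_map (μ := μ) hT.measurable.aemeasurable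
        (f := M n) (by rw [hT.map_eq]; exact (hMm n).aestronglyMeasurable)
      rw [hT.map_eq] at h3
      exact h3.symm
    rw [this, sub_nonneg]
    exact integral_mono (hint _) (hint _) fun a => maxBirkhoffSum_le_succ T f n a
  linarith

/-- For `c'` between the mean and `c`, the sums of `f - c'` have an upper bound `K`, so the averages
of `f` are at most `c' + K / n`. -/
theorem ae_eventually_birkhoffSum_le [IsProbabilityMeasure μ] (hT : Ergodic T μ)
    (hfm : Measurable f) (hf : Integrable f μ) {c : ℝ} (hc : ∫ a, f a ∂μ < c) :
    ∀ᵐ a ∂μ, ∀ᶠ n : ℕ in atTop, birkhoffSum T f n a / n < c := by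
  obtain ⟨c', h1, h2⟩ := exists_between hc
  have hg : Integrable (fun a => f a - c') μ := hf.sub (integrable_const _)
  have := ae_bddAbove_birkhoffSum hT (hfm.sub_const c') hg (by
    rw [integral_sub hf (integrable_const _)]; simpa using h1)
  filter_upwards [this] with a ⟨K, hK⟩
  have hlim : Tendsto (fun n : ℕ => K / n) atTop (𝓝 0) := tendsto_const_div_atTop_nhds_zero_nat K
  filter_upwards [hlim.eventually_lt_const (sub_pos.2 h2), eventually_gt_atTop 0] with n hn hn0
  have hb := (birkhoffSum_le_maxBirkhoffSum T (fun a => f a - c') n a).trans (hK ⟨n, rfl⟩)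
  have hn' : (0 : ℝ) < n := Nat.cast_pos.2 hn0
  have hs : birkhoffSum T (fun a => f a - c') n a = birkhoffSum T f n a - n * c' := by
    simp [birkhoffSum, Finset.sum_sub_distrib]
  rw [hs] at hb
  rw [div_lt_iff₀ hn'] at hn ⊢
  linarith

/-- **Birkhoff's pointwise ergodic theorem** for ergodic maps. -/
theorem ae_tendsto_birkhoffSum_div [IsProbabilityMeasure μ] (hT : Ergodic T μ)
    (hfm : Measurable f) (hf : Integrable f μ) :
    ∀ᵐ a ∂μ, Tendsto (fun n : ℕ => birkhoffSum T f n a / n) atTop (𝓝 (∫ a, f a ∂μ)) := by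
  have hup : ∀ᵐ a ∂μ, ∀ q : ℚ, ∫ a, f a ∂μ < q →
      ∀ᶠ n : ℕ in atTop, birkhoffSum T f n a / n < q := by
    rw [ae_all_iff]
    intro q
    by_cases h : ∫ a, f a ∂μ < q
    · filter_upwards [ae_eventually_birkhoffSum_le hT hfm hf h] with a ha _ using ha
    · exact ae_of_all _ fun a h' => absurd h' h
  have hlo : ∀ᵐ a ∂μ, ∀ q : ℚ, (q : ℝ) < ∫ a, f a ∂μ →
      ∀ᶠ n : ℕ in atTop, (q : ℝ) < birkhoffSum T f n a / n := by
    rw [ae_all_iff]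
    intro q
    by_cases h : (q : ℝ) < ∫ a, f a ∂μ
    · filter_upwards [ae_eventually_birkhoffSum_le hT hfm.neg hf.neg (c := -q)
        (by simp only [Pi.neg_apply, integral_neg]; linarith)] with a ha _
      filter_upwards [ha] with n hn
      rw [birkhoffSum_neg] at hn
      rw [neg_div] at hn
      linarith
    · exact ae_of_all _ fun a h' => absurd h' h
  filter_upwards [hup, hlo] with a h1 h2
  rw [tendsto_order]
  constructor
  · intro b hb
    obtain ⟨q, hq1, hq2⟩ := exists_rat_btwn hb
    filter_upwards [h2 q hq2] with n hn using hq1.trans hn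
  · intro b hb
    obtain ⟨q, hq1, hq2⟩ := exists_rat_btwn hb
    filter_upwards [h1 q hq1] with n hn using hn.trans hq2

end Birkhoff

end SublevelPH

/-! ### Existence of the interval decomposition -/

namespace SublevelPH

noncomputable section

/-! ### Components and deaths -/

/-- The vertices are ordered by value, with ties broken by the index. -/
def key (x : ℕ → EReal) (i : ℕ) : EReal ×ₗ ℕ := toLex (x i, i)

theorem key_injective (x : ℕ → EReal) : Function.Injective (key x) := fun i j h => by
  exact congrArg (fun p => (ofLex p).2) h

theorem le_of_key_lt {x : ℕ → EReal} {i j : ℕ} (h : key x i < key x j) : x i ≤ x j := by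
  rcases Prod.Lex.lt_iff.1 h with h | h
  · exact h.le
  · exact h.1.le

theorem le_of_key_le {x : ℕ → EReal} {i j : ℕ} (h : key x i ≤ key x j) : x i ≤ x j := by
  rcases h.lt_or_eq with h | h
  · exact le_of_key_lt h
  · rw [key_injective x h]

/-- The time at which the vertices `i` and `j` become connected. -/
def level (x : ℕ → EReal) (i j : ℕ) : EReal := (Finset.uIcc i j).sup x

theorem level_le_iff {x : ℕ → EReal} {i j : ℕ} {t : EReal} :
    level x i j ≤ t ↔ ∀ k ∈ Finset.uIcc i j, x k ≤ t := Finset.sup_le_iff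

theorem level_comm (x : ℕ → EReal) (i j : ℕ) : level x i j = level x j i := by
  rw [level, Finset.uIcc_comm, level]

@[simp] theorem level_self (x : ℕ → EReal) (i : ℕ) : level x i i = x i := by
  simp [level]

theorem level_trans {x : ℕ → EReal} {i j k : ℕ} {t : EReal} (h : level x i j ≤ t)
    (h' : level x j k ≤ t) : level x i k ≤ t := by
  rw [level_le_iff] at *
  intro l hl
  have : l ∈ Finset.uIcc i j ∨ l ∈ Finset.uIcc j k := by
    simp only [Finset.mem_uIcc] at *
    omega
  exact this.elim (h l) (h' l)

theorem left_le_level (x : ℕ → EReal) (i j : ℕ) : x i ≤ level x i j :=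
  Finset.le_sup Finset.left_mem_uIcc

theorem right_le_level (x : ℕ → EReal) (i j : ℕ) : x j ≤ level x i j :=
  Finset.le_sup Finset.right_mem_uIcc

theorem exists_level_eq (x : ℕ → EReal) (i j : ℕ) : ∃ k ∈ Finset.uIcc i j, level x i j = x k :=
  Finset.exists_mem_eq_sup _ ⟨i, Finset.left_mem_uIcc⟩ x

/-- The time at which the vertex `i` becomes connected to an older one. -/
def death (x : ℕ → EReal) (i : ℕ) : EReal := ⨅ (j) (_ : key x j < key x i), level x i j

theorem death_le_level {x : ℕ → EReal} {i j : ℕ} (h : key x j < key x i) :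
    death x i ≤ level x i j := iInf₂_le j h

theorem le_death (x : ℕ → EReal) (i : ℕ) : x i ≤ death x i :=
  le_iInf₂ fun j _ => left_le_level x i j

/-- Levels are values of `x`, of which there are finitely many, so the infimum that defines the
death is attained. -/
theorem exists_level_le_death {x : ℕ → EReal} {N : ℕ} (hN : ∀ i, N ≤ i → x i = ⊤) {i : ℕ}
    (hi : death x i ≠ ⊤) : ∃ j, key x j < key x i ∧ level x i j ≤ death x i := by
  have hfin : (range x).Finite := by
    refine ((Finset.range N).image x ∪ {⊤}).finite_toSet.subset ?_
    rintro _ ⟨k, rfl⟩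
    rcases lt_or_ge k N with h | h
    · simp only [Finset.coe_union, Finset.coe_image, Finset.coe_range, Finset.coe_singleton]
      exact Or.inl ⟨k, h, rfl⟩
    · simp [hN k h]
  set S : Set EReal := {l | ∃ j, key x j < key x i ∧ l = level x i j} with hS
  have hSf : S.Finite := hfin.subset <| by
    rintro _ ⟨j, _, rfl⟩
    obtain ⟨k, _, hk⟩ := exists_level_eq x i j
    exact ⟨k, hk.symm⟩
  have hSn : S.Nonempty := by
    by_contra h
    rw [not_nonempty_iff_eq_empty] at h
    refine hi (top_le_iff.1 (le_iInf₂ fun j hj => ?_))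
    have : level x i j ∈ S := ⟨j, hj, rfl⟩
    simp [h] at this
  obtain ⟨l, ⟨j, hj, rfl⟩, hmin⟩ := hSf.exists_minimal hSn
  refine ⟨j, hj, le_iInf₂ fun k hk => ?_⟩
  rcases le_total (level x i j) (level x i k) with h | h
  · exact h
  · exact hmin ⟨k, hk, rfl⟩ h

theorem death_le_iff {x : ℕ → EReal} {N : ℕ} (hN : ∀ i, N ≤ i → x i = ⊤) {i : ℕ} {t : EReal}
    (ht : t ≠ ⊤) : death x i ≤ t ↔ ∃ j, key x j < key x i ∧ level x i j ≤ t := by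
  constructor
  · intro h
    obtain ⟨j, hj, hl⟩ := exists_level_le_death hN (ne_top_of_le_ne_top ht h)
    exact ⟨j, hj, hl.trans h⟩
  · rintro ⟨j, hj, hl⟩
    exact (death_le_level hj).trans hl

/-! ### The homology classes of the vertices -/

variable {x : ℕ → EReal}

open Classical in
/-- The class of the vertex `i` in `H₀(K(t))`, and `0` if it is not in `K(t)`. -/
def vertexClass (x : ℕ → EReal) (t : ℝ) (i : ℕ) : H0 x t :=
  if h : x i ≤ (t : EReal) then Submodule.Quotient.mk (Finsupp.single ⟨i, h⟩ 1) else 0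

theorem H0Map_vertexClass {s t : ℝ} (h : s ≤ t) {i : ℕ} (hi : x i ≤ (s : EReal)) :
    H0Map x h (vertexClass x s i) = vertexClass x t i := by
  have hi' : x i ≤ (t : EReal) := hi.trans (EReal.coe_le_coe_iff.2 h)
  rw [vertexClass, vertexClass, dif_pos hi, dif_pos hi', H0Map, Submodule.mapQ_apply]
  simp [Finsupp.mapDomain_single, Vertex.incl]

theorem add_self_H0 {t : ℝ} (c : H0 x t) : c + c = 0 := by
  rw [← two_smul (ZMod 2) c, show (2 : ZMod 2) = 0 from rfl, zero_smul]

theorem vertexClass_succ {t : ℝ} {i : ℕ} (hi : x i ≤ (t : EReal))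
    (hi' : x (i + 1) ≤ (t : EReal)) : vertexClass x t i = vertexClass x t (i + 1) := by
  have h : vertexClass x t i + vertexClass x t (i + 1) = 0 := by
    rw [vertexClass, vertexClass, dif_pos hi, dif_pos hi', ← Submodule.Quotient.mk_add,
      Submodule.Quotient.mk_eq_zero]
    refine ⟨Finsupp.single ⟨i, max_le hi hi'⟩ 1, ?_⟩
    simp [boundary, Edge.left, Edge.right]
  calc _ = vertexClass x t i + (vertexClass x t (i + 1) + vertexClass x t (i + 1)) := by
        rw [add_self_H0, add_zero]
    _ = _ := by rw [← add_assoc, h, zero_add]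

theorem vertexClass_eq_of_le {t : ℝ} {i j : ℕ} (hij : i ≤ j)
    (h : ∀ k, i ≤ k → k ≤ j → x k ≤ (t : EReal)) : vertexClass x t i = vertexClass x t j := by
  induction j, hij using Nat.le_induction with
  | base => rfl
  | succ j hj ih =>
    rw [ih fun k h1 h2 => h k h1 (by omega)]
    exact vertexClass_succ (h j hj (by omega)) (h (j + 1) (by omega) le_rfl)

theorem vertexClass_eq {t : ℝ} {i j : ℕ} (h : level x i j ≤ (t : EReal)) :
    vertexClass x t i = vertexClass x t j := by
  rw [level_le_iff] at h
  rcases le_total i j with hij | hij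
  · exact vertexClass_eq_of_le hij fun k h1 h2 => h k (by simp [Finset.mem_uIcc]; omega)
  · exact (vertexClass_eq_of_le hij fun k h1 h2 => h k (by simp [Finset.mem_uIcc]; omega)).symm

theorem span_vertexClass (x : ℕ → EReal) (t : ℝ) (S : Submodule (ZMod 2) (H0 x t))
    (hS : ∀ i, x i ≤ (t : EReal) → vertexClass x t i ∈ S) : S = ⊤ := by
  rw [eq_top_iff]
  rintro c -
  obtain ⟨c, rfl⟩ := Submodule.Quotient.mk_surjective _ c
  induction c using Finsupp.induction_linear with
  | zero => simp
  | add c d hc hd => rw [Submodule.Quotient.mk_add]; exact S.add_mem hc hd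
  | single v a =>
    have := S.smul_mem a (hS v.1 v.2)
    rw [vertexClass, dif_pos v.2, ← Submodule.Quotient.mk_smul] at this
    simpa using this

open Classical in
/-- The functional on `H₀(K(t))` that counts the vertices connected to `m`. -/
def componentFunctional (x : ℕ → EReal) (t : ℝ) (m : ℕ) : H0 x t →ₗ[ZMod 2] ZMod 2 :=
  Submodule.liftQ _ (Finsupp.linearCombination (ZMod 2) fun v : Vertex x t =>
    if level x m v.1 ≤ (t : EReal) then (1 : ZMod 2) else 0) <| by
    rintro _ ⟨c, rfl⟩
    rw [LinearMap.mem_ker]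
    induction c using Finsupp.induction_linear with
    | zero => simp
    | add c d hc hd => rw [map_add, map_add, hc, hd, add_zero]
    | single e a =>
      have he : level x e.1 (e.1 + 1) ≤ (t : EReal) := by
        rw [level_le_iff]
        intro k hk
        have : k = e.1 ∨ k = e.1 + 1 := by
          rw [Finset.mem_uIcc] at hk
          omega
        rcases this with rfl | rfl
        · exact (le_max_left _ _).trans e.2
        · exact (le_max_right _ _).trans e.2
      -- Both ends of an edge of `K(t)` are connected to `m` or neither is, so the functional takes
      -- the value `1 + 1 = 0` or `0` on the boundary of the edge.
      have : level x m e.1 ≤ (t : EReal) ↔ level x m (e.1 + 1) ≤ (t : EReal) :=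
        ⟨fun h => level_trans h he, fun h => level_trans h (by rwa [level_comm])⟩
      by_cases h : level x m (e.1 + 1) ≤ (t : EReal)
      · simp [boundary, Edge.left, Edge.right, this, h, CharTwo.add_self_eq_zero]
      · simp [boundary, Edge.left, Edge.right, this, h]

open Classical in
theorem componentFunctional_vertexClass (t : ℝ) (m : ℕ) {i : ℕ} (hi : x i ≤ (t : EReal)) :
    componentFunctional x t m (vertexClass x t i) =
      if level x m i ≤ (t : EReal) then 1 else 0 := by
  rw [vertexClass, dif_pos hi, componentFunctional, ← Submodule.mkQ_apply, Submodule.mkQ_apply,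
    Submodule.liftQ_apply]
  simp

/-! ### The elder rule -/

open Classical in
/-- An older vertex to which `i` is connected at its death, if any. -/
def ancestor (x : ℕ → EReal) (i : ℕ) : ℕ :=
  if h : ∃ j, key x j < key x i ∧ level x i j ≤ death x i then h.choose else i

theorem ancestor_spec {N : ℕ} (hN : ∀ i, N ≤ i → x i = ⊤) {i : ℕ} (hi : death x i ≠ ⊤) :
    key x (ancestor x i) < key x i ∧ level x i (ancestor x i) ≤ death x i := by
  have h := exists_level_le_death hN hi
  rw [ancestor, dif_pos h]
  exact h.choose_spec

open Classical in
/-- The cycle born with the vertex `i`. -/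
def barClass (x : ℕ → EReal) (t : ℝ) (i : ℕ) : H0 x t :=
  vertexClass x t i + if death x i = ⊤ then 0 else vertexClass x t (ancestor x i)

theorem H0Map_barClass {N : ℕ} (hN : ∀ i, N ≤ i → x i = ⊤) {s t : ℝ} (h : s ≤ t) {i : ℕ}
    (hi : x i ≤ (s : EReal)) : H0Map x h (barClass x s i) = barClass x t i := by
  rw [barClass, barClass, map_add, H0Map_vertexClass h hi]
  split_ifs with hd
  · rw [map_zero]
  · rw [H0Map_vertexClass h ((le_of_key_lt (ancestor_spec hN hd).1).trans hi)]

/-- From the death of `i` on, `i` and its ancestor lie in one component, and their classes cancel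
modulo 2. -/
theorem barClass_eq_zero {N : ℕ} (hN : ∀ i, N ≤ i → x i = ⊤) {t : ℝ} {i : ℕ}
    (hi : death x i ≤ (t : EReal)) : barClass x t i = 0 := by
  have hd : death x i ≠ ⊤ := ne_top_of_le_ne_top (EReal.coe_ne_top t) hi
  rw [barClass, if_neg hd, ← vertexClass_eq ((ancestor_spec hN hd).2.trans hi), add_self_H0]

open Classical in
/-- The bars of the elder rule, as the map from the sum of the interval modules. -/
def barMap {ι : Type*} (x : ℕ → EReal) (p : ι → Delta) (idx : ι → ℕ) (t : ℝ) :
    (⨁ i, intervalSpace (p i) t) →ₗ[ZMod 2] H0 x t :=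
  DirectSum.toModule (ZMod 2) ι (H0 x t) fun i =>
    (LinearMap.toSpanSingleton (ZMod 2) (H0 x t) (barClass x t (idx i))).comp
      (intervalSpace (p i) t).subtype

theorem barMap_of {ι : Type*} [DecidableEq ι] (p : ι → Delta) (idx : ι → ℕ) (t : ℝ) (i : ι)
    (a : intervalSpace (p i) t) :
    barMap x p idx t (DirectSum.lof (ZMod 2) ι (fun i => intervalSpace (p i) t) i a) =
      (a : ZMod 2) • barClass x t (idx i) := by
  classical
  rw [barMap]
  exact DirectSum.toModule_lof (ZMod 2) (M := fun i => intervalSpace (p i) t) i a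

theorem intervalSpace_eq_bot {p : Delta} {t : ℝ}
    (hp : ¬(p.1.1 ≤ (t : EReal) ∧ (t : EReal) < p.1.2)) : intervalSpace p t = ⊥ := if_neg hp

theorem alive_of_ne_zero {p : Delta} {t : ℝ} {a : intervalSpace p t} (ha : a ≠ 0) :
    p.1.1 ≤ (t : EReal) ∧ (t : EReal) < p.1.2 := by
  by_contra h
  exact ha (Subtype.ext ((Submodule.mem_bot _).1 ((intervalSpace_eq_bot h).le a.2)))

theorem intervalMap_coe {p : Delta} {s t : ℝ} (h : s ≤ t)
    (hp : p.1.1 ≤ (s : EReal) ∧ (t : EReal) < p.1.2) (a : intervalSpace p s) :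
    (intervalMap p h a : ZMod 2) = a := by
  rw [intervalMap, dif_pos hp]
  rfl

theorem intervalMap_eq_zero {p : Delta} {s t : ℝ} (h : s ≤ t)
    (hp : ¬(p.1.1 ≤ (s : EReal) ∧ (t : EReal) < p.1.2)) (a : intervalSpace p s) :
    intervalMap p h a = 0 := by
  rw [intervalMap, dif_neg hp]
  rfl

section Elder

variable {ι : Type*} {p : ι → Delta} {idx : ι → ℕ} {N : ℕ}

theorem barMap_naturality (hN : ∀ i, N ≤ i → x i = ⊤)
    (hp : ∀ i, (p i).1 = (x (idx i), death x (idx i))) {s t : ℝ} (h : s ≤ t)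
    (w : ⨁ i, intervalSpace (p i) s) :
    H0Map x h (barMap x p idx s w) =
      barMap x p idx t (DirectSum.lmap (fun i => intervalMap (p i) h) w) := by
  classical
  induction w using DirectSum.induction_on with
  | zero => simp
  | add v w hv hw => rw [map_add, map_add, map_add, map_add, hv, hw]
  | of i a =>
    rw [← DirectSum.lof_eq_of (ZMod 2), DirectSum.lmap_lof, barMap_of, barMap_of, map_smul]
    by_cases ha : a = 0
    · simp [ha]
    have hs := alive_of_ne_zero ha
    rw [hp i] at hs
    rw [H0Map_barClass hN h hs.1]
    by_cases ht : (t : EReal) < death x (idx i)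
    · rw [intervalMap_coe h (by rw [hp i]; exact ⟨hs.1, ht⟩)]
    · rw [barClass_eq_zero hN (not_lt.1 ht), smul_zero, smul_zero]

/-- Induction on the number of older vertices: the class of a vertex alive at `t` is its bar class
minus the class of an older vertex or 0, and the class of a dead one equals that of an older vertex.
-/
theorem barMap_surjective (hN : ∀ i, N ≤ i → x i = ⊤)
    (hp : ∀ i, (p i).1 = (x (idx i), death x (idx i)))
    (hrange : ∀ k, x k < death x k → k ∈ range idx) (t : ℝ) :
    Function.Surjective (barMap x p idx t) := by
  classical
  rw [← LinearMap.range_eq_top]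
  apply span_vertexClass
  have hlt : ∀ k, x k ≤ (t : EReal) → k < N := fun k hk => by
    by_contra h
    rw [hN k (not_lt.1 h)] at hk
    exact EReal.coe_ne_top t (top_le_iff.1 hk)
  have key_ind : ∀ n k, ((Finset.range N).filter fun j => key x j < key x k).card = n →
      x k ≤ (t : EReal) → vertexClass x t k ∈ LinearMap.range (barMap x p idx t) := by
    intro n
    induction n using Nat.strong_induction_on with
    | _ n ih =>
      rintro k rfl hk
      have hold : ∀ j, key x j < key x k →
          vertexClass x t j ∈ LinearMap.range (barMap x p idx t) := by
        intro j hj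
        have hjt := (le_of_key_lt hj).trans hk
        refine ih _ (Finset.card_lt_card ?_) j rfl hjt
        refine ⟨fun l hl => ?_, fun hsub => ?_⟩
        · rw [Finset.mem_filter] at hl ⊢
          exact ⟨hl.1, hl.2.trans hj⟩
        · have := hsub (Finset.mem_filter.2 ⟨Finset.mem_range.2 (hlt j hjt), hj⟩)
          exact lt_irrefl _ (Finset.mem_filter.1 this).2
      by_cases hd : (t : EReal) < death x k
      · obtain ⟨i, rfl⟩ := hrange k (hk.trans_lt hd)
        have hbar : barClass x t (idx i) ∈ LinearMap.range (barMap x p idx t) := by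
          have htop : intervalSpace (p i) t = ⊤ :=
            intervalSpace_eq_top le_rfl (by rw [hp i]; exact ⟨hk, hd⟩)
          refine ⟨DirectSum.lof (ZMod 2) ι _ i ⟨1, by rw [htop]; trivial⟩, ?_⟩
          rw [barMap_of, one_smul]
        have hanc : (if death x (idx i) = ⊤ then 0 else vertexClass x t (ancestor x (idx i))) ∈
            LinearMap.range (barMap x p idx t) := by
          split_ifs with hdt
          · exact Submodule.zero_mem _
          · exact hold _ (ancestor_spec hN hdt).1
        have := Submodule.sub_mem _ hbar hanc
        rwa [barClass, add_sub_cancel_right] at this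
      · obtain ⟨j, hj, hl⟩ := (death_le_iff hN (EReal.coe_ne_top t)).1 (not_lt.1 hd)
        rw [vertexClass_eq hl]
        exact hold j hj
  exact fun k hk => key_ind _ k rfl hk

/-- Let `m` index the youngest vertex in the support of a kernel element. As its bar is alive, no
older vertex lies in its component at time `t`, so the functional of this component sees only the
coefficient at `m`, which must vanish. -/
theorem barMap_injective (hN : ∀ i, N ≤ i → x i = ⊤)
    (hp : ∀ i, (p i).1 = (x (idx i), death x (idx i))) (hidx : Function.Injective idx) (t : ℝ) :
    Function.Injective (barMap x p idx t) := by
  classical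
  rw [injective_iff_map_eq_zero]
  intro w hw
  by_contra hne
  have hsupp : (DFinsupp.support w).Nonempty := by
    rw [Finset.nonempty_iff_ne_empty]
    exact fun h => hne (DFinsupp.support_eq_empty.1 h)
  obtain ⟨m, hm, hmax⟩ := Finset.exists_max_image _ (fun i => key x (idx i)) hsupp
  have halive : ∀ i ∈ DFinsupp.support w,
      x (idx i) ≤ (t : EReal) ∧ (t : EReal) < death x (idx i) := fun i hi => by
    have := alive_of_ne_zero (DFinsupp.mem_support_iff.1 hi)
    rwa [hp i] at this
  have hfar : ∀ j, key x j < key x (idx m) → ¬level x (idx m) j ≤ (t : EReal) := fun j hj hl =>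
    not_le.2 (halive m hm).2 ((death_le_level hj).trans hl)
  have hval : ∀ i ∈ DFinsupp.support w,
      componentFunctional x t (idx m) (barClass x t (idx i)) = if i = m then 1 else 0 := by
    intro i hi
    have hanc : componentFunctional x t (idx m)
        (if death x (idx i) = ⊤ then 0 else vertexClass x t (ancestor x (idx i))) = 0 := by
      split_ifs with hd
      · exact map_zero _
      · have h1 := (ancestor_spec hN hd).1
        rw [componentFunctional_vertexClass t _ ((le_of_key_lt h1).trans (halive i hi).1),
          if_neg (hfar _ (h1.trans_le (hmax i hi)))]
    rw [barClass, map_add, hanc, add_zero,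
      componentFunctional_vertexClass t _ (halive i hi).1]
    by_cases him : i = m
    · rw [him, if_pos rfl, if_pos (by rw [level_self]; exact (halive m hm).1)]
    · rw [if_neg him, if_neg]
      refine hfar _ ((hmax i hi).lt_of_ne fun h => him (hidx (key_injective x h)))
  have hsum : componentFunctional x t (idx m) (barMap x p idx t w) = (w m : ZMod 2) := by
    conv_lhs => rw [← DirectSum.sum_support_of w]
    rw [map_sum, map_sum, Finset.sum_eq_single m]
    · rw [← DirectSum.lof_eq_of (ZMod 2), barMap_of, map_smul, hval m hm, if_pos rfl, smul_eq_mul, mul_one]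
    · intro i hi him
      rw [← DirectSum.lof_eq_of (ZMod 2), barMap_of, map_smul, hval i hi, if_neg him, smul_zero]
    · exact fun h => absurd hm h
  rw [hw, map_zero] at hsum
  exact DFinsupp.mem_support_iff.1 hm (Subtype.ext hsum.symm)

theorem exists_equiv_of_elder (hN : ∀ i, N ≤ i → x i = ⊤)
    (hp : ∀ i, (p i).1 = (x (idx i), death x (idx i))) (hidx : Function.Injective idx)
    (hrange : ∀ k, x k < death x k → k ∈ range idx) :
    ∃ e : ∀ t : ℝ, H0 x t ≃ₗ[ZMod 2] ⨁ i, intervalSpace (p i) t,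
      ∀ (s t : ℝ) (h : s ≤ t) (c : H0 x s) (i : ι),
        e t (H0Map x h c) i = intervalMap (p i) h (e s c i) := by
  refine ⟨fun t => (LinearEquiv.ofBijective (barMap x p idx t)
    ⟨barMap_injective hN hp hidx t, barMap_surjective hN hp hrange t⟩).symm, ?_⟩
  intro s t h c i
  obtain ⟨w, rfl⟩ := barMap_surjective hN hp hrange s c
  rw [barMap_naturality hN hp h]
  have key_eq : ∀ (r : ℝ) (v : ⨁ i, intervalSpace (p i) r),
      (LinearEquiv.ofBijective (barMap x p idx r)
        ⟨barMap_injective hN hp hidx r, barMap_surjective hN hp hrange r⟩).symm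
        (barMap x p idx r v) = v := fun r v => LinearEquiv.ofBijective_symm_apply_apply _ v
  rw [key_eq, key_eq, DirectSum.lmap_apply]

end Elder

end

end SublevelPH

/-! ### Quadrants determine the diagram -/

namespace SublevelPH

noncomputable section

/-! ### Rectangles in the set of bars -/

/-- The bars that are born up to time `s` and are alive at time `t`. -/
def quadrant (s t : EReal) : Set Delta := {p | p.1.1 ≤ s ∧ t < p.1.2}

/-- The bars with birth in `(s₁, s₂]` and death in `(t₁, t₂]`. -/
def rect (s₁ s₂ t₁ t₂ : EReal) : Set Delta :=
  {p | (s₁ < p.1.1 ∧ p.1.1 ≤ s₂) ∧ t₁ < p.1.2 ∧ p.1.2 ≤ t₂}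

instance : BorelSpace Delta := Subtype.borelSpace _

theorem continuous_birth : Continuous fun p : Delta => p.1.1 :=
  continuous_fst.comp continuous_subtype_val

theorem continuous_death : Continuous fun p : Delta => p.1.2 :=
  continuous_snd.comp continuous_subtype_val

theorem measurableSet_quadrant (s t : EReal) : MeasurableSet (quadrant s t) :=
  (measurableSet_le continuous_birth.measurable measurable_const).inter
    (measurableSet_lt measurable_const continuous_death.measurable)

theorem quadrant_inter (s t s' t' : EReal) :
    quadrant s t ∩ quadrant s' t' = quadrant (min s s') (max t t') := by
  ext p
  simp only [quadrant, mem_inter_iff, mem_ofPred_eq, le_min_iff, max_lt_iff]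
  tauto

theorem rect_eq {s₁ s₂ t₁ t₂ : EReal} :
    rect s₁ s₂ t₁ t₂ = quadrant s₂ t₁ \ (quadrant s₁ t₁ ∪ quadrant s₂ t₂) := by
  ext p
  simp only [quadrant, rect, Set.mem_sdiff, mem_union, mem_ofPred_eq, not_or, not_and, not_lt]
  constructor
  · rintro ⟨⟨h1, h2⟩, h3, h4⟩
    exact ⟨⟨h2, h3⟩, fun h => absurd h1 (not_lt.2 h), fun _ => h4⟩
  · rintro ⟨⟨h1, h2⟩, h3, h4⟩
    exact ⟨⟨not_le.1 fun h => absurd h2 (not_lt.2 (h3 h)), h1⟩, h2, h4 h1⟩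

theorem measurableSet_rect (s₁ s₂ t₁ t₂ : EReal) : MeasurableSet (rect s₁ s₂ t₁ t₂) := by
  rw [rect_eq]
  exact (measurableSet_quadrant _ _).diff
    ((measurableSet_quadrant _ _).union (measurableSet_quadrant _ _))

theorem rect_inter (s₁ s₂ t₁ t₂ s₁' s₂' t₁' t₂' : EReal) :
    rect s₁ s₂ t₁ t₂ ∩ rect s₁' s₂' t₁' t₂' =
      rect (max s₁ s₁') (min s₂ s₂') (max t₁ t₁') (min t₂ t₂') := by
  ext p
  simp only [rect, mem_inter_iff, mem_ofPred_eq, le_min_iff, max_lt_iff]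
  tauto

/-- Inclusion and exclusion: the two removed quadrants meet in `quadrant s₁ t₂`. -/
theorem measureReal_rect (μ : Measure Delta) [IsFiniteMeasure μ] {s₁ s₂ t₁ t₂ : EReal}
    (hs : s₁ ≤ s₂) (ht : t₁ ≤ t₂) :
    μ.real (rect s₁ s₂ t₁ t₂) = μ.real (quadrant s₂ t₁) -
      (μ.real (quadrant s₁ t₁) + μ.real (quadrant s₂ t₂) - μ.real (quadrant s₁ t₂)) := by
  have hsub : quadrant s₁ t₁ ∪ quadrant s₂ t₂ ⊆ quadrant s₂ t₁ := by
    rintro p (h | h)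
    · exact ⟨h.1.trans hs, h.2⟩
    · exact ⟨h.1, ht.trans_lt h.2⟩
  rw [rect_eq, measureReal_sdiff hsub
    ((measurableSet_quadrant _ _).union (measurableSet_quadrant _ _))]
  have := measureReal_union_add_inter (μ := μ) (s := quadrant s₁ t₁)
    (measurableSet_quadrant s₂ t₂)
  rw [quadrant_inter, min_eq_left hs, max_eq_right ht] at this
  linarith

/-- The rectangles with rational corners and death possibly unbounded. -/
def rationalRects : Set (Set Delta) :=
  {A | ∃ (s₁ s₂ t₁ : ℚ) (t₂ : EReal), (s₁ ≤ s₂ ∧ s₂ ≤ t₁ ∧ ((t₁ : ℝ) : EReal) ≤ t₂ ∧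
    (t₂ = ⊤ ∨ ∃ q : ℚ, t₂ = ((q : ℝ) : EReal))) ∧
    A = rect ((s₁ : ℝ) : EReal) ((s₂ : ℝ) : EReal) ((t₁ : ℝ) : EReal) t₂}

theorem isPiSystem_rationalRects : IsPiSystem rationalRects := by
  rintro _ ⟨s₁, s₂, t₁, t₂, ⟨h1, h2, h3, h4⟩, rfl⟩ _ ⟨s₁', s₂', t₁', t₂', ⟨h1', h2', h3', h4'⟩, rfl⟩
    ⟨p, hp⟩
  rw [rect_inter] at hp ⊢
  have hm : ∀ a b : ℚ, ((max a b : ℚ) : ℝ).toEReal = max ((a : ℝ) : EReal) ((b : ℝ) : EReal) :=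
    fun a b => by
      rw [Rat.cast_max, EReal.coe_strictMono.monotone.map_max]
  have hm' : ∀ a b : ℚ, ((min a b : ℚ) : ℝ).toEReal = min ((a : ℝ) : EReal) ((b : ℝ) : EReal) :=
    fun a b => by
      rw [Rat.cast_min, EReal.coe_strictMono.monotone.map_min]
  refine ⟨max s₁ s₁', min s₂ s₂', max t₁ t₁', min t₂ t₂', ⟨?_, ?_, ?_, ?_⟩, ?_⟩
  · have := hp.1.1.trans_le hp.1.2
    rw [← hm, ← hm', EReal.coe_lt_coe_iff, Rat.cast_lt] at this
    exact this.le
  · exact (min_le_left _ _).trans (h2.trans (le_max_left _ _))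
  · rw [hm]
    exact (hp.2.1.trans_le hp.2.2).le
  · rcases h4 with rfl | ⟨q, rfl⟩
    · simpa using h4'
    · rcases h4' with rfl | ⟨q', rfl⟩
      · exact Or.inr ⟨q, by simp⟩
      · exact Or.inr ⟨min q q', (hm' _ _).symm⟩
  · rw [hm, hm', hm]

theorem countable_rationalRects : rationalRects.Countable := by
  have : rationalRects ⊆ range (fun a : ℚ × ℚ × ℚ × Option ℚ =>
      rect ((a.1 : ℝ) : EReal) ((a.2.1 : ℝ) : EReal) ((a.2.2.1 : ℝ) : EReal)
        (a.2.2.2.elim ⊤ fun q => ((q : ℝ) : EReal))) := by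
    rintro _ ⟨s₁, s₂, t₁, t₂, ⟨-, -, -, rfl | ⟨q, rfl⟩⟩, rfl⟩
    · exact ⟨(s₁, s₂, t₁, none), rfl⟩
    · exact ⟨(s₁, s₂, t₁, some q), rfl⟩
  exact (countable_range _).mono this

/-- This makes rational rectangles generate the Borel sets and, as a π-system, test weak
convergence. All four corner quadrants lie above the diagonal, where the counts are known. -/
theorem exists_rationalRect {U : Set Delta} (hU : IsOpen U) {p : Delta} (hp : p ∈ U) :
    ∃ A ∈ rationalRects, A ∈ 𝓝 p ∧ A ⊆ U := by
  obtain ⟨V, hV, rfl⟩ := isOpen_induced_iff.1 hU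
  obtain ⟨⟨b, d⟩, hb, hbd⟩ := p
  change ⊥ < b at hb
  change b < d at hbd
  obtain ⟨A, hA, B, hB, hAB⟩ := mem_nhds_prod_iff.1 (hV.mem_nhds hp)
  change A ∈ 𝓝 b at hA
  change B ∈ 𝓝 d at hB
  obtain ⟨l, hl, hlA⟩ := exists_Ioc_subset_of_mem_nhds hA ⟨⊥, hb⟩
  obtain ⟨u, hu, huA⟩ := exists_Ico_subset_of_mem_nhds hA ⟨d, hbd⟩
  obtain ⟨l', hl', hlB⟩ := exists_Ioc_subset_of_mem_nhds hB ⟨b, hbd⟩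
  obtain ⟨s₁, hs₁, hs₁'⟩ := EReal.exists_rat_btwn_of_lt hl
  -- Keeping `s₂` below `d` leaves room for `t₁` between `s₂` and `d`, hence `s₂ ≤ t₁`.
  obtain ⟨s₂, hs₂, hs₂'⟩ := EReal.exists_rat_btwn_of_lt (lt_min hu hbd)
  obtain ⟨t₁, ht₁, ht₁'⟩ := EReal.exists_rat_btwn_of_lt (max_lt hl' (hs₂'.trans_le (min_le_right _ _)))
  -- For `d = ∞` no finite upper bound gives a neighbourhood, whence the rectangles with `t₂ = ⊤`.
  obtain ⟨t₂, ht₂, hdt₂, htB⟩ : ∃ t₂ : EReal, (t₂ = ⊤ ∨ ∃ q : ℚ, t₂ = ((q : ℝ) : EReal)) ∧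
      Iic t₂ ∈ 𝓝 d ∧ ∀ e, l' < e → e ≤ t₂ → e ∈ B := by
    by_cases hd : d = ⊤
    · subst hd
      exact ⟨⊤, Or.inl rfl, by simp, fun e h _ => hlB ⟨h, le_top⟩⟩
    · obtain ⟨u', hu', huB⟩ := exists_Ico_subset_of_mem_nhds hB ⟨⊤, lt_top_iff_ne_top.2 hd⟩
      obtain ⟨q, hq, hq'⟩ := EReal.exists_rat_btwn_of_lt hu'
      refine ⟨_, Or.inr ⟨q, rfl⟩, Iic_mem_nhds hq, fun e h h' => ?_⟩
      rcases le_or_gt e d with hed | hed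
      · exact hlB ⟨h, hed⟩
      · exact huB ⟨hed.le, h'.trans_lt hq'⟩
  have hdt : d ≤ t₂ := mem_Iic.1 (mem_of_mem_nhds hdt₂)
  refine ⟨_, ⟨s₁, s₂, t₁, t₂, ⟨?_, ?_, ht₁'.le.trans hdt, ht₂⟩, rfl⟩, ?_, ?_⟩
  · have := hs₁'.trans hs₂
    rw [EReal.coe_lt_coe_iff, Rat.cast_lt] at this
    exact this.le
  · have := (le_max_right _ _).trans_lt ht₁
    rw [EReal.coe_lt_coe_iff, Rat.cast_lt] at this
    exact this.le
  · have h1 : (fun p : Delta => p.1.1) ⁻¹' Ioc ((s₁ : ℝ) : EReal) ((s₂ : ℝ) : EReal) ∈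
        𝓝 (⟨(b, d), hb, hbd⟩ : Delta) :=
      continuous_birth.continuousAt.preimage_mem_nhds (Ioc_mem_nhds hs₁' hs₂)
    have h2 : (fun p : Delta => p.1.2) ⁻¹' (Ioi ((t₁ : ℝ) : EReal) ∩ Iic t₂) ∈
        𝓝 (⟨(b, d), hb, hbd⟩ : Delta) :=
      continuous_death.continuousAt.preimage_mem_nhds (inter_mem (Ioi_mem_nhds ht₁') hdt₂)
    exact inter_mem h1 h2
  · rintro ⟨⟨b', d'⟩, hb', hbd'⟩ ⟨⟨h1, h2⟩, h3, h4⟩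
    change _ < b' at h1
    change b' ≤ _ at h2
    change _ < d' at h3
    change d' ≤ _ at h4
    refine hAB ⟨?_, htB d' (((le_max_left _ _).trans_lt ht₁).trans h3) h4⟩
    rcases le_or_gt b' b with h | h
    · exact hlA ⟨hs₁.trans h1, h⟩
    · exact huA ⟨h.le, h2.trans_lt (hs₂'.trans_le (min_le_left _ _))⟩

theorem quadrant_top (s : EReal) : quadrant s ⊤ = ∅ := by
  ext p; simp [quadrant]

theorem borel_eq_generateFrom_rationalRects :
    (inferInstance : MeasurableSpace Delta) = MeasurableSpace.generateFrom rationalRects := by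
  apply le_antisymm
  · rw [BorelSpace.measurable_eq (α := Delta)]
    refine MeasurableSpace.generateFrom_le fun U hU => ?_
    have : U = ⋃₀ {A ∈ rationalRects | A ⊆ U} := by
      apply Subset.antisymm
      · intro p hp
        obtain ⟨A, hA, hpA, hAU⟩ := exists_rationalRect hU hp
        exact ⟨A, ⟨hA, hAU⟩, mem_of_mem_nhds hpA⟩
      · exact sUnion_subset fun A hA => hA.2
    rw [this]
    exact MeasurableSet.sUnion (countable_rationalRects.mono (sep_subset _ _))
      fun A hA => MeasurableSpace.measurableSet_generateFrom hA.1
  · refine MeasurableSpace.generateFrom_le ?_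
    rintro _ ⟨s₁, s₂, t₁, t₂, -, rfl⟩
    exact measurableSet_rect _ _ _ _

theorem iUnion_rationalRects : ⋃₀ rationalRects = univ := by
  refine eq_univ_of_forall fun p => ?_
  obtain ⟨A, hA, hpA, -⟩ := exists_rationalRect isOpen_univ (mem_univ p)
  exact ⟨A, hA, mem_of_mem_nhds hpA⟩

/-- A finite measure is determined by its values on the quadrants above the diagonal. -/
theorem measure_ext_of_quadrant {μ ν : Measure Delta} [IsFiniteMeasure μ] [IsFiniteMeasure ν]
    (h : ∀ s t : ℝ, s ≤ t → μ.real (quadrant s t) = ν.real (quadrant s t)) : μ = ν := by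
  have hrect : ∀ A ∈ rationalRects, μ A = ν A := by
    rintro _ ⟨s₁, s₂, t₁, t₂, ⟨h1, h2, h3, h4⟩, rfl⟩
    have h1' : ((s₁ : ℝ)) ≤ (s₂ : ℝ) := Rat.cast_le.2 h1
    have h2' : ((s₂ : ℝ)) ≤ (t₁ : ℝ) := Rat.cast_le.2 h2
    rw [← measureReal_eq_measureReal_iff, measureReal_rect μ (by simpa using h1) h3,
      measureReal_rect ν (by simpa using h1) h3, h _ _ h2', h _ _ (h1'.trans h2')]
    rcases h4 with rfl | ⟨q, rfl⟩
    · simp only [quadrant_top, measureReal_empty]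
    · rw [EReal.coe_le_coe_iff] at h3
      rw [h _ _ (h2'.trans h3), h _ _ (h1'.trans (h2'.trans h3))]
  exact Measure.ext_of_generateFrom_of_cover_subset borel_eq_generateFrom_rationalRects
    isPiSystem_rationalRects subset_rfl countable_rationalRects iUnion_rationalRects
    (fun A _ => measure_ne_top μ A) hrect

/-! ### Uniqueness of the diagram -/

/-- The counting measure of a multiset of bars. -/
def countMeasure (D : Multiset Delta) : Measure Delta := (D.map fun p => Measure.dirac p).sum

open Classical in
theorem countMeasure_apply (D : Multiset Delta) {A : Set Delta} (hA : MeasurableSet A) :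
    countMeasure D A = D.countP (· ∈ A) := by
  induction D using Multiset.induction_on with
  | empty => simp [countMeasure]
  | cons p D ih =>
    rw [countMeasure] at ih ⊢
    rw [Multiset.map_cons, Multiset.sum_cons, Measure.add_apply, ih, Measure.dirac_apply' _ hA,
      Multiset.countP_cons]
    by_cases h : p ∈ A <;> simp [h, add_comm]

instance (D : Multiset Delta) : IsFiniteMeasure (countMeasure D) := by
  classical
  exact ⟨by rw [countMeasure_apply _ MeasurableSet.univ]; exact ENNReal.natCast_lt_top _⟩

theorem countMeasure_injective : Function.Injective countMeasure := by
  classical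
  intro D D' h
  ext p
  have h1 := congrArg (fun μ : Measure Delta => μ {p}) h
  simp only [countMeasure_apply _ (measurableSet_singleton p), Nat.cast_inj] at h1
  simpa [Multiset.count, eq_comm] using h1

open Classical in
/-- The rank of the structure map from time `s` to time `t` counts the bars that are born up to
time `s` and are alive at time `t`. -/
theorem finrank_range_H0Map {x : ℕ → EReal} {D : Multiset Delta} (hD : IsPersistenceDiagram x D)
    {s t : ℝ} (h : s ≤ t) :
    Module.finrank (ZMod 2) (LinearMap.range (H0Map x h)) =
      D.countP (· ∈ quadrant (s : EReal) (t : EReal)) := by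
  obtain ⟨e, he⟩ := hD
  set J := {i : D.ToType // i.1 ∈ quadrant (s : EReal) (t : EReal)} with hJ
  let coord (i : D.ToType) : H0 x t →ₗ[ZMod 2] ZMod 2 :=
    (intervalSpace i.1 t).subtype ∘ₗ
      DirectSum.component (ZMod 2) D.ToType (fun i => intervalSpace i.1 t) i ∘ₗ (e t).toLinearMap
  have hcoord : ∀ i c, coord i c = (e t c i : ZMod 2) := fun i c => rfl
  let F : LinearMap.range (H0Map x h) →ₗ[ZMod 2] (J → ZMod 2) :=
    (LinearMap.pi fun j : J => coord j.1) ∘ₗ (LinearMap.range (H0Map x h)).subtype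
  have hF : ∀ c j, F c j = (e t c.1 j.1 : ZMod 2) := fun c j => rfl
  -- By naturality the coordinates outside `J` vanish on the range, so those in `J` determine an
  -- element of it.
  have hinj : Function.Injective F := by
    rw [injective_iff_map_eq_zero]
    rintro ⟨_, c, rfl⟩ hc
    rw [Subtype.ext_iff]
    change H0Map x h c = 0
    rw [← (e t).map_eq_zero_iff]
    refine DFinsupp.ext fun i => Subtype.ext ?_
    by_cases hi : i.1 ∈ quadrant (s : EReal) (t : EReal)
    · have := congrFun hc ⟨i, hi⟩
      rw [hF] at this
      exact this
    · rw [he, intervalMap_eq_zero h hi]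
      rfl
  -- A bar in `J` is already alive at time `s`, so any values can be prescribed there and are
  -- carried unchanged to time `t`.
  have hsurj : Function.Surjective F := by
    intro g
    let w : ⨁ i : D.ToType, intervalSpace i.1 s :=
      (DirectSum.linearEquivFunOnFintype (ZMod 2) D.ToType fun i => intervalSpace i.1 s).symm
        fun i => if hi : i.1 ∈ quadrant (s : EReal) (t : EReal) then
          ⟨g ⟨i, hi⟩, by
            rw [intervalSpace_eq_top le_rfl
              ⟨hi.1, (EReal.coe_le_coe_iff.2 h).trans_lt hi.2⟩]
            trivial⟩ else 0
    refine ⟨⟨H0Map x h ((e s).symm w), LinearMap.mem_range_self _ _⟩, ?_⟩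
    ext ⟨i, hi⟩
    rw [hF, he, intervalMap_coe h hi, LinearEquiv.apply_symm_apply]
    have : w i = (DirectSum.linearEquivFunOnFintype (ZMod 2) D.ToType
      (fun i => intervalSpace i.1 s)) w i := rfl
    rw [this, LinearEquiv.apply_symm_apply, dif_pos hi]
  rw [(LinearEquiv.ofBijective F ⟨hinj, hsurj⟩).finrank_eq, Module.finrank_fintype_fun_eq_card,
    Fintype.card_subtype]
  conv_rhs => rw [← Multiset.map_univ_coe D, Multiset.countP_map]
  rfl

theorem IsPersistenceDiagram.unique {x : ℕ → EReal} {D D' : Multiset Delta}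
    (hD : IsPersistenceDiagram x D) (hD' : IsPersistenceDiagram x D') : D = D' := by
  classical
  refine countMeasure_injective (measure_ext_of_quadrant fun s t h => ?_)
  rw [measureReal_def, measureReal_def, countMeasure_apply _ (measurableSet_quadrant _ _),
    countMeasure_apply _ (measurableSet_quadrant _ _), ← finrank_range_H0Map hD h,
    ← finrank_range_H0Map hD' h]

theorem diagram_eq {x : ℕ → EReal} {D : Multiset Delta} (hD : IsPersistenceDiagram x D) :
    diagram x = D := by
  have h : ∃ D, IsPersistenceDiagram x D := ⟨D, hD⟩
  rw [diagram, dif_pos h]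
  exact h.choose_spec.unique hD

/-! ### The diagram of the elder rule -/

open Classical in
/-- The bar born with the vertex `i`. -/
def bar (x : ℕ → EReal) (i : ℕ) : Delta :=
  if h : ⊥ < x i ∧ x i < death x i then ⟨(x i, death x i), h⟩
  else ⟨(0, 1), EReal.bot_lt_zero, EReal.coe_lt_coe_iff.2 one_pos⟩

open Classical in
/-- The vertices with a bar of positive length. -/
def bars (x : ℕ → EReal) (N : ℕ) : Finset ℕ := (Finset.range N).filter fun i => x i < death x i

variable {x : ℕ → EReal} {N : ℕ}

theorem mem_bars {i : ℕ} : i ∈ bars x N ↔ i < N ∧ x i < death x i := by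
  simp [bars]

theorem bar_coe (hb : ∀ i, x i ≠ ⊥) {i : ℕ} (hi : i ∈ bars x N) :
    (bar x i).1 = (x i, death x i) := by
  rw [bar, dif_pos ⟨bot_lt_iff_ne_bot.2 (hb i), (mem_bars.1 hi).2⟩]

theorem isPersistenceDiagram_elder (hN : ∀ i, N ≤ i → x i = ⊤) (hb : ∀ i, x i ≠ ⊥) :
    IsPersistenceDiagram x ((bars x N).val.map (bar x)) := by
  classical
  set φ := (bars x N).val.mapEquiv (bar x)
  have hφ : ∀ j, bar x (φ.symm j).1 = j.1 := fun j => by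
    have := Multiset.mapEquiv_apply (bars x N).val (bar x) (φ.symm j)
    rw [← this]
    exact congrArg Sigma.fst (φ.apply_symm_apply j)
  have hmem : ∀ j : (bars x N).val.ToType, j.1 ∈ bars x N := fun j =>
    Multiset.coe_mem (m := (bars x N).val) (x := j)
  refine exists_equiv_of_elder (idx := fun j => (φ.symm j).1) hN (fun j => ?_) ?_ fun k hk => ?_
  · rw [← hφ, bar_coe hb (hmem _)]
  · intro j j' h
    refine φ.symm.injective ?_
    rcases hj : φ.symm j with ⟨a, i⟩
    rcases hj' : φ.symm j' with ⟨a', i'⟩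
    simp only [hj, hj'] at h
    subst h
    -- Vertices occur once in `bars`, so the copy number of an index carries no information, even if
    -- several vertices have the same bar.
    have := Multiset.nodup_iff_count_le_one.1 (bars x N).nodup a
    congr 1
    exact Fin.ext (by omega)
  · have hk' : k ∈ (bars x N).val := by
      refine mem_bars.2 ⟨?_, hk⟩
      by_contra h
      rw [hN k (not_lt.1 h)] at hk
      exact not_top_lt hk
    refine ⟨φ ⟨k, ⟨0, Multiset.count_pos.2 hk'⟩⟩, ?_⟩
    exact congrArg Sigma.fst (φ.symm_apply_apply _)

theorem diagram_eq_elder (hN : ∀ i, N ≤ i → x i = ⊤) (hb : ∀ i, x i ≠ ⊥) :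
    diagram x = (bars x N).val.map (bar x) :=
  diagram_eq (isPersistenceDiagram_elder hN hb)

theorem diagramMeasure_eq (hN : ∀ i, N ≤ i → x i = ⊤) (hb : ∀ i, x i ≠ ⊥) :
    diagramMeasure x = ∑ i ∈ bars x N, Measure.dirac (bar x i) := by
  rw [diagramMeasure, diagram_eq_elder hN hb, Multiset.map_map]
  rfl

end

end SublevelPH

/-! ### Bar counts as visit counts of the shift -/

namespace SublevelPH

noncomputable section

/-! ### Counting bars -/

variable {x : ℕ → EReal} {N : ℕ}

theorem lt_of_le_coe (hN : ∀ i, N ≤ i → x i = ⊤) {t : EReal} (ht : t ≠ ⊤) {i : ℕ}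
    (hi : x i ≤ t) : i < N := by
  by_contra h
  rw [hN i (not_lt.1 h)] at hi
  exact ht (top_le_iff.1 hi)

open Classical in
/-- The oldest vertices of the components of `K(t)` that are born up to time `s` correspond to the
last vertices of these components with value at most `s`. -/
theorem card_quadrant (hN : ∀ i, N ≤ i → x i = ⊤) {s t : EReal} (hst : s ≤ t) (ht : t ≠ ⊤) :
    ((Finset.range N).filter fun i => x i ≤ s ∧ t < death x i).card =
      ((Finset.range N).filter fun i => x i ≤ s ∧
        ∃ j, i < j ∧ t < x j ∧ ∀ k, i < k → k < j → s < x k).card := by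
  have hlast : ∀ o, x o ≤ s → ∃ i, (level x o i ≤ t ∧ x i ≤ s) ∧
      ∀ k, level x o k ≤ t → x k ≤ s → k ≤ i := by
    intro o ho
    obtain ⟨i, hi, hmax⟩ := Finset.exists_max_image
      ((Finset.range N).filter fun i => level x o i ≤ t ∧ x i ≤ s) id
      ⟨o, Finset.mem_filter.2 ⟨Finset.mem_range.2 (lt_of_le_coe hN ht (ho.trans hst)),
        by rw [level_self]; exact ho.trans hst, ho⟩⟩
    exact ⟨i, (Finset.mem_filter.1 hi).2, fun k h1 h2 => hmax k (Finset.mem_filter.2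
      ⟨Finset.mem_range.2 (lt_of_le_coe hN ht (h2.trans hst)), h1, h2⟩)⟩
  choose! g hg hgmax using hlast
  refine Finset.card_bij (fun o _ => g o) ?_ ?_ ?_
  · intro o ho
    obtain ⟨-, ho, hd⟩ := Finset.mem_filter.1 ho
    obtain ⟨h1, h2⟩ := hg o ho
    refine Finset.mem_filter.2 ⟨Finset.mem_range.2 (lt_of_le_coe hN ht (h2.trans hst)), h2, ?_⟩
    -- The first index after `g o` with value above `t` ends the component. A vertex with value at
    -- most `s` before it would contradict that `g o` is the last one.
    have hex : ∃ j, g o < j ∧ t < x j := ⟨g o + N + 1, by omega, by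
      rw [hN _ (by omega)]; exact lt_top_iff_ne_top.2 ht⟩
    refine ⟨Nat.find hex, (Nat.find_spec hex).1, (Nat.find_spec hex).2, fun k hk hkj => ?_⟩
    by_contra hks
    have : level x (g o) k ≤ t := by
      rw [level_le_iff]
      intro l hl
      rw [Finset.mem_uIcc] at hl
      rcases eq_or_ne l (g o) with rfl | hne
      · exact h2.trans hst
      · have := Nat.find_min hex (m := l) (by omega)
        by_contra hl'
        exact this ⟨by omega, not_le.1 hl'⟩
    have := hgmax o ho k (level_trans h1 this) (not_lt.1 hks)
    omega
  · intro o ho o' ho' h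
    obtain ⟨-, ho, hd⟩ := Finset.mem_filter.1 ho
    obtain ⟨-, ho', hd'⟩ := Finset.mem_filter.1 ho'
    have hl : level x o o' ≤ t :=
      level_trans (hg o ho).1 (by rw [show g o = g o' from h, level_comm]; exact (hg o' ho').1)
    -- Of two vertices connected at time `t`, the younger is dead by then.
    by_contra hne
    rcases lt_or_gt_of_ne fun h' => hne (key_injective x h') with h' | h'
    · exact not_le.2 hd' ((death_le_level h').trans (by rwa [level_comm]))
    · exact not_le.2 hd ((death_le_level h').trans hl)
  · intro i hi
    obtain ⟨-, hi, j, hij, hj, hk⟩ := Finset.mem_filter.1 hi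
    -- The preimage is the oldest vertex of the component of `i`. The vertex `j` cuts the component
    -- off before any later vertex of value at most `s`, so `i` is its last such vertex.
    obtain ⟨o, ho, hmin⟩ := Finset.exists_min_image
      ((Finset.range N).filter fun k => level x i k ≤ t) (key x)
      ⟨i, Finset.mem_filter.2 ⟨Finset.mem_range.2 (lt_of_le_coe hN ht (hi.trans hst)),
        by rw [level_self]; exact hi.trans hst⟩⟩
    obtain ⟨hoN, hoi⟩ := Finset.mem_filter.1 ho
    have hos : x o ≤ s := (le_of_key_le (hmin i (Finset.mem_filter.2
      ⟨Finset.mem_range.2 (lt_of_le_coe hN ht (hi.trans hst)),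
        by rw [level_self]; exact hi.trans hst⟩))).trans hi
    refine ⟨o, Finset.mem_filter.2 ⟨hoN, hos, ?_⟩, ?_⟩
    · by_contra hd
      obtain ⟨l, hl, hol⟩ := (death_le_iff hN ht).1 (not_lt.1 hd)
      refine not_le.2 hl (hmin l (Finset.mem_filter.2 ⟨Finset.mem_range.2
        (lt_of_le_coe hN ht ((right_le_level x o l).trans hol)), level_trans hoi hol⟩))
    · obtain ⟨h1, h2⟩ := hg o hos
      have h3 : level x i (g o) ≤ t := level_trans hoi h1
      have h4 : i ≤ g o := hgmax o hos i (by rwa [level_comm]) hi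
      refine le_antisymm ?_ h4
      by_contra hlt
      have hgj : g o < j := by
        by_contra hge
        refine not_le.2 hj (level_le_iff.1 h3 j ?_)
        rw [Finset.mem_uIcc]
        omega
      exact not_le.2 (hk (g o) (not_le.1 hlt) hgj) h2

-- An Euler characteristic count, from `card_quadrant` with `s = t`: the vertices alive at `t` are
-- as many as those in `K(t)` whose right neighbour is not in `K(t)`. Taking complements among the
-- vertices of `K(t)` leaves the dead ones and the edges.
open Classical in
theorem card_death_le (hN : ∀ i, N ≤ i → x i = ⊤) {t : EReal} (ht : t ≠ ⊤) :
    ((Finset.range N).filter fun i => death x i ≤ t).card =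
      ((Finset.range N).filter fun i => max (x i) (x (i + 1)) ≤ t).card := by
  have h1 := card_quadrant hN (le_refl t) ht
  have h2 : ∀ i, (∃ j, i < j ∧ t < x j ∧ ∀ k, i < k → k < j → t < x k) ↔ t < x (i + 1) := by
    intro i
    constructor
    · rintro ⟨j, hij, hj, hk⟩
      rcases eq_or_ne j (i + 1) with rfl | hne
      · exact hj
      · exact hk (i + 1) (by omega) (by omega)
    · exact fun h => ⟨i + 1, by omega, h, fun k _ _ => by omega⟩
  simp only [h2] at h1
  have h3 := Finset.card_filter_add_card_filter_not (s := (Finset.range N).filter fun i => x i ≤ t)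
    (fun i => t < death x i)
  have h4 := Finset.card_filter_add_card_filter_not (s := (Finset.range N).filter fun i => x i ≤ t)
    (fun i => t < x (i + 1))
  simp only [Finset.filter_filter, not_lt] at h3 h4
  have h5 : ((Finset.range N).filter fun i => x i ≤ t ∧ death x i ≤ t) =
      (Finset.range N).filter fun i => death x i ≤ t :=
    Finset.filter_congr fun i _ => ⟨And.right, fun h => ⟨(le_death x i).trans h, h⟩⟩
  have h6 : ((Finset.range N).filter fun i => x i ≤ t ∧ x (i + 1) ≤ t) =
      (Finset.range N).filter fun i => max (x i) (x (i + 1)) ≤ t :=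
    Finset.filter_congr fun i _ => max_le_iff.symm
  rw [h5] at h3
  rw [h6] at h4
  omega

open Classical in
/-- Finite families with the same cumulative counts have the same sums. -/
theorem sum_comp_eq_of_card_le {ι : Type*} (s : Finset ι) (f g : ι → EReal)
    (h : ∀ t, (s.filter fun i => f i ≤ t).card = (s.filter fun i => g i ≤ t).card)
    (φ : EReal → ℝ) : ∑ i ∈ s, φ (f i) = ∑ i ∈ s, φ (g i) := by
  -- The sums are integrals for counting measures on `[-∞, ∞]`, which are determined by their
  -- distribution functions.
  have hμ : ∑ i ∈ s, Measure.dirac (f i) = ∑ i ∈ s, Measure.dirac (g i) := by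
    refine Measure.ext_of_Iic _ _ fun t => ?_
    have hc : ∀ f : ι → EReal, (∑ i ∈ s, Measure.dirac (f i)) (Iic t) =
        ((s.filter fun i => f i ≤ t).card : ENNReal) := fun f => by
      rw [Measure.finsetSum_apply, Finset.card_filter, Nat.cast_sum]
      refine Finset.sum_congr rfl fun i _ => ?_
      rw [Measure.dirac_apply' _ measurableSet_Iic]
      by_cases hi : f i ≤ t <;> simp [hi]
    rw [hc, hc, h]
  have hint : ∀ f : ι → EReal, ∫ a, φ a ∂(∑ i ∈ s, Measure.dirac (f i)) = ∑ i ∈ s, φ (f i) :=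
    fun f => by
      rw [integral_finsetSum_measure fun i _ => integrable_dirac (by simp)]
      simp
  rw [← hint, hμ, hint]

theorem sum_death_eq (hN : ∀ i, N ≤ i → x i = ⊤) (φ : EReal → ℝ) :
    ∑ i ∈ Finset.range N, φ (death x i) = ∑ i ∈ Finset.range N, φ (max (x i) (x (i + 1))) := by
  classical
  refine sum_comp_eq_of_card_le _ _ _ (fun t => ?_) φ
  rcases eq_or_ne t ⊤ with rfl | ht
  · simp
  · exact card_death_le hN ht

/-- The maximum over an edge is the value at one of its ends, and a vertex belongs to at most two
edges. This turns control of the sample values into control of the deaths. -/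
theorem sum_death_le (hN : ∀ i, N ≤ i → x i = ⊤) {φ : EReal → ℝ} (hφ : ∀ a, 0 ≤ φ a) :
    ∑ i ∈ Finset.range N, φ (death x i) ≤ 2 * ∑ i ∈ Finset.range (N + 1), φ (x i) := by
  rw [sum_death_eq hN]
  have h1 : ∑ i ∈ Finset.range N, φ (max (x i) (x (i + 1))) ≤
      ∑ i ∈ Finset.range N, (φ (x i) + φ (x (i + 1))) := by
    refine Finset.sum_le_sum fun i _ => ?_
    have := hφ (x i)
    have := hφ (x (i + 1))
    rcases max_choice (x i) (x (i + 1)) with h | h <;> rw [h] <;> linarith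
  have h2 := Finset.sum_range_succ (fun i => φ (x i)) N
  have h3 := Finset.sum_range_succ' (fun i => φ (x i)) N
  rw [Finset.sum_add_distrib] at h1
  have := hφ (x N)
  have := hφ (x 0)
  linarith

/-- A vertex with a bar is a strict local minimum if neighbours have different values. -/
theorem lt_neighbours_of_lt_death (hne : ∀ i, x i ≠ ⊤ → x i ≠ x (i + 1)) {i : ℕ}
    (h : x i < death x i) : x i < x (i + 1) ∧ ∀ j, j + 1 = i → x i < x j := by
  -- A lower neighbour is older and connected to `i` at level `x i`, so `i` would die at birth.
  have key_lt : ∀ j, (j = i + 1 ∨ j + 1 = i) → x j < x i → False := by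
    intro j hj hlt
    have hk : key x j < key x i := Prod.Lex.lt_iff.2 (Or.inl hlt)
    refine not_le.2 h ((death_le_level hk).trans (level_le_iff.2 fun k hk => ?_))
    have : k = i ∨ k = j := by rw [Finset.mem_uIcc] at hk; omega
    rcases this with rfl | rfl
    · exact le_rfl
    · exact hlt.le
  refine ⟨?_, ?_⟩
  · rcases lt_trichotomy (x i) (x (i + 1)) with h' | h' | h'
    · exact h'
    · exact absurd h' (hne i (ne_top_of_lt h))
    · exact (key_lt _ (Or.inl rfl) h').elim
  · rintro j rfl
    rcases lt_trichotomy (x (j + 1)) (x j) with h' | h' | h'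
    · exact h'
    · exact absurd h'.symm (hne j (by rw [← h']; exact ne_top_of_lt h))
    · exact (key_lt _ (Or.inr rfl) h').elim

/-- A path that leaves `i + 1` passes through one of its neighbours. -/
theorem min_neighbours_le_death {i : ℕ} {u : EReal} (h1 : u ≤ x i)  (h2 : u ≤ x (i + 2)) :
    u ≤ death x (i + 1) := by
  refine le_iInf₂ fun j hj => ?_
  have hne : j ≠ i + 1 := fun h => lt_irrefl _ (h ▸ hj)
  rcases lt_or_gt_of_ne hne with h | h
  · exact h1.trans (level_le_iff.1 le_rfl i (by rw [Finset.mem_uIcc]; omega))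
  · exact h2.trans (level_le_iff.1 le_rfl (i + 2) (by rw [Finset.mem_uIcc]; omega))

/-! ### Samples of a sequence -/

/-- The left shift. -/
def shift (y : ℕ → ℝ) (i : ℕ) : ℝ := y (i + 1)

theorem iterate_shift (n : ℕ) (y : ℕ → ℝ) (i : ℕ) : shift^[n] y i = y (i + n) := by
  induction n generalizing y with
  | zero => rfl
  | succ n ih => rw [Function.iterate_succ_apply, ih, shift]; congr 1

/-- The sample of length `n` of a sequence, with the value `∞` elsewhere. -/
def extend (y : ℕ → ℝ) (n k : ℕ) : EReal := if 1 ≤ k ∧ k ≤ n then (y (k - 1) : EReal) else ⊤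

variable {y : ℕ → ℝ} {n : ℕ}

theorem extend_of_le (k : ℕ) (hk : n + 1 ≤ k) : extend y n k = ⊤ := if_neg (by omega)

@[simp] theorem extend_zero : extend y n 0 = ⊤ := if_neg (by omega)

theorem extend_succ {k : ℕ} (hk : k < n) : extend y n (k + 1) = (y k : EReal) :=
  if_pos (by omega)

theorem extend_ne_bot (k : ℕ) : extend y n k ≠ ⊥ := by
  rw [extend]
  split_ifs
  · exact EReal.coe_ne_bot _
  · exact top_ne_bot

theorem exists_of_extend_ne_top {k : ℕ} (h : extend y n k ≠ ⊤) :
    ∃ i, i < n ∧ k = i + 1 ∧ extend y n k = (y i : EReal) := by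
  by_cases hk : 1 ≤ k ∧ k ≤ n
  · refine ⟨k - 1, by omega, by omega, ?_⟩
    rw [extend, if_pos hk]
  · exact absurd (if_neg hk) h

theorem sum_extend (φ : EReal → ℝ) :
    ∑ k ∈ Finset.range (n + 2), φ (extend y n k) =
      ∑ i ∈ Finset.range n, φ (y i) + 2 * φ ⊤ := by
  rw [Finset.sum_range_succ, Finset.sum_range_succ', extend_zero, extend_of_le (n + 1) le_rfl,
    Finset.sum_congr rfl fun i hi => by rw [extend_succ (Finset.mem_range.1 hi)]]
  ring

/-- The sequences that start at most at `s` and exceed `t` before they return to `(-∞, s]`. -/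
def upcrossing (s t : ℝ) : Set (ℕ → ℝ) :=
  {y | y 0 ≤ s ∧ ∃ j, 0 < j ∧ t < y j ∧ ∀ k, 0 < k → k < j → s < y k}

/-- The sequences with a strict local minimum at `1`, such that no element of `F` is between the
minimum and its neighbours. -/
def shallowMin (F : Finset ℝ) : Set (ℕ → ℝ) :=
  {y | y 1 < y 0 ∧ y 1 < y 2 ∧ ∀ q ∈ F, ¬(y 1 ≤ q ∧ q < y 0 ∧ q < y 2)}

open Classical in
/-- The number of visits of the orbit of `y` to `A` up to time `n`. -/
def visits (A : Set (ℕ → ℝ)) (y : ℕ → ℝ) (n : ℕ) : ℕ :=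
  ((Finset.range n).filter fun i => shift^[i] y ∈ A).card

theorem birkhoffSum_indicator (A : Set (ℕ → ℝ)) (y : ℕ → ℝ) (n : ℕ) :
    birkhoffSum shift (A.indicator fun _ => (1 : ℝ)) n y = visits A y n := by
  classical
  simp [birkhoffSum, visits, indicator]

theorem mem_upcrossing_iff {s t : ℝ} {i : ℕ} : shift^[i] y ∈ upcrossing s t ↔
    y i ≤ s ∧ ∃ j, i < j ∧ t < y j ∧ ∀ k, i < k → k < j → s < y k := by
  simp only [upcrossing, mem_ofPred_eq, iterate_shift, zero_add]
  refine and_congr_right fun _ => ⟨?_, ?_⟩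
  · rintro ⟨j, hj, hjt, hk⟩
    refine ⟨j + i, by omega, hjt, fun k h1 h2 => ?_⟩
    have := hk (k - i) (by omega) (by omega)
    rwa [Nat.sub_add_cancel h1.le] at this
  · rintro ⟨j, hj, hjt, hk⟩
    refine ⟨j - i, by omega, by rwa [Nat.sub_add_cancel hj.le], fun k h1 h2 => ?_⟩
    exact hk _ (by omega) (by omega)

open Classical in
/-- The number of bars of a sample in a quadrant. -/
theorem card_quadrant_extend (y : ℕ → ℝ) (n : ℕ) {s t : ℝ} (hst : s ≤ t) :
    visits (upcrossing s t) y n ≤ ((Finset.range (n + 1)).filter fun i =>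
      extend y n i ≤ (s : EReal) ∧ (t : EReal) < death (extend y n) i).card ∧
    ((Finset.range (n + 1)).filter fun i =>
      extend y n i ≤ (s : EReal) ∧ (t : EReal) < death (extend y n) i).card ≤
      visits (upcrossing s t) y n + 1 := by
  rw [card_quadrant extend_of_le (EReal.coe_le_coe_iff.2 hst) (EReal.coe_ne_top t)]
  set A := (Finset.range (n + 1)).filter fun i => extend y n i ≤ (s : EReal) ∧
    ∃ j, i < j ∧ (t : EReal) < extend y n j ∧ ∀ k, i < k → k < j → (s : EReal) < extend y n k
    with hA
  have hlow : ∀ i, i < n → shift^[i] y ∈ upcrossing s t → i + 1 ∈ A := by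
    intro i hi h
    obtain ⟨h1, j, hij, hj, hk⟩ := mem_upcrossing_iff.1 h
    refine Finset.mem_filter.2 ⟨Finset.mem_range.2 (by omega), ?_, min (j + 1) (n + 1), by omega,
      ?_, fun k h2 h3 => ?_⟩
    · rw [extend_succ hi]
      exact EReal.coe_le_coe_iff.2 h1
    · rcases lt_or_ge j n with h' | h'
      · rw [min_eq_left (by omega), extend_succ h']
        exact EReal.coe_lt_coe_iff.2 hj
      · rw [min_eq_right (by omega), extend_of_le _ le_rfl]
        exact EReal.coe_lt_top t
    · obtain ⟨k, rfl⟩ : ∃ k', k = k' + 1 := ⟨k - 1, by omega⟩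
      rw [extend_succ (by omega)]
      exact EReal.coe_lt_coe_iff.2 (hk k (by omega) (by omega))
  refine ⟨?_, ?_⟩
  · refine Finset.card_le_card_of_injOn (fun i => i + 1) (fun i hi => ?_)
      (fun i _ j _ h => Nat.succ_injective h)
    obtain ⟨hi, h⟩ := Finset.mem_filter.1 hi
    exact hlow i (Finset.mem_range.1 hi) h
  -- The vertices that owe their place in `A` to the value `∞` at `n + 1`. There is at most one: if
  -- another vertex of value at most `s` follows, the path exceeds `t` before it, inside the sample.
  · set B := A.filter fun i => ¬ shift^[i - 1] y ∈ upcrossing s t with hB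
    have hcard : B.card ≤ 1 := by
      rw [Finset.card_le_one]
      have hmain : ∀ a ∈ B, ∀ b ∈ B, ¬ a < b := by
        intro a ha b hb hab
        obtain ⟨ha, ha'⟩ := Finset.mem_filter.1 ha
        obtain ⟨-, ha1, j, haj, hj, hk⟩ := Finset.mem_filter.1 ha
        obtain ⟨-, hb1, -⟩ := Finset.mem_filter.1 (Finset.mem_filter.1 hb).1
        obtain ⟨i, hin, rfl, hi⟩ :=
          exists_of_extend_ne_top (ne_top_of_le_ne_top (EReal.coe_ne_top s) ha1)
        obtain ⟨l, hln, rfl, hl⟩ :=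
          exists_of_extend_ne_top (ne_top_of_le_ne_top (EReal.coe_ne_top s) hb1)
        refine ha' ?_
        rw [Nat.add_sub_cancel, mem_upcrossing_iff]
        rw [hi] at ha1
        refine ⟨EReal.coe_le_coe_iff.1 ha1, j - 1, by omega, ?_, fun k h1 h2 => ?_⟩
        · have hjb : j ≤ l + 1 := by
            by_contra h
            exact not_le.2 (hk _ hab (by omega)) hb1
          obtain ⟨j, rfl⟩ : ∃ j', j = j' + 1 := ⟨j - 1, by omega⟩
          rw [extend_succ (by omega)] at hj
          exact EReal.coe_lt_coe_iff.1 hj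
        · have hjb : j ≤ l + 1 := by
            by_contra h
            exact not_le.2 (hk _ hab (by omega)) hb1
          have := hk (k + 1) (by omega) (by omega)
          rw [extend_succ (by omega)] at this
          exact EReal.coe_lt_coe_iff.1 this
      intro a ha b hb
      exact le_antisymm (not_lt.1 (hmain b hb a ha)) (not_lt.1 (hmain a ha b hb))
    have hrest : (A.filter fun i => shift^[i - 1] y ∈ upcrossing s t).card ≤
        visits (upcrossing s t) y n := by
      have h0 : ∀ i ∈ A, ∃ l, l < n ∧ i = l + 1 := fun i hi => by
        obtain ⟨-, h1, -⟩ := Finset.mem_filter.1 hi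
        obtain ⟨l, hl, rfl, -⟩ :=
          exists_of_extend_ne_top (ne_top_of_le_ne_top (EReal.coe_ne_top s) h1)
        exact ⟨l, hl, rfl⟩
      refine Finset.card_le_card_of_injOn (fun i => i - 1) (fun i hi => ?_) ?_
      · obtain ⟨hi, h⟩ := Finset.mem_filter.1 hi
        obtain ⟨l, hl, rfl⟩ := h0 i hi
        exact Finset.mem_filter.2 ⟨Finset.mem_range.2 hl, h⟩
      · intro i hi j hj h
        obtain ⟨l, hl, rfl⟩ := h0 i (Finset.mem_filter.1 hi).1
        obtain ⟨l', hl', rfl⟩ := h0 j (Finset.mem_filter.1 hj).1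
        simpa using h
    have := Finset.card_filter_add_card_filter_not (s := A)
      (fun i => shift^[i - 1] y ∈ upcrossing s t)
    have hB' : (A.filter fun i => ¬ shift^[i - 1] y ∈ upcrossing s t).card ≤ 1 := by
      convert hcard
    omega

open Classical in
/-- Up to the ends of the sample, bars that contain no point of `F` are born at local minima that
are not separated from their neighbours by points of `F`. -/
theorem card_bars_avoiding_le (hne : ∀ i, y i ≠ y (i + 1)) (n : ℕ) (F : Finset ℝ) :
    ((bars (extend y n) (n + 1)).filter fun i =>
      ∀ q ∈ F, ¬(extend y n i ≤ (q : EReal) ∧ (q : EReal) < death (extend y n) i)).card ≤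
      visits (shallowMin F) y n + 2 := by
  set x := extend y n with hx
  have hne' : ∀ i, x i ≠ ⊤ → x i ≠ x (i + 1) := by
    intro i hi
    obtain ⟨k, hk, rfl, hxk⟩ := exists_of_extend_ne_top hi
    rw [hx, hxk]
    rcases lt_or_ge (k + 1) n with h | h
    · rw [extend_succ h]
      exact fun h' => hne k (EReal.coe_injective h')
    · rw [extend_of_le _ (by omega)]
      exact EReal.coe_ne_top _
  set A := (bars x (n + 1)).filter fun i =>
      ∀ q ∈ F, ¬(x i ≤ (q : EReal) ∧ (q : EReal) < death x i) with hA
  -- The vertices `1` and `n` have a neighbour outside the sample; they account for the constant 2.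
  -- A vertex `l + 2` carries `y (l + 1)`, the middle of the window seen by `shift^[l]`.
  have h1 : (A \ {1, n}).card ≤ visits (shallowMin F) y n := by
    have h0 : ∀ i ∈ A \ {1, n}, ∃ l, l + 2 < n ∧ i = l + 2 ∧ shift^[l] y ∈ shallowMin F := by
      intro i hi
      obtain ⟨hi, hi2⟩ := Finset.mem_sdiff.1 hi
      obtain ⟨hi, hF⟩ := Finset.mem_filter.1 hi
      have hd := (mem_bars.1 hi).2
      obtain ⟨k, hk, rfl, hxk⟩ := exists_of_extend_ne_top (ne_top_of_lt hd)
      simp only [Finset.mem_insert, Finset.mem_singleton, not_or] at hi2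
      obtain ⟨l, rfl⟩ : ∃ l, k = l + 1 := ⟨k - 1, by omega⟩
      obtain ⟨h2, h3⟩ := lt_neighbours_of_lt_death hne' hd
      have h3 := h3 (l + 1) rfl
      rw [hx] at h2 h3
      have e0 : extend y n (l + 1) = (y l : EReal) := extend_succ (by omega)
      have e1 : extend y n (l + 1 + 1) = (y (l + 1) : EReal) := extend_succ (by omega)
      have e2 : extend y n (l + 1 + 1 + 1) = (y (l + 2) : EReal) := extend_succ (by omega)
      rw [e1, e2] at h2
      rw [e1, e0] at h3
      refine ⟨l, by omega, rfl, ?_⟩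
      simp only [shallowMin, mem_ofPred_eq, iterate_shift, zero_add]
      rw [add_comm 1 l, add_comm 2 l]
      refine ⟨EReal.coe_lt_coe_iff.1 h3, EReal.coe_lt_coe_iff.1 h2, fun q hq hcon => hF q hq ?_⟩
      refine ⟨by rw [hx, e1]; exact EReal.coe_le_coe_iff.2 hcon.1, ?_⟩
      have hmin : (min (y l) (y (l + 2)) : ℝ) ≤ death x (l + 1 + 1) := by
        refine min_neighbours_le_death ?_ ?_
        · rw [hx, e0]; exact EReal.coe_le_coe_iff.2 (min_le_left _ _)
        · have e2' : extend y n (l + 1 + 2) = (y (l + 2) : EReal) := e2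
          rw [hx, e2']; exact EReal.coe_le_coe_iff.2 (min_le_right _ _)
      exact (EReal.coe_lt_coe_iff.2 (lt_min hcon.2.1 hcon.2.2)).trans_le hmin
    refine Finset.card_le_card_of_injOn (fun i => i - 2) (fun i hi => ?_) ?_
    · obtain ⟨l, hl, rfl, hl'⟩ := h0 i hi
      exact Finset.mem_filter.2 ⟨Finset.mem_range.2 (by simp; omega), hl'⟩
    · intro i hi j hj h
      obtain ⟨l, hl, rfl, -⟩ := h0 i hi
      obtain ⟨l', hl', rfl, -⟩ := h0 j hj
      simpa using h
  have h2 := Finset.le_card_sdiff {1, n} A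
  have h3 := Finset.card_le_two (a := 1) (b := n)
  omega

/-- A strict local minimum lies below the lower bound for its death given by its neighbours. The two
discarded indices are those whose window of length 3 leaves the sample. -/
theorem visits_le_card_bars (y : ℕ → ℝ) (n : ℕ) :
    visits (shallowMin ∅) y n ≤ (bars (extend y n) (n + 1)).card + 2 := by
  classical
  set A := (Finset.range n).filter fun i => shift^[i] y ∈ shallowMin ∅ with hA
  have h1 : (A \ {n - 1, n - 2}).card ≤ (bars (extend y n) (n + 1)).card := by
    refine Finset.card_le_card_of_injOn (fun i => i + 2) (fun i hi => ?_)
      (fun i _ j _ h => by simpa using h)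
    obtain ⟨hi, hi2⟩ := Finset.mem_sdiff.1 hi
    obtain ⟨hi, hm⟩ := Finset.mem_filter.1 hi
    simp only [Finset.mem_insert, Finset.mem_singleton, not_or, Finset.mem_range] at hi2 hi
    simp only [shallowMin, mem_ofPred_eq, iterate_shift, zero_add] at hm
    rw [add_comm 1 i, add_comm 2 i] at hm
    refine mem_bars.2 ⟨by simp only; omega, ?_⟩
    have e0 : extend y n (i + 1) = (y i : EReal) := extend_succ (by omega)
    have e1 : extend y n (i + 1 + 1) = (y (i + 1) : EReal) := extend_succ (by omega)
    have e2 : extend y n (i + 1 + 2) = (y (i + 2) : EReal) := extend_succ (by omega)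
    change extend y n (i + 1 + 1) < death (extend y n) (i + 1 + 1)
    have hmin : (min (y i) (y (i + 2)) : ℝ) ≤ death (extend y n) (i + 1 + 1) := by
      refine min_neighbours_le_death ?_ ?_
      · rw [e0]; exact EReal.coe_le_coe_iff.2 (min_le_left _ _)
      · rw [e2]; exact EReal.coe_le_coe_iff.2 (min_le_right _ _)
    rw [e1]
    exact (EReal.coe_lt_coe_iff.2 (lt_min hm.1 hm.2.1)).trans_le hmin
  have h2 := Finset.le_card_sdiff {n - 1, n - 2} A
  have h3 := Finset.card_le_two (a := n - 1) (b := n - 2)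
  have h4 : visits (shallowMin ∅) y n = A.card := rfl
  omega

end

end SublevelPH

namespace SublevelPH

noncomputable section

/-! ### The diagram measure of a sample -/

theorem measurableSet_DeltaFin : MeasurableSet DeltaFin :=
  continuous_death.measurable (measurableSet_singleton ⊤).compl

variable (y : ℕ → ℝ) (n : ℕ)

/-- The vertices with a bar of positive length of a sample. -/
def sampleBars : Finset ℕ := bars (extend y n) (n + 1)

open Classical in
/-- The vertices with a finite bar of positive length of a sample. -/
def finBars : Finset ℕ := (sampleBars y n).filter fun i => death (extend y n) i ≠ ⊤

theorem diagram_extend :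
    diagram (extend y n) = (sampleBars y n).val.map (bar (extend y n)) :=
  diagram_eq_elder extend_of_le extend_ne_bot

theorem diagramMeasure_extend :
    diagramMeasure (extend y n) = ∑ i ∈ sampleBars y n, Measure.dirac (bar (extend y n) i) :=
  diagramMeasure_eq extend_of_le extend_ne_bot

instance : IsFiniteMeasure (diagramMeasure (extend y n)) := by
  rw [diagramMeasure_extend]
  infer_instance

variable {y n}

theorem bar_extend {i : ℕ} (hi : i ∈ sampleBars y n) :
    (bar (extend y n) i).1 = (extend y n i, death (extend y n) i) := bar_coe extend_ne_bot hi

theorem bar_mem_DeltaFin {i : ℕ} (hi : i ∈ sampleBars y n) :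
    bar (extend y n) i ∈ DeltaFin ↔ death (extend y n) i ≠ ⊤ := by
  change (bar (extend y n) i).1.2 ≠ ⊤ ↔ _
  rw [bar_extend hi]

theorem mem_finBars {i : ℕ} :
    i ∈ finBars y n ↔ i ∈ sampleBars y n ∧ death (extend y n) i ≠ ⊤ := by
  simp [finBars]

open Classical in
theorem diagramMeasure_real_apply {A : Set Delta} (hA : MeasurableSet A) :
    (diagramMeasure (extend y n)).real A =
      ((sampleBars y n).filter fun i => bar (extend y n) i ∈ A).card := by
  have : diagramMeasure (extend y n) A =
      (((sampleBars y n).filter fun i => bar (extend y n) i ∈ A).card : ENNReal) := by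
    rw [diagramMeasure_extend, Measure.finsetSum_apply, Finset.card_filter, Nat.cast_sum]
    refine Finset.sum_congr rfl fun i _ => ?_
    rw [Measure.dirac_apply' _ hA]
    by_cases hi : bar (extend y n) i ∈ A <;> simp [hi]
  rw [measureReal_def, this, ENNReal.toReal_natCast]

theorem diagramMeasure_real_univ :
    (diagramMeasure (extend y n)).real univ = (sampleBars y n).card := by
  classical
  simp [diagramMeasure_real_apply MeasurableSet.univ]

open Classical in
theorem diagramMeasure_real_quadrant {s t : ℝ} (hst : s ≤ t) :
    (diagramMeasure (extend y n)).real (quadrant s t) =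
      ((Finset.range (n + 1)).filter fun i =>
        extend y n i ≤ (s : EReal) ∧ (t : EReal) < death (extend y n) i).card := by
  rw [diagramMeasure_real_apply (measurableSet_quadrant _ _)]
  congr 2
  ext i
  rw [Finset.mem_filter, Finset.mem_filter, Finset.mem_range]
  constructor
  · rintro ⟨hi, h⟩
    refine ⟨(mem_bars.1 hi).1, ?_⟩
    have h' : (bar (extend y n) i).1.1 ≤ (s : EReal) ∧ (t : EReal) < (bar (extend y n) i).1.2 := h
    rwa [bar_extend hi] at h'
  · rintro ⟨hi, h⟩
    have hi' : i ∈ sampleBars y n :=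
      mem_bars.2 ⟨hi, h.1.trans_lt ((EReal.coe_le_coe_iff.2 hst).trans_lt h.2)⟩
    refine ⟨hi', ?_⟩
    change (bar (extend y n) i).1.1 ≤ (s : EReal) ∧ (t : EReal) < (bar (extend y n) i).1.2
    rwa [bar_extend hi']

theorem integrable_diagramMeasure (f : Delta → ℝ) :
    Integrable f (diagramMeasure (extend y n)) := by
  rw [diagramMeasure_extend]
  exact integrable_finsetSum_measure.2 fun i _ => integrable_dirac (by simp)

theorem integral_diagramMeasure (f : Delta → ℝ) :
    ∫ p, f p ∂diagramMeasure (extend y n) = ∑ i ∈ sampleBars y n, f (bar (extend y n) i) := by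
  rw [diagramMeasure_extend, integral_finsetSum_measure fun i _ => integrable_dirac (by simp)]
  simp

theorem integrable_finPart {μ : Measure Delta} {f : Delta → ℝ} (hf : Integrable f μ) :
    Integrable (fun p : DeltaFin => f p) (finPart μ) := by
  have := (MeasurableEmbedding.subtype_coe measurableSet_DeltaFin).integrableOn_range_iff_comap
    (μ := μ) (f := f)
  exact this.1 hf.integrableOn

theorem integral_finPart (μ : Measure Delta) (f : Delta → ℝ) :
    ∫ p : DeltaFin, f p ∂finPart μ = ∫ p in DeltaFin, f p ∂μ :=
  integral_subtype_comap measurableSet_DeltaFin f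

theorem finPart_apply (μ : Measure Delta) (A : Set Delta) :
    finPart μ (Subtype.val ⁻¹' A) = μ (A ∩ DeltaFin) := by
  rw [finPart, (MeasurableEmbedding.subtype_coe measurableSet_DeltaFin).comap_apply,
    Subtype.image_preimage_coe, inter_comm]

theorem finPart_univ (μ : Measure Delta) : finPart μ univ = μ DeltaFin := by
  rw [← preimage_univ (f := Subtype.val), finPart_apply, univ_inter]

theorem integral_finPart_diagramMeasure (f : Delta → ℝ) :
    ∫ p : DeltaFin, f p ∂finPart (diagramMeasure (extend y n)) =
      ∑ i ∈ finBars y n, f (bar (extend y n) i) := by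
  classical
  rw [integral_finPart, ← integral_indicator measurableSet_DeltaFin, integral_diagramMeasure,
    finBars, Finset.sum_filter]
  refine Finset.sum_congr rfl fun i hi => ?_
  rw [indicator_apply]
  simp only [bar_mem_DeltaFin hi]

theorem finPart_diagramMeasure_real_univ :
    (finPart (diagramMeasure (extend y n))).real univ = (finBars y n).card := by
  classical
  rw [measureReal_def, finPart_univ, ← measureReal_def,
    diagramMeasure_real_apply measurableSet_DeltaFin, finBars,
    Finset.filter_congr fun i hi => bar_mem_DeltaFin hi]

/-- At most one bar of a sample is infinite. -/
theorem card_sampleBars_le : (sampleBars y n).card ≤ (finBars y n).card + 1 := by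
  classical
  have h := Finset.card_filter_add_card_filter_not (s := sampleBars y n)
    (fun i => death (extend y n) i ≠ ⊤)
  have h1 : ((sampleBars y n).filter fun i => ¬ death (extend y n) i ≠ ⊤).card ≤ 1 := by
    -- The path between two vertices of the sample stays inside it, so they are connected at a
    -- finite level and the younger bar is finite.
    have hmain : ∀ a b, a ∈ sampleBars y n → b ∈ sampleBars y n → death (extend y n) a = ⊤ →
        ¬ key (extend y n) b < key (extend y n) a := by
      intro a b ha hb hd hlt
      have h2 := death_le_level hlt
      rw [hd, top_le_iff] at h2
      obtain ⟨k, hk, hk'⟩ := exists_level_eq (extend y n) a b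
      obtain ⟨i, hi, rfl, -⟩ := exists_of_extend_ne_top (ne_top_of_lt (mem_bars.1 ha).2)
      obtain ⟨j, hj, rfl, -⟩ := exists_of_extend_ne_top (ne_top_of_lt (mem_bars.1 hb).2)
      rw [Finset.mem_uIcc] at hk
      obtain ⟨k, rfl⟩ : ∃ k', k = k' + 1 := ⟨k - 1, by omega⟩
      rw [h2, extend_succ (by omega)] at hk'
      exact EReal.coe_ne_top _ hk'.symm
    rw [Finset.card_le_one]
    intro a ha b hb
    obtain ⟨ha, ha'⟩ := Finset.mem_filter.1 ha
    obtain ⟨hb, hb'⟩ := Finset.mem_filter.1 hb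
    exact key_injective _ (le_antisymm (not_lt.1 (hmain a b ha hb (not_not.1 ha')))
      (not_lt.1 (hmain b a hb ha (not_not.1 hb'))))
  rw [finBars]
  omega

theorem card_finBars_le : (finBars y n).card ≤ (sampleBars y n).card := by
  classical
  exact Finset.card_filter_le _ _

theorem finPoints_map_sum (f : Delta → ℝ) :
    ((finPoints (extend y n)).map f).sum = ∑ i ∈ finBars y n, f (bar (extend y n) i) := by
  classical
  rw [finPoints, diagram_extend, Multiset.filter_map, Multiset.map_map, finBars,
    Finset.sum_filter, ← Finset.sum_filter]
  change (((sampleBars y n).filter fun i => bar (extend y n) i ∈ DeltaFin).val.map _).sum = _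
  rw [Finset.filter_congr fun i hi => bar_mem_DeltaFin hi]
  rfl

theorem sum_birth_le {φ : EReal → ℝ} (hφ : ∀ a, 0 ≤ φ a) :
    ∑ i ∈ sampleBars y n, φ (extend y n i) ≤ ∑ i ∈ Finset.range n, φ (y i) + 2 * φ ⊤ := by
  rw [← sum_extend]
  refine Finset.sum_le_sum_of_subset_of_nonneg (fun i hi => ?_) fun i _ _ => hφ _
  have := (mem_bars.1 hi).1
  exact Finset.mem_range.2 (by omega)

theorem sum_sampleBars_death_le {φ : EReal → ℝ} (hφ : ∀ a, 0 ≤ φ a) :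
    ∑ i ∈ sampleBars y n, φ (death (extend y n) i) ≤
      2 * (∑ i ∈ Finset.range n, φ (y i) + 2 * φ ⊤) := by
  rw [← sum_extend]
  refine le_trans ?_ (sum_death_le extend_of_le hφ)
  refine Finset.sum_le_sum_of_subset_of_nonneg (fun i hi => ?_) fun i _ _ => hφ _
  exact Finset.mem_range.2 (mem_bars.1 hi).1

end

end SublevelPH

namespace SublevelPH

noncomputable section

/-! ### Weak convergence -/

section Weak

/-- A probability measure as an element of the space of probability measures. -/
def toProbabilityMeasure {S : Type*} [MeasurableSpace S] (ν : Measure S) (h : IsProbabilityMeasure ν) : ProbabilityMeasure S :=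
  ⟨ν, h⟩

/-- Normalized diagrams need not be probability measures for small `n`, when there may be no bars.
Filling in the exceptional terms with `ν` makes the theory of `ProbabilityMeasure` available. -/
theorem exists_probabilityMeasure_seq {S : Type*} [MeasurableSpace S] {μ : ℕ → Measure S}
    {ν : Measure S} [IsProbabilityMeasure ν]
    (hμ : ∀ᶠ n in atTop, IsProbabilityMeasure (μ n)) :
    ∃ π : ℕ → ProbabilityMeasure S, ∀ᶠ n in atTop, (π n : Measure S) = μ n := by
  classical
  refine ⟨fun n => if h : IsProbabilityMeasure (μ n) then toProbabilityMeasure (μ n) h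
    else toProbabilityMeasure ν ‹_›, ?_⟩
  filter_upwards [hμ] with n hn
  rw [dif_pos hn]
  rfl

variable {S : Type*} [TopologicalSpace S] [MeasurableSpace S] {μ : ℕ → Measure S} {ν : Measure S}

theorem weaklyTendsto_iff [OpensMeasurableSpace S] [hν : IsProbabilityMeasure ν]
    {π : ℕ → ProbabilityMeasure S} (hπ : ∀ᶠ n in atTop, (π n : Measure S) = μ n) :
    WeaklyTendsto μ ν ↔ Tendsto π atTop (𝓝 (toProbabilityMeasure ν hν)) := by
  rw [ProbabilityMeasure.tendsto_iff_forall_integral_tendsto]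
  refine forall_congr' fun f => tendsto_congr' ?_
  filter_upwards [hπ] with n hn
  rw [hn]

theorem weaklyTendsto_of_isPiSystem [SecondCountableTopology S] [OpensMeasurableSpace S]
    [hν : IsProbabilityMeasure ν] (hμ : ∀ᶠ n in atTop, IsProbabilityMeasure (μ n))
    {C : Set (Set S)} (hC : IsPiSystem C) (hmeas : ∀ A ∈ C, MeasurableSet A)
    (hnhds : ∀ U : Set S, IsOpen U → ∀ p ∈ U, ∃ A ∈ C, A ∈ 𝓝 p ∧ A ⊆ U)
    (h : ∀ A ∈ C, Tendsto (fun n => (μ n).real A) atTop (𝓝 (ν.real A))) :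
    WeaklyTendsto μ ν := by
  obtain ⟨π, hπ⟩ := exists_probabilityMeasure_seq (ν := ν) hμ
  rw [weaklyTendsto_iff hπ]
  refine hC.tendsto_probabilityMeasure_of_tendsto_of_mem hmeas hnhds fun A hA => ?_
  rw [← NNReal.tendsto_coe]
  refine (h A hA).congr' ?_
  filter_upwards [hπ] with n hn
  rw [← hn]
  rfl

theorem WeaklyTendsto.le_liminf_of_isOpen [HasOuterApproxClosed S] [OpensMeasurableSpace S]
    [hν : IsProbabilityMeasure ν] (hμ : ∀ᶠ n in atTop, IsProbabilityMeasure (μ n))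
    (h : WeaklyTendsto μ ν) {G : Set S} (hG : IsOpen G) :
    ν G ≤ liminf (fun n => μ n G) atTop := by
  obtain ⟨π, hπ⟩ := exists_probabilityMeasure_seq (ν := ν) hμ
  refine (ProbabilityMeasure.le_liminf_measure_open_of_tendsto
    ((weaklyTendsto_iff hπ).1 h) hG).trans_eq (liminf_congr ?_)
  filter_upwards [hπ] with n hn
  rw [hn]

theorem WeaklyTendsto.tendsto_of_null_frontier [HasOuterApproxClosed S] [OpensMeasurableSpace S]
    [hν : IsProbabilityMeasure ν] (hμ : ∀ᶠ n in atTop, IsProbabilityMeasure (μ n))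
    (h : WeaklyTendsto μ ν) {A : Set S} (hA : ν (frontier A) = 0) :
    Tendsto (fun n => (μ n).real A) atTop (𝓝 (ν.real A)) := by
  obtain ⟨π, hπ⟩ := exists_probabilityMeasure_seq (ν := ν) hμ
  have := ProbabilityMeasure.tendsto_measure_of_null_frontier_of_tendsto'
    ((weaklyTendsto_iff hπ).1 h) hA
  have h2 := (ENNReal.tendsto_toReal (measure_ne_top ν A)).comp this
  refine h2.congr' ?_
  filter_upwards [hπ] with n hn
  simp only [Function.comp_apply, hn, measureReal_def]

/-- A bound for the integrals of a nonnegative continuous function passes to the weak limit. -/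
theorem WeaklyTendsto.integral_le [HasOuterApproxClosed S] [OpensMeasurableSpace S]
    [hν : IsProbabilityMeasure ν] (hμ : ∀ᶠ n in atTop, IsProbabilityMeasure (μ n))
    (h : WeaklyTendsto μ ν) {g : S → ℝ} (hg : Continuous g) (hg0 : 0 ≤ g) {c : ℝ} (hc : 0 ≤ c)
    (hgi : ∀ᶠ n in atTop, Integrable g (μ n)) (hgc : ∀ᶠ n in atTop, ∫ p, g p ∂μ n ≤ c) :
    Integrable g ν ∧ ∫ p, g p ∂ν ≤ c := by
  have hle : ∫⁻ p, ENNReal.ofReal (g p) ∂ν ≤ ENNReal.ofReal c := by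
    refine (lintegral_le_liminf_lintegral_of_forall_isOpen_measure_le_liminf_measure hg hg0
      fun G hG => h.le_liminf_of_isOpen hμ hG).trans ?_
    refine (liminf_le_liminf (v := fun _ => ENNReal.ofReal c) ?_).trans_eq (liminf_const _)
    filter_upwards [hgi, hgc] with n h1 h2
    rw [← ofReal_integral_eq_lintegral_ofReal h1 (ae_of_all _ hg0)]
    exact ENNReal.ofReal_le_ofReal h2
  have hi : Integrable g ν := by
    refine ⟨hg.measurable.aestronglyMeasurable, ?_⟩
    rw [hasFiniteIntegral_iff_ofReal (ae_of_all _ hg0)]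
    exact hle.trans_lt ENNReal.ofReal_lt_top
  refine ⟨hi, ?_⟩
  rw [← ofReal_integral_eq_lintegral_ofReal hi (ae_of_all _ hg0)] at hle
  exact (ENNReal.ofReal_le_ofReal_iff hc).1 hle

/-- The integrals of a uniformly integrable continuous function converge. -/
theorem WeaklyTendsto.tendsto_integral [HasOuterApproxClosed S] [OpensMeasurableSpace S]
    [hν : IsProbabilityMeasure ν] (hμ : ∀ᶠ n in atTop, IsProbabilityMeasure (μ n))
    (h : WeaklyTendsto μ ν) {f : S → ℝ} (hf : Continuous f)
    (hfi : ∀ᶠ n in atTop, Integrable f (μ n))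
    (hui : ∀ η > 0, ∃ M : ℝ, ∀ᶠ n in atTop, ∫ p, max (|f p| - M) 0 ∂μ n ≤ η) :
    Integrable f ν ∧ Tendsto (fun n => ∫ p, f p ∂μ n) atTop (𝓝 (∫ p, f p ∂ν)) := by
  have hpart : ∀ M : ℝ, ∀ m : Measure S, IsProbabilityMeasure m → Integrable f m →
      Integrable (fun p => max (|f p| - M) 0) m := fun M m hm hfm =>
    (hfm.abs.sub (integrable_const _)).sup (integrable_zero _ _ _)
  have hlim : ∀ η > 0, ∃ M : ℝ, 0 ≤ M ∧ (∀ᶠ n in atTop, ∫ p, max (|f p| - M) 0 ∂μ n ≤ η) ∧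
      Integrable (fun p => max (|f p| - M) 0) ν ∧ ∫ p, max (|f p| - M) 0 ∂ν ≤ η := by
    intro η hη
    obtain ⟨M, hM⟩ := hui η hη
    have hM' : ∀ᶠ n in atTop, ∫ p, max (|f p| - max M 0) 0 ∂μ n ≤ η := by
      filter_upwards [hM, hμ, hfi] with n h1 h2 h3
      refine (integral_mono (hpart _ _ h2 h3) (hpart _ _ h2 h3) fun p => ?_).trans h1
      have := le_max_left M 0
      exact max_le_max (by linarith) le_rfl
    refine ⟨max M 0, le_max_right _ _, hM', ?_⟩
    refine h.integral_le hμ ((hf.abs.sub continuous_const).max continuous_const)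
      (fun p => le_max_right _ _) hη.le ?_ hM'
    filter_upwards [hμ, hfi] with n h2 h3 using hpart _ _ h2 h3
  have hfν : Integrable f ν := by
    obtain ⟨M, hM0, -, h2, -⟩ := hlim 1 one_pos
    refine ((integrable_const M).add h2).mono' hf.measurable.aestronglyMeasurable
      (ae_of_all _ fun p => ?_)
    rw [Real.norm_eq_abs, Pi.add_apply]
    have := le_max_left (|f p| - M) 0
    linarith
  refine ⟨hfν, ?_⟩
  rw [Metric.tendsto_nhds]
  intro ε hε
  -- Clipping `f` to `[-M, M]` changes the integrals for `μ n` and for `ν` by at most `ε / 4` each,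
  -- and the bounded function `g` adds another `ε / 4`.
  obtain ⟨M, hM0, h1, h2, h3⟩ := hlim (ε / 4) (by positivity)
  let g : S →ᵇ ℝ := BoundedContinuousFunction.ofNormedAddCommGroup
    (fun p => max (-M) (min (f p) M)) (by fun_prop) M fun p => by
      rw [Real.norm_eq_abs, abs_le]
      exact ⟨le_max_left _ _, max_le (by linarith) (min_le_right _ _)⟩
  have hgf : ∀ p, |f p - g p| = max (|f p| - M) 0 := fun p => by
    change |f p - max (-M) (min (f p) M)| = _
    rcases le_total (f p) M with h4 | h4
    · rw [min_eq_left h4]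
      rcases le_total (-M) (f p) with h5 | h5
      · rw [max_eq_right h5, sub_self, abs_zero, max_eq_right]
        rw [sub_nonpos, abs_le]
        exact ⟨h5, h4⟩
      · rw [max_eq_left h5, abs_of_nonpos (by linarith), abs_of_nonpos (by linarith),
          max_eq_left (by linarith)]
        ring
    · rw [min_eq_right h4, max_eq_right (by linarith), abs_of_nonneg (by linarith),
        abs_of_nonneg (by linarith), max_eq_left (by linarith)]
  have hdiff : ∀ m : Measure S, IsProbabilityMeasure m → Integrable f m →
      ∫ p, max (|f p| - M) 0 ∂m ≤ ε / 4 → |∫ p, f p ∂m - ∫ p, g p ∂m| ≤ ε / 4 := by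
    intro m hm hfm hle
    rw [← integral_sub hfm (g.integrable m)]
    refine (abs_integral_le_integral_abs).trans ?_
    simp only [hgf]
    exact hle
  filter_upwards [hμ, hfi, h1, (Metric.tendsto_nhds.1 (h g)) (ε / 4) (by positivity)]
    with n h4 h5 h6 h7
  have h8 := hdiff _ h4 h5 h6
  have h9 := hdiff ν hν hfν h3
  rw [Real.dist_eq] at h7 ⊢
  rw [abs_le] at h8 h9
  rw [abs_lt] at h7 ⊢
  constructor <;> linarith

end Weak

instance : SecondCountableTopology Delta := inferInstance

theorem normalized_real {S : Type*} [MeasurableSpace S] (μ : Measure S) (A : Set S) :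
    (normalized μ).real A = μ.real A / μ.real univ := by
  rw [normalized, measureReal_def, Measure.smul_apply, smul_eq_mul, ENNReal.toReal_mul,
    ENNReal.toReal_inv, measureReal_def, measureReal_def]
  ring

theorem integral_normalized {S : Type*} [MeasurableSpace S] (μ : Measure S) (f : S → ℝ) :
    ∫ p, f p ∂normalized μ = (∫ p, f p ∂μ) / μ.real univ := by
  rw [normalized, integral_smul_measure, ENNReal.toReal_inv, measureReal_def, smul_eq_mul]
  ring

theorem isProbabilityMeasure_normalized {S : Type*} [MeasurableSpace S] {μ : Measure S}
    [IsFiniteMeasure μ] (h : 0 < μ.real univ) : IsProbabilityMeasure (normalized μ) := by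
  refine ⟨?_⟩
  rw [normalized, Measure.smul_apply, smul_eq_mul]
  refine ENNReal.inv_mul_cancel (fun h0 => ?_) (measure_ne_top μ _)
  simp [measureReal_def, h0] at h

theorem integrable_normalized {S : Type*} [MeasurableSpace S] {μ : Measure S} {f : S → ℝ}
    (hf : Integrable f μ) (h : 0 < μ.real univ) : Integrable f (normalized μ) := by
  refine hf.smul_measure (ENNReal.inv_ne_top.2 fun h0 => ?_)
  simp [measureReal_def, h0] at h

end

end SublevelPH

namespace SublevelPH

noncomputable section

/-! ### Typical sequences and the limiting diagram -/

/-- The excess over `M` of an upper bound for `|u|` and `|u log u|` on `[0, 2|a|]`. -/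
def excess (M a : ℝ) : ℝ := max (2 + 2 * |a| * Real.log (1 + 2 * |a|) - M) 0

/-- The rational and the infinite numbers. -/
def ratPoints : Set EReal := {v | v = ⊤ ∨ v = ⊥ ∨ ∃ q : ℚ, v = ((q : ℝ) : EReal)}

/-- The averages along the sequence `y` that determine its persistence diagrams converge. -/
structure IsTypical (y : ℕ → ℝ) (β : ℚ → ℚ → ℝ) (p : ℝ) : Prop where
  ne : ∀ i, y i ≠ y (i + 1)
  upcrossing : ∀ s t : ℚ, s ≤ t →
    Tendsto (fun n : ℕ => (visits (upcrossing s t) y n : ℝ) / n) atTop (𝓝 (β s t))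
  localMin : Tendsto (fun n : ℕ => (visits (shallowMin ∅) y n : ℝ) / n) atTop (𝓝 p)
  -- The last three fields are tightness conditions: no mass at the diagonal, none on rational or
  -- infinite coordinate lines, and uniform integrability of the lifetimes.
  shallow : ∀ ε > 0, ∃ F : Finset ℚ, ∀ᶠ n : ℕ in atTop,
    (visits (shallowMin (F.image (↑))) y n : ℝ) ≤ ε * n
  atom : ∀ v ∈ ratPoints, ∀ ε > 0, ∃ O : Set EReal, IsOpen O ∧ v ∈ O ∧ ∀ᶠ n : ℕ in atTop,
    ∑ i ∈ Finset.range n, O.indicator (fun _ => (1 : ℝ)) (y i : EReal) ≤ ε * n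
  tail : ∀ ε > 0, ∃ M : ℝ, 2 ≤ M ∧ ∀ᶠ n : ℕ in atTop,
    ∑ i ∈ Finset.range n, excess M (y i) ≤ ε * n

variable {y : ℕ → ℝ} {β : ℚ → ℚ → ℝ} {p : ℝ}

/-- Used to discard the bounded errors at the ends of the sample. -/
theorem tendsto_div_of_near {a b : ℕ → ℕ} {c : ℕ} (h1 : ∀ n, a n ≤ b n + c)
    (h2 : ∀ n, b n ≤ a n + c) {l : ℝ} (ha : Tendsto (fun n : ℕ => (a n : ℝ) / n) atTop (𝓝 l)) :
    Tendsto (fun n : ℕ => (b n : ℝ) / n) atTop (𝓝 l) := by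
  have hc : Tendsto (fun n : ℕ => (c : ℝ) / n) atTop (𝓝 0) :=
    tendsto_const_div_atTop_nhds_zero_nat _
  have hl := ha.sub hc
  have hr := ha.add hc
  rw [sub_zero] at hl
  rw [add_zero] at hr
  refine tendsto_of_tendsto_of_tendsto_of_le_of_le hl hr (fun n => ?_) fun n => ?_
  · simp only
    rw [← sub_div]
    gcongr
    have : (a n : ℝ) ≤ b n + c := by exact_mod_cast h1 n
    linarith
  · simp only
    rw [← add_div]
    gcongr
    exact_mod_cast h2 n

namespace IsTypical

theorem tendsto_card (h : IsTypical y β p) :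
    Tendsto (fun n : ℕ => ((sampleBars y n).card : ℝ) / n) atTop (𝓝 p) := by
  classical
  refine tendsto_div_of_near (c := 2) (fun n => visits_le_card_bars y n) (fun n => ?_) h.localMin
  have := card_bars_avoiding_le h.ne n ∅
  simpa [sampleBars] using this

theorem tendsto_card_fin (h : IsTypical y β p) :
    Tendsto (fun n : ℕ => ((finBars y n).card : ℝ) / n) atTop (𝓝 p) :=
  tendsto_div_of_near (c := 1) (fun _ => card_sampleBars_le)
    (fun _ => card_finBars_le.trans (Nat.le_succ _)) h.tendsto_card

theorem eventually_le_card (h : IsTypical y β p) (hp : 0 < p) :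
    ∀ᶠ n : ℕ in atTop, 0 < (finBars y n).card ∧ (n : ℝ) * p ≤ 2 * (finBars y n).card := by
  filter_upwards [h.tendsto_card_fin.eventually_const_lt (half_lt_self hp), eventually_gt_atTop 0]
    with n hn hn0
  have hn0' : (0 : ℝ) < n := Nat.cast_pos.2 hn0
  rw [lt_div_iff₀ hn0'] at hn
  have h2 : (0 : ℝ) < (finBars y n).card := lt_trans (by positivity) hn
  exact ⟨by exact_mod_cast h2, by linarith⟩

theorem eventually_isProbabilityMeasure (h : IsTypical y β p) (hp : 0 < p) :
    ∀ᶠ n in atTop, IsProbabilityMeasure (normalized (diagramMeasure (extend y n))) := by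
  filter_upwards [h.eventually_le_card hp] with n hn
  refine isProbabilityMeasure_normalized ?_
  rw [diagramMeasure_real_univ]
  exact_mod_cast hn.1.trans_le card_finBars_le

theorem tendsto_quadrant (h : IsTypical y β p) (hp : 0 < p) {s t : ℚ} (hst : s ≤ t) :
    Tendsto (fun n => (normalized (diagramMeasure (extend y n))).real
      (quadrant ((s : ℝ) : EReal) ((t : ℝ) : EReal))) atTop (𝓝 (β s t / p)) := by
  classical
  have hst' : (s : ℝ) ≤ t := Rat.cast_le.2 hst
  have h1 := tendsto_div_of_near (c := 1)
    (fun n => (card_quadrant_extend y n hst').1.trans (Nat.le_succ _))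
    (fun n => (card_quadrant_extend y n hst').2) (h.upcrossing s t hst)
  refine (h1.div h.tendsto_card hp.ne').congr' ?_
  filter_upwards [eventually_gt_atTop 0] with n hn
  have hn' : (n : ℝ) ≠ 0 := Nat.cast_ne_zero.2 hn.ne'
  rw [normalized_real, diagramMeasure_real_quadrant hst', diagramMeasure_real_univ,
    Pi.div_apply, div_div_div_cancel_right₀ hn']

/-- A set of bars has small limiting mass if it contains few bars of the samples. -/
theorem measureReal_le_of_isOpen (h : IsTypical y β p) (hp : 0 < p)
    {π : ℕ → Measure (EReal × EReal)} {ν : Measure (EReal × EReal)} [IsProbabilityMeasure ν]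
    {φ : ℕ → ℕ} (hφ : StrictMono φ)
    (hπ : ∀ᶠ n in atTop, π n = (normalized (diagramMeasure (extend y (φ n)))).map Subtype.val)
    (hπν : WeaklyTendsto π ν) {G : Set (EReal × EReal)} (hG : IsOpen G) {ε c : ℝ} (hε : 0 < ε)
    {g : ℕ → ℕ → ℝ} (hg : ∀ n, ∀ i ∈ sampleBars y n, (extend y n i, death (extend y n) i) ∈ G →
      1 ≤ g n i) (hg0 : ∀ n, ∀ i ∈ sampleBars y n, 0 ≤ g n i)
    (hsum : ∀ᶠ n : ℕ in atTop, ∑ i ∈ sampleBars y n, g n i ≤ ε * n + c) :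
    ν.real G ≤ 4 * ε / p := by
  classical
  have hprob := hφ.tendsto_atTop.eventually (h.eventually_isProbabilityMeasure hp)
  have hπ' : ∀ᶠ n in atTop, IsProbabilityMeasure (π n) := by
    filter_upwards [hπ, hprob] with n h1 h2
    rw [h1]
    exact Measure.isProbabilityMeasure_map measurable_subtype_coe.aemeasurable
  have hle : ∀ᶠ n : ℕ in atTop, (normalized (diagramMeasure (extend y n))).real
      (Subtype.val ⁻¹' G) ≤ 4 * ε / p := by
    -- For `n ≥ c / ε` at most `2 ε n` bars lie in `G`, and eventually there are at least `n p / 2`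
    -- bars; the quotient is `4 ε / p`.
    have hc := (tendsto_natCast_atTop_atTop (R := ℝ)).eventually_ge_atTop (c / ε)
    filter_upwards [h.eventually_le_card hp, hsum, hc] with n h1 h2 h3
    rw [div_le_iff₀ hε] at h3
    have h4 : (0 : ℝ) < (sampleBars y n).card := by
      exact_mod_cast h1.1.trans_le card_finBars_le
    have h5 : ((finBars y n).card : ℝ) ≤ (sampleBars y n).card := by
      exact_mod_cast card_finBars_le
    rw [normalized_real, diagramMeasure_real_univ,
      diagramMeasure_real_apply (measurable_subtype_coe hG.measurableSet), div_le_div_iff₀ h4 hp]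
    have h6 : (((sampleBars y n).filter fun i => bar (extend y n) i ∈
        (Subtype.val ⁻¹' G : Set Delta)).card : ℝ) ≤ ε * n + c := by
      refine le_trans ?_ h2
      rw [Finset.card_filter, Nat.cast_sum]
      refine Finset.sum_le_sum fun i hi => ?_
      split_ifs with hiG
      · rw [mem_preimage, bar_extend hi] at hiG
        simpa using hg n i hi hiG
      · simpa using hg0 n i hi
    have h7 : (ε * n + c) * p ≤ 2 * ε * (n * p) := by
      have : c * p ≤ ε * n * p := by gcongr; linarith
      linarith
    have h8 := mul_le_mul_of_nonneg_right h6 hp.le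
    have h9 : 2 * ε * (n * p) ≤ 2 * ε * (2 * (sampleBars y n).card) := by
      exact mul_le_mul_of_nonneg_left (by linarith [h1.2]) (by positivity)
    linarith
  have hlim := hπν.le_liminf_of_isOpen hπ' hG
  have hlim' : ν G ≤ ENNReal.ofReal (4 * ε / p) := by
    refine hlim.trans ((liminf_le_liminf (v := fun _ => ENNReal.ofReal (4 * ε / p)) ?_).trans_eq
      (liminf_const _))
    filter_upwards [hπ, hprob, hφ.tendsto_atTop.eventually hle] with n h1 h2 h3
    rw [h1, Measure.map_apply measurable_subtype_coe hG.measurableSet,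
      ← ofReal_measureReal (measure_ne_top _ _)]
    exact ENNReal.ofReal_le_ofReal h3
  exact ENNReal.toReal_le_of_le_ofReal (by positivity) hlim'

/-- The normalized diagrams of a typical sequence have a limit point, whose values on quadrants are
determined by the frequencies of upcrossings. -/
theorem exists_limit (h : IsTypical y β p) (hp : 0 < p) :
    ∃ ξ₀ : Measure Delta, IsProbabilityMeasure ξ₀ ∧ ξ₀ DeltaFin = 1 ∧
      ∀ s t : ℚ, s ≤ t →
        ξ₀.real (quadrant ((s : ℝ) : EReal) ((t : ℝ) : EReal)) = β s t / p := by
  classical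
  have hev := h.eventually_isProbabilityMeasure hp
  have hmap : ∀ᶠ n in atTop, IsProbabilityMeasure
      ((normalized (diagramMeasure (extend y n))).map Subtype.val) := by
    filter_upwards [hev] with n hn
    exact Measure.isProbabilityMeasure_map measurable_subtype_coe.aemeasurable
  obtain ⟨ρ, hρ⟩ := exists_probabilityMeasure_seq (ν := Measure.dirac (0 : EReal × EReal)) hmap
  -- Probability measures on the compact square `[-∞, ∞]²` form a compact space, whereas on `Δ` mass
  -- might escape.
  obtain ⟨⟨ν, hν⟩, φ, hφ, hlim⟩ := CompactSpace.tendsto_subseq ρ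
  have hπ : ∀ᶠ n in atTop, ((ρ (φ n) : ProbabilityMeasure (EReal × EReal)) :
      Measure (EReal × EReal)) = (normalized (diagramMeasure (extend y (φ n)))).map Subtype.val :=
    hφ.tendsto_atTop.eventually hρ
  have hπν : WeaklyTendsto (fun n => (ρ (φ n) : Measure (EReal × EReal))) ν :=
    (weaklyTendsto_iff (Eventually.of_forall fun n => rfl)).2 hlim
  have hsmall : ∀ A : Set (EReal × EReal), (∀ ε > 0, ν.real A ≤ 4 * ε / p) → ν A = 0 := by
    intro A hA
    rw [← measureReal_eq_zero_iff]
    refine le_antisymm (le_of_forall_pos_le_add fun ε hε => ?_) measureReal_nonneg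
    have := hA (ε * p / 4) (by positivity)
    have e : 4 * (ε * p / 4) / p = ε := by field_simp
    linarith
  have hind : ∀ (O : Set EReal) (a : EReal), 0 ≤ O.indicator (fun _ => (1 : ℝ)) a :=
    fun O a => indicator_nonneg (fun _ _ => zero_le_one) a
  have hbirth : ∀ v ∈ ratPoints, ν {q | q.1 = v} = 0 := by
    refine fun v hv => hsmall _ fun ε hε => ?_
    obtain ⟨O, hO, hvO, hOn⟩ := h.atom v hv ε hε
    refine (measureReal_mono (s₂ := Prod.fst ⁻¹' O) fun q hq => ?_).trans
      (h.measureReal_le_of_isOpen hp hφ hπ hπν (hO.preimage continuous_fst) hε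
        (g := fun n i => O.indicator (fun _ => (1 : ℝ)) (extend y n i))
        (c := 2 * O.indicator (fun _ => (1 : ℝ)) ⊤)
        (fun n i _ hi => ?_) (fun n i _ => hind _ _) ?_)
    · rw [mem_preimage, show q.1 = v from hq]
      exact hvO
    · rw [indicator_of_mem (show extend y n i ∈ O from hi)]
    · filter_upwards [hOn] with n hn
      have := sum_birth_le (y := y) (n := n) (hind O)
      linarith
  have hdeath : ∀ v ∈ ratPoints, ν {q | q.2 = v} = 0 := by
    refine fun v hv => hsmall _ fun ε hε => ?_
    -- `ε / 2` makes up for the factor 2 in `sum_sampleBars_death_le`.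
    obtain ⟨O, hO, hvO, hOn⟩ := h.atom v hv (ε / 2) (by positivity)
    refine (measureReal_mono (s₂ := Prod.snd ⁻¹' O) fun q hq => ?_).trans
      (h.measureReal_le_of_isOpen hp hφ hπ hπν (hO.preimage continuous_snd) hε
        (g := fun n i => O.indicator (fun _ => (1 : ℝ)) (death (extend y n) i))
        (c := 4 * O.indicator (fun _ => (1 : ℝ)) ⊤)
        (fun n i _ hi => ?_) (fun n i _ => hind _ _) ?_)
    · rw [mem_preimage, show q.2 = v from hq]
      exact hvO
    · rw [indicator_of_mem (show death (extend y n) i ∈ O from hi)]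
    · filter_upwards [hOn] with n hn
      have := sum_sampleBars_death_le (y := y) (n := n) (hind O)
      linarith
  have hrat : ∀ q : ℚ, ((q : ℝ) : EReal) ∈ ratPoints := fun q => Or.inr (Or.inr ⟨q, rfl⟩)
  -- the limit is concentrated on the finite bars
  have hconc : ν (Subtype.val '' DeltaFin)ᶜ = 0 := by
    set Z : Set (EReal × EReal) := ({q | q.1 = ⊥} ∪ {q | q.2 = ⊤}) ∪
      ⋃ r : ℚ, ({q | q.1 = ((r : ℝ) : EReal)} ∪ {q | q.2 = ((r : ℝ) : EReal)}) with hZ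
    have hZ0 : ν Z = 0 := by
      refine measure_union_null (measure_union_null (hbirth _ (Or.inr (Or.inl rfl)))
        (hdeath _ (Or.inl rfl))) (measure_iUnion_null fun r => ?_)
      exact measure_union_null (hbirth _ (hrat r)) (hdeath _ (hrat r))
    refine hsmall _ fun ε hε => ?_
    obtain ⟨F, hF⟩ := h.shallow ε hε
    -- Closed quadrants are removed so that `G` is open. A pair outside `G` satisfies `b ≤ r ≤ d`
    -- for some `r ∈ F`; outside the null set `Z` both inequalities are strict, so it is a finite
    -- bar.
    set G : Set (EReal × EReal) :=
      (⋃ r ∈ F, Iic (((r : ℝ)) : EReal) ×ˢ Ici (((r : ℝ)) : EReal))ᶜ with hGdef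
    have hG : IsOpen G := by
      refine IsClosed.isOpen_compl (self := ?_)
      exact F.finite_toSet.isClosed_biUnion fun r _ => isClosed_Iic.prod isClosed_Ici
    have hsub : (Subtype.val '' DeltaFin)ᶜ ⊆ G ∪ Z := by
      rintro ⟨b, d⟩ hq
      by_contra hcon
      simp only [mem_union, not_or, hGdef, hZ, mem_compl_iff, mem_iUnion, mem_ofPred_eq,
        not_exists] at hcon
      obtain ⟨hF', ⟨hb, hd⟩, hr⟩ := hcon
      obtain ⟨r, hrF⟩ := not_forall.1 hF'
      obtain ⟨-, hr'⟩ := Classical.not_imp.1 hrF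
      obtain ⟨hr1, hr2⟩ := not_not.1 hr'
      have h1 : b < ((r : ℝ) : EReal) := lt_of_le_of_ne hr1 (hr r).1
      have h2 : ((r : ℝ) : EReal) < d := lt_of_le_of_ne hr2 fun e => (hr r).2 e.symm
      exact hq ⟨⟨(b, d), bot_lt_iff_ne_bot.2 hb, h1.trans h2⟩, hd, rfl⟩
    have hGε : ν.real G ≤ 4 * ε / p := by
      refine h.measureReal_le_of_isOpen hp hφ hπ hπν hG hε
        (g := fun n i => if ∀ q ∈ F.image ((↑) : ℚ → ℝ),
          ¬(extend y n i ≤ (q : EReal) ∧ (q : EReal) < death (extend y n) i) then 1 else 0)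
        (c := 2) (fun n i _ hi => ?_) (fun n i _ => by positivity) ?_
      · rw [if_pos]
        intro q hq hcon
        obtain ⟨r, hr, rfl⟩ := Finset.mem_image.1 hq
        exact hi (mem_biUnion hr ⟨hcon.1, hcon.2.le⟩)
      · filter_upwards [hF] with n hn
        have h1 := card_bars_avoiding_le h.ne n (F.image (↑))
        rw [← Finset.sum_filter, Finset.sum_const, nsmul_eq_mul, mul_one]
        have h2 : ((((sampleBars y n).filter fun i => ∀ q ∈ F.image ((↑) : ℚ → ℝ),
          ¬(extend y n i ≤ (q : EReal) ∧ (q : EReal) < death (extend y n) i)).card : ℕ) : ℝ) ≤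
            visits (shallowMin (F.image (↑))) y n + 2 := by
          exact_mod_cast h1
        linarith
    calc ν.real (Subtype.val '' DeltaFin)ᶜ ≤ ν.real (G ∪ Z) := measureReal_mono hsub
      _ ≤ ν.real G + ν.real Z := measureReal_union_le _ _
      _ = ν.real G := by simp [measureReal_def ν Z, hZ0]
      _ ≤ _ := hGε
  have hDm : MeasurableSet Delta :=
    (measurableSet_lt measurable_const measurable_fst).inter
      (measurableSet_lt measurable_fst measurable_snd)
  have hemb := MeasurableEmbedding.subtype_coe hDm
  have hconc' : ν (Subtype.val '' DeltaFin) = 1 :=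
    (prob_compl_eq_zero_iff (hemb.measurableSet_image.2 measurableSet_DeltaFin)).1 hconc
  refine ⟨ν.comap Subtype.val, ⟨?_⟩, ?_, fun s t hst => ?_⟩
  · rw [hemb.comap_apply]
    refine le_antisymm prob_le_one ?_
    rw [← hconc']
    exact measure_mono (image_mono (subset_univ _))
  · rw [hemb.comap_apply, hconc']
  · set A : Set (EReal × EReal) := Iic ((s : ℝ) : EReal) ×ˢ Ioi ((t : ℝ) : EReal) with hA
    have hpre : (Subtype.val ⁻¹' A : Set Delta) =
        quadrant ((s : ℝ) : EReal) ((t : ℝ) : EReal) := rfl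
    -- Births at `s` and deaths at `t` have no limiting mass, so the limit on this quadrant is the
    -- prescribed frequency.
    have hfr : ν (frontier A) = 0 := by
      refine measure_mono_null (t := {q | q.1 = ((s : ℝ) : EReal)} ∪ {q | q.2 = ((t : ℝ) : EReal)})
        ?_ (measure_union_null (hbirth _ (hrat s)) (hdeath _ (hrat t)))
      rw [hA, frontier_prod_eq]
      refine union_subset (fun q hq => Or.inr ?_) fun q hq => Or.inl (frontier_Iic_subset _ hq.1)
      have := hq.2
      rw [← compl_Iic, frontier_compl] at this
      exact frontier_Iic_subset _ this
    have hprob := hφ.tendsto_atTop.eventually hmap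
    have h1 := hπν.tendsto_of_null_frontier (Eventually.of_forall fun n => inferInstance) hfr
    have h2 := (h.tendsto_quadrant hp hst).comp hφ.tendsto_atTop
    have hAm : MeasurableSet A := measurableSet_Iic.prod measurableSet_Ioi
    have h3 : ν.real A = β s t / p := by
      refine tendsto_nhds_unique (h1.congr' ?_) h2
      filter_upwards [hπ] with n hn
      rw [hn, Function.comp_apply, measureReal_def, Measure.map_apply measurable_subtype_coe hAm,
        hpre, measureReal_def]
    rw [← h3, measureReal_def, measureReal_def, hemb.comap_apply, ← hpre,
      Subtype.image_preimage_coe]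
    congr 1
    refine le_antisymm (measure_mono inter_subset_right) ?_
    refine measure_mono_ae ?_
    filter_upwards [compl_mem_ae_iff.2 hconc] with q hq hqA
    rw [compl_compl] at hq
    obtain ⟨⟨q, hq'⟩, -, rfl⟩ := hq
    exact ⟨hq', hqA⟩

end IsTypical

end

end SublevelPH

namespace SublevelPH

noncomputable section

/-! ### Lifetimes -/

/-- The relation `b < d` excludes `b = ∞` and `d = -∞`, so the difference is never of the form `∞ -
∞`. -/
theorem continuous_death_sub_birth : Continuous fun p : Delta => p.1.2 - p.1.1 := by
  rw [continuous_iff_continuousAt]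
  intro p
  have h1 : p.1.1 ≠ ⊤ := ne_top_of_lt p.2.2
  have h2 : p.1.2 ≠ ⊥ := (p.2.1.trans p.2.2).ne'
  have h := EReal.continuousAt_add (p := (p.1.2, -p.1.1))
    (Or.inr fun h => h1 (by simpa using h)) (Or.inl h2)
  have h3 : ContinuousAt (fun p : Delta => (p.1.2, -p.1.1)) p :=
    (continuous_death.prodMk continuous_birth.neg).continuousAt
  exact ContinuousAt.comp (f := fun p : Delta => (p.1.2, -p.1.1)) h h3

theorem lifetime_eq {p : Delta} (hp : p ∈ DeltaFin) :
    lifetime p = p.1.2.toReal - p.1.1.toReal :=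
  EReal.toReal_sub hp (p.2.1.trans p.2.2).ne' (ne_top_of_lt p.2.2) p.2.1.ne'

theorem lifetime_pos {p : Delta} (hp : p ∈ DeltaFin) : 0 < lifetime p := by
  rw [lifetime_eq hp, sub_pos]
  rw [← EReal.coe_lt_coe_iff, EReal.coe_toReal hp (p.2.1.trans p.2.2).ne',
    EReal.coe_toReal (ne_top_of_lt p.2.2) p.2.1.ne']
  exact p.2.2

theorem continuous_lifetime : Continuous fun p : DeltaFin => lifetime p := by
  have h : (fun p : DeltaFin => lifetime p) = fun p => p.1.1.2.toReal - p.1.1.1.toReal :=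
    funext fun p => lifetime_eq p.2
  rw [h]
  refine Continuous.sub ?_ ?_
  · refine EReal.continuousOn_toReal.comp_continuous
      (continuous_death.comp continuous_subtype_val) fun p => ?_
    simp only [mem_compl_iff, mem_insert_iff, mem_singleton_iff, not_or]
    exact ⟨(p.1.2.1.trans p.1.2.2).ne', p.2⟩
  · refine EReal.continuousOn_toReal.comp_continuous
      (continuous_birth.comp continuous_subtype_val) fun p => ?_
    simp only [mem_compl_iff, mem_insert_iff, mem_singleton_iff, not_or]
    exact ⟨p.1.2.1.ne', ne_top_of_lt p.1.2.2⟩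

/-- Unlike `u log u`, the function `u log (1 + u)` is monotone and nonnegative on `[0, ∞)`. With 2
added it dominates both `u` and `|u log u|`, so one tail condition serves both averages. -/
theorem mul_log_one_add_mono {u v : ℝ} (hu : 0 ≤ u) (huv : u ≤ v) :
    u * Real.log (1 + u) ≤ v * Real.log (1 + v) := by
  have h1 : Real.log (1 + u) ≤ Real.log (1 + v) := Real.log_le_log (by linarith) (by linarith)
  have h2 : 0 ≤ Real.log (1 + u) := Real.log_nonneg (by linarith)
  exact mul_le_mul huv h1 h2 (hu.trans huv)

theorem mul_log_one_add_nonneg {u : ℝ} (hu : 0 ≤ u) : 0 ≤ u * Real.log (1 + u) :=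
  mul_nonneg hu (Real.log_nonneg (by linarith))

theorem abs_mul_log_le {u : ℝ} (hu : 0 ≤ u) : |u * Real.log u| ≤ 2 + u * Real.log (1 + u) := by
  have h0 := mul_log_one_add_nonneg hu
  rcases hu.eq_or_lt with rfl | hu'
  · simp
  rcases le_total u 1 with h | h
  · have := Real.abs_log_mul_self_lt u hu' h
    rw [mul_comm]
    linarith
  · rw [abs_of_nonneg (mul_nonneg hu (Real.log_nonneg h))]
    have : Real.log u ≤ Real.log (1 + u) := Real.log_le_log hu' (by linarith)
    have := mul_le_mul_of_nonneg_left this hu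
    linarith

theorem abs_le_two_add_mul_log {u : ℝ} (hu : 0 ≤ u) : |u| ≤ 2 + u * Real.log (1 + u) := by
  rw [abs_of_nonneg hu]
  have h0 := mul_log_one_add_nonneg hu
  rcases le_total u 2 with h | h
  · linarith
  · have h1 : 1 ≤ Real.log (1 + u) := by
      rw [Real.le_log_iff_exp_le (by linarith)]
      have := Real.exp_one_lt_d9
      linarith
    have := mul_le_mul_of_nonneg_left h1 hu
    linarith

theorem excess_nonneg (M a : ℝ) : 0 ≤ excess M a := le_max_right _ _

/-- The lifetime is at most `|b| + |d|`, hence at most twice the larger of the two, so the excess at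
one endpoint suffices. -/
theorem max_sub_le_excess {M b d v : ℝ} (hbd : b ≤ d)
    (hv : v ≤ 2 + (d - b) * Real.log (1 + (d - b))) :
    max (v - M) 0 ≤ excess M b + excess M d := by
  have hb := excess_nonneg M b
  have hd := excess_nonneg M d
  refine max_le ?_ (by linarith)
  have hle : d - b ≤ |d| + |b| := by
    have := le_abs_self d
    have := neg_abs_le b
    linarith
  rcases le_total |d| |b| with h | h
  · have := mul_log_one_add_mono (sub_nonneg.2 hbd) (v := 2 * |b|) (by linarith)
    have h2 : 2 + 2 * |b| * Real.log (1 + 2 * |b|) - M ≤ excess M b := le_max_left _ _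
    linarith
  · have := mul_log_one_add_mono (sub_nonneg.2 hbd) (v := 2 * |d|) (by linarith)
    have h2 : 2 + 2 * |d| * Real.log (1 + 2 * |d|) - M ≤ excess M d := le_max_left _ _
    linarith

variable {y : ℕ → ℝ} {β : ℚ → ℚ → ℝ} {p : ℝ} {ξ₀ : Measure Delta}

/-- Births contribute the sum over the sample once and deaths at most twice. The vertices with value
`∞` contribute nothing, as `EReal.toReal ⊤ = 0` and the excess at 0 vanishes for `M ≥ 2`. -/
theorem sum_finBars_excess_le {n : ℕ} {M : ℝ} (hM : 2 ≤ M) {f : Delta → ℝ}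
    (hf : ∀ q ∈ DeltaFin, |f q| ≤ 2 + lifetime q * Real.log (1 + lifetime q)) :
    ∑ i ∈ finBars y n, max (|f (bar (extend y n) i)| - M) 0 ≤
      3 * ∑ i ∈ Finset.range n, excess M (y i) := by
  set φ : EReal → ℝ := fun a => excess M a.toReal with hφ
  have hφ0 : ∀ a, 0 ≤ φ a := fun a => excess_nonneg _ _
  have htop : φ ⊤ = 0 := by
    simp only [hφ, excess, EReal.toReal_top, abs_zero, mul_zero, zero_mul, add_zero]
    exact max_eq_right (by linarith)
  have h1 := sum_birth_le (y := y) (n := n) hφ0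
  have h2 := sum_sampleBars_death_le (y := y) (n := n) hφ0
  rw [htop, mul_zero, add_zero] at h1 h2
  have h3 : ∑ i ∈ finBars y n, max (|f (bar (extend y n) i)| - M) 0 ≤
      ∑ i ∈ finBars y n, (φ (extend y n i) + φ (death (extend y n) i)) := by
    refine Finset.sum_le_sum fun i hi => ?_
    obtain ⟨hi, hd⟩ := mem_finBars.1 hi
    have hfin := (bar_mem_DeltaFin hi).2 hd
    have h4 := hf _ hfin
    have h5 := lifetime_pos hfin
    have h6 := lifetime_eq hfin
    rw [bar_extend hi] at h6
    simp only at h6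
    rw [h6] at h4 h5
    exact max_sub_le_excess (sub_pos.1 h5).le h4
  have h4 : ∑ i ∈ finBars y n, (φ (extend y n i) + φ (death (extend y n) i)) ≤
      ∑ i ∈ sampleBars y n, (φ (extend y n i) + φ (death (extend y n) i)) :=
    Finset.sum_le_sum_of_subset_of_nonneg (fun i hi => (mem_finBars.1 hi).1)
      fun i _ _ => add_nonneg (hφ0 _) (hφ0 _)
  rw [Finset.sum_add_distrib, Finset.sum_add_distrib] at h4
  rw [Finset.sum_add_distrib] at h3
  have h5 : ∑ i ∈ Finset.range n, φ (y i) = ∑ i ∈ Finset.range n, excess M (y i) := rfl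
  linarith

instance {μ : Measure Delta} [IsFiniteMeasure μ] : IsFiniteMeasure (finPart μ) :=
  ⟨by rw [finPart_univ]; exact measure_lt_top _ _⟩

theorem isProbabilityMeasure_finPart (hfin : ξ₀ DeltaFin = 1) :
    IsProbabilityMeasure (finPart ξ₀) := ⟨by rw [finPart_univ, hfin]⟩

namespace IsTypical

theorem tendsto_rect (h : IsTypical y β p) (hp : 0 < p) [IsProbabilityMeasure ξ₀]
    (hξ : ∀ s t : ℚ, s ≤ t →
      ξ₀.real (quadrant ((s : ℝ) : EReal) ((t : ℝ) : EReal)) = β s t / p)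
    {A : Set Delta} (hA : A ∈ rationalRects) :
    Tendsto (fun n => (normalized (diagramMeasure (extend y n))).real A) atTop
      (𝓝 (ξ₀.real A)) := by
  have hq : ∀ s t : ℚ, s ≤ t → Tendsto (fun n => (normalized (diagramMeasure (extend y n))).real
      (quadrant ((s : ℝ) : EReal) ((t : ℝ) : EReal))) atTop
      (𝓝 (ξ₀.real (quadrant ((s : ℝ) : EReal) ((t : ℝ) : EReal)))) := fun s t hst => by
    rw [hξ s t hst]
    exact h.tendsto_quadrant hp hst
  obtain ⟨s₁, s₂, t₁, t₂, ⟨h1, h2, h3, h4⟩, rfl⟩ := hA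
  have h1' : (((s₁ : ℝ)) : EReal) ≤ ((s₂ : ℝ) : EReal) :=
    EReal.coe_le_coe_iff.2 (Rat.cast_le.2 h1)
  have hq' : ∀ s : ℚ, s ≤ t₁ → Tendsto (fun n =>
      (normalized (diagramMeasure (extend y n))).real (quadrant ((s : ℝ) : EReal) t₂)) atTop
      (𝓝 (ξ₀.real (quadrant ((s : ℝ) : EReal) t₂))) := by
    intro s hs
    rcases h4 with rfl | ⟨q, rfl⟩
    · simp only [quadrant_top, measureReal_empty, tendsto_const_nhds]
    · exact hq s q (hs.trans (Rat.cast_le.1 (EReal.coe_le_coe_iff.1 h3)))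
  rw [measureReal_rect ξ₀ h1' h3]
  refine ((hq s₂ t₁ h2).sub (((hq s₁ t₁ (h1.trans h2)).add (hq' s₂ h2)).sub
    (hq' s₁ (h1.trans h2)))).congr' ?_
  filter_upwards [h.eventually_isProbabilityMeasure hp] with n hn
  rw [measureReal_rect _ h1' h3]

/-- Weak convergence of the normalized diagrams. -/
theorem weaklyTendsto (h : IsTypical y β p) (hp : 0 < p) [IsProbabilityMeasure ξ₀]
    (hξ : ∀ s t : ℚ, s ≤ t →
      ξ₀.real (quadrant ((s : ℝ) : EReal) ((t : ℝ) : EReal)) = β s t / p) :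
    WeaklyTendsto (fun n => normalized (diagramMeasure (extend y n))) ξ₀ := by
  refine weaklyTendsto_of_isPiSystem (h.eventually_isProbabilityMeasure hp)
    isPiSystem_rationalRects ?_ (fun U hU q hq => exists_rationalRect hU hq)
    fun A hA => h.tendsto_rect hp hξ hA
  rintro _ ⟨s₁, s₂, t₁, t₂, -, rfl⟩
  exact measurableSet_rect _ _ _ _

theorem eventually_isProbabilityMeasure_finPart (h : IsTypical y β p) (hp : 0 < p) :
    ∀ᶠ n in atTop,
      IsProbabilityMeasure (normalized (finPart (diagramMeasure (extend y n)))) := by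
  filter_upwards [h.eventually_le_card hp] with n hn
  refine isProbabilityMeasure_normalized ?_
  rw [finPart_diagramMeasure_real_univ]
  exact_mod_cast hn.1

theorem tendsto_card_fin_atTop (h : IsTypical y β p) (hp : 0 < p) :
    Tendsto (fun n => ((finBars y n).card : ℝ)) atTop atTop := by
  have h1 : Tendsto (fun n : ℕ => (n : ℝ) * (p / 2)) atTop atTop :=
    tendsto_natCast_atTop_atTop.atTop_mul_const (by positivity)
  refine tendsto_atTop_mono' _ ?_ h1
  filter_upwards [h.eventually_le_card hp] with n hn
  linarith [hn.2]

/-- Weak convergence of the normalized diagrams of finite bars. -/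
theorem weaklyTendsto_finPart (h : IsTypical y β p) (hp : 0 < p) [IsProbabilityMeasure ξ₀]
    (hfin : ξ₀ DeltaFin = 1) (hξ : ∀ s t : ℚ, s ≤ t →
      ξ₀.real (quadrant ((s : ℝ) : EReal) ((t : ℝ) : EReal)) = β s t / p) :
    WeaklyTendsto (fun n => normalized (finPart (diagramMeasure (extend y n))))
      (finPart ξ₀) := by
  have := isProbabilityMeasure_finPart hfin
  have hAm : ∀ A ∈ rationalRects, MeasurableSet A := by
    rintro _ ⟨s₁, s₂, t₁, t₂, -, rfl⟩
    exact measurableSet_rect _ _ _ _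
  refine weaklyTendsto_of_isPiSystem (h.eventually_isProbabilityMeasure_finPart hp)
    (isPiSystem_rationalRects.comap Subtype.val) ?_ ?_ ?_
  · rintro _ ⟨A, hA, rfl⟩
    exact measurable_subtype_coe (hAm A hA)
  · intro U hU q hq
    obtain ⟨V, hV, rfl⟩ := isOpen_induced_iff.1 hU
    obtain ⟨A, hA, hqA, hAV⟩ := exists_rationalRect hV hq
    exact ⟨_, ⟨A, hA, rfl⟩, continuous_subtype_val.continuousAt.preimage_mem_nhds hqA,
      preimage_mono hAV⟩
  · rintro _ ⟨A, hA, rfl⟩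
    have hlim : (finPart ξ₀).real (Subtype.val ⁻¹' A) = ξ₀.real A := by
      rw [measureReal_def, finPart_apply, measureReal_def]
      congr 1
      refine measure_congr (inter_ae_eq_left_of_ae_eq_univ (eventuallyEq_univ.2 ?_))
      rw [mem_ae_iff, prob_compl_eq_zero_iff measurableSet_DeltaFin]
      exact hfin
    rw [hlim]
    have h1 := h.tendsto_rect hp hξ hA
    have h2 : Tendsto (fun n => ((sampleBars y n).card : ℝ) / (finBars y n).card) atTop (𝓝 1) := by
      have := h.tendsto_card.div h.tendsto_card_fin hp.ne'
      rw [div_self hp.ne'] at this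
      refine this.congr' ?_
      filter_upwards [eventually_gt_atTop 0] with n hn
      have hn' : (n : ℝ) ≠ 0 := Nat.cast_ne_zero.2 hn.ne'
      rw [Pi.div_apply, div_div_div_cancel_right₀ hn']
    have h3 : Tendsto (fun n => 1 / ((finBars y n).card : ℝ)) atTop (𝓝 0) :=
      tendsto_const_nhds.div_atTop (h.tendsto_card_fin_atTop hp)
    have h4 := h1.mul h2
    rw [mul_one] at h4
    have h5 := h4.sub h3
    rw [sub_zero] at h5
    -- Dropping the infinite bar removes at most one point from `A`, which is the error `1 /
    -- (finBars y n).card`; `h2` changes the normalization.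
    refine tendsto_of_tendsto_of_tendsto_of_le_of_le' h5 h4 ?_ ?_
    all_goals
      filter_upwards [h.eventually_le_card hp] with n hn
      have hF : (0 : ℝ) < (finBars y n).card := by exact_mod_cast hn.1
      have hS : (0 : ℝ) < (sampleBars y n).card := by
        exact_mod_cast hn.1.trans_le card_finBars_le
      rw [normalized_real, normalized_real, finPart_diagramMeasure_real_univ,
        diagramMeasure_real_univ, measureReal_def (finPart _), finPart_apply, ← measureReal_def,
        div_mul_div_cancel₀ hS.ne']
    · rw [← sub_div]
      gcongr
      have h6 := measureReal_inter_add_sdiff (μ := diagramMeasure (extend y n)) (s := A)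
        measurableSet_DeltaFin
      have h7 : (diagramMeasure (extend y n)).real (A \ DeltaFin) ≤
          (diagramMeasure (extend y n)).real DeltaFinᶜ := measureReal_mono fun q hq => hq.2
      have h8 := measureReal_add_measureReal_compl (μ := diagramMeasure (extend y n))
        measurableSet_DeltaFin
      have h9 : (diagramMeasure (extend y n)).real DeltaFin = (finBars y n).card := by
        rw [← finPart_diagramMeasure_real_univ, measureReal_def, measureReal_def, finPart_univ]
      rw [diagramMeasure_real_univ, h9] at h8
      have h10 : ((sampleBars y n).card : ℝ) ≤ (finBars y n).card + 1 := by
        exact_mod_cast card_sampleBars_le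
      linarith
    · exact div_le_div_of_nonneg_right (measureReal_mono inter_subset_left) hF.le

/-- Convergence of the averages of functions of the lifetime of moderate growth. -/
theorem tendsto_average (h : IsTypical y β p) (hp : 0 < p) [IsProbabilityMeasure ξ₀]
    (hfin : ξ₀ DeltaFin = 1) (hξ : ∀ s t : ℚ, s ≤ t →
      ξ₀.real (quadrant ((s : ℝ) : EReal) ((t : ℝ) : EReal)) = β s t / p)
    {f : Delta → ℝ} (hfc : Continuous fun q : DeltaFin => f q)
    (hf : ∀ q ∈ DeltaFin, |f q| ≤ 2 + lifetime q * Real.log (1 + lifetime q)) :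
    Integrable (fun q : DeltaFin => f q) (finPart ξ₀) ∧
      Tendsto (fun n => (∑ i ∈ finBars y n, f (bar (extend y n) i)) / (finBars y n).card) atTop
        (𝓝 (∫ q : DeltaFin, f q ∂finPart ξ₀)) := by
  have := isProbabilityMeasure_finPart hfin
  have hpos : ∀ᶠ n in atTop, 0 < (finPart (diagramMeasure (extend y n))).real univ := by
    filter_upwards [h.eventually_le_card hp] with n hn
    rw [finPart_diagramMeasure_real_univ]
    exact_mod_cast hn.1
  have hmain := (h.weaklyTendsto_finPart hp hfin hξ).tendsto_integral
    (h.eventually_isProbabilityMeasure_finPart hp) hfc ?_ ?_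
  · refine ⟨hmain.1, hmain.2.congr fun n => ?_⟩
    rw [integral_normalized, integral_finPart_diagramMeasure, finPart_diagramMeasure_real_univ]
  · filter_upwards [hpos] with n hn
    exact integrable_normalized (integrable_finPart (integrable_diagramMeasure f)) hn
  · intro η hη
    -- The factor 3 of `sum_finBars_excess_le` gives `η p n / 2`, which is at most `η` times the
    -- number of finite bars.
    obtain ⟨M, hM, hMn⟩ := h.tail (η * p / 6) (by positivity)
    refine ⟨M, ?_⟩
    filter_upwards [hMn, h.eventually_le_card hp] with n h1 h2
    have hF : (0 : ℝ) < (finBars y n).card := by exact_mod_cast h2.1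
    rw [integral_normalized, integral_finPart_diagramMeasure (fun q => max (|f q| - M) 0),
      finPart_diagramMeasure_real_univ, div_le_iff₀ hF]
    have h3 := sum_finBars_excess_le (y := y) (n := n) hM hf
    have h4 := mul_le_mul_of_nonneg_left h2.2 hη.le
    linarith

theorem tendsto_lifetime (h : IsTypical y β p) (hp : 0 < p) [IsProbabilityMeasure ξ₀]
    (hfin : ξ₀ DeltaFin = 1) (hξ : ∀ s t : ℚ, s ≤ t →
      ξ₀.real (quadrant ((s : ℝ) : EReal) ((t : ℝ) : EReal)) = β s t / p) :
    Integrable (fun q : DeltaFin => lifetime q) (finPart ξ₀) ∧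
      Tendsto (fun n => (∑ i ∈ finBars y n, lifetime (bar (extend y n) i)) / (finBars y n).card)
        atTop (𝓝 (∫ q : DeltaFin, lifetime q ∂finPart ξ₀)) :=
  h.tendsto_average hp hfin hξ continuous_lifetime
    fun _ hq => abs_le_two_add_mul_log (lifetime_pos hq).le

theorem tendsto_lifetime_mul_log (h : IsTypical y β p) (hp : 0 < p) [IsProbabilityMeasure ξ₀]
    (hfin : ξ₀ DeltaFin = 1) (hξ : ∀ s t : ℚ, s ≤ t →
      ξ₀.real (quadrant ((s : ℝ) : EReal) ((t : ℝ) : EReal)) = β s t / p) :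
    Integrable (fun q : DeltaFin => lifetime q * Real.log (lifetime q)) (finPart ξ₀) ∧
      Tendsto (fun n => (∑ i ∈ finBars y n, lifetime (bar (extend y n) i) *
        Real.log (lifetime (bar (extend y n) i))) / (finBars y n).card)
        atTop (𝓝 (∫ q : DeltaFin, lifetime q * Real.log (lifetime q) ∂finPart ξ₀)) :=
  h.tendsto_average (f := fun q => lifetime q * Real.log (lifetime q)) hp hfin hξ
    (Real.continuous_mul_log.comp continuous_lifetime)
    fun _ hq => abs_mul_log_le (lifetime_pos hq).le

end IsTypical

theorem integral_lifetime_pos [IsProbabilityMeasure ξ₀] (hfin : ξ₀ DeltaFin = 1)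
    (hi : Integrable (fun q : DeltaFin => lifetime q) (finPart ξ₀)) :
    0 < ∫ q : DeltaFin, lifetime q ∂finPart ξ₀ := by
  have := isProbabilityMeasure_finPart hfin
  rw [integral_pos_iff_support_of_nonneg (fun q => (lifetime_pos q.2).le) hi]
  have : Function.support (fun q : DeltaFin => lifetime q) = univ :=
    eq_univ_of_forall fun q => (lifetime_pos q.2).ne'
  rw [this, measure_univ]
  exact one_pos

/-- The entropy of the weights `l i / ∑ l`. -/
theorem entropy_eq {ι : Type*} {s : Finset ι} (hs : s.Nonempty) {l : ι → ℝ}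
    (hl : ∀ i ∈ s, 0 < l i) :
    -(∑ i ∈ s, l i / (∑ j ∈ s, l j) * Real.log (l i / ∑ j ∈ s, l j)) - Real.log s.card =
      -(((∑ i ∈ s, l i * Real.log (l i)) / s.card) / ((∑ i ∈ s, l i) / s.card)) +
        Real.log ((∑ i ∈ s, l i) / s.card) := by
  set T := ∑ j ∈ s, l j with hT
  have hTpos : 0 < T := Finset.sum_pos hl hs
  have hc : (0 : ℝ) < s.card := by exact_mod_cast hs.card_pos
  have h1 : ∑ i ∈ s, l i / T * Real.log (l i / T) =
      (∑ i ∈ s, l i * Real.log (l i)) / T - Real.log T := by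
    have : ∀ i ∈ s, l i / T * Real.log (l i / T) =
        l i * Real.log (l i) / T - l i / T * Real.log T := fun i hi => by
      rw [Real.log_div (hl i hi).ne' hTpos.ne']
      ring
    rw [Finset.sum_congr rfl this, Finset.sum_sub_distrib, ← Finset.sum_div, ← Finset.sum_mul,
      ← Finset.sum_div, ← hT, div_self hTpos.ne', one_mul]
  rw [h1, div_div_div_cancel_right₀ hc.ne', Real.log_div hTpos.ne' hc.ne']
  ring

/-- Convergence of persistent entropy. -/
theorem IsTypical.tendsto_entropy (h : IsTypical y β p) (hp : 0 < p) [IsProbabilityMeasure ξ₀]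
    (hfin : ξ₀ DeltaFin = 1) (hξ : ∀ s t : ℚ, s ≤ t →
      ξ₀.real (quadrant ((s : ℝ) : EReal) ((t : ℝ) : EReal)) = β s t / p) :
    Tendsto (fun n => persistentEntropy (extend y n) -
      Real.log ((finPart (diagramMeasure (extend y n))).real univ)) atTop
      (𝓝 (-(∫ q : DeltaFin, lifetime q * Real.log (lifetime q) ∂finPart ξ₀) /
        (∫ q : DeltaFin, lifetime q ∂finPart ξ₀) +
          Real.log (∫ q : DeltaFin, lifetime q ∂finPart ξ₀))) := by
  obtain ⟨hi, h1⟩ := h.tendsto_lifetime hp hfin hξ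
  obtain ⟨-, h2⟩ := h.tendsto_lifetime_mul_log hp hfin hξ
  have hpos := integral_lifetime_pos hfin hi
  rw [neg_div]
  refine (((h2.div h1 hpos.ne').neg).add (h1.log hpos.ne')).congr' ?_
  filter_upwards [h.eventually_le_card hp] with n hn
  rw [persistentEntropy, totalLifetime, finPoints_map_sum, finPoints_map_sum,
    finPart_diagramMeasure_real_univ]
  refine (entropy_eq (Finset.card_pos.1 hn.1) fun i hi => ?_).symm
  obtain ⟨hi, hd⟩ := mem_finBars.1 hi
  exact lifetime_pos ((bar_mem_DeltaFin hi).2 hd)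

/-! ### The ALPS statistic -/

theorem isOpen_DeltaGT (l : ℝ) : IsOpen (DeltaGT l) :=
  isOpen_Ioi.preimage continuous_death_sub_birth

theorem antitone_measureReal_DeltaGT (μ : Measure Delta) [IsFiniteMeasure μ] :
    Antitone fun l : ℝ => μ.real (DeltaGT l) := fun l l' hl =>
  measureReal_mono fun q hq => lt_of_le_of_lt (EReal.coe_le_coe_iff.2 hl) hq

/-- The frontier lies in a level set of `d - b`. These are disjoint, so only countably many have
positive mass. -/
theorem ae_null_frontier_DeltaGT (μ : Measure Delta) [IsFiniteMeasure μ] :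
    ∀ᵐ l : ℝ, μ (frontier (DeltaGT l)) = 0 := by
  have hc : {v : EReal | 0 < μ {q : Delta | q.1.2 - q.1.1 = v}}.Countable :=
    Measure.countable_meas_level_set_pos continuous_death_sub_birth.measurable
  have hc' : {l : ℝ | 0 < μ {q : Delta | q.1.2 - q.1.1 = (l : EReal)}}.Countable :=
    hc.preimage EReal.coe_injective
  filter_upwards [hc'.ae_notMem volume] with l hl
  have h0 : μ {q : Delta | q.1.2 - q.1.1 = (l : EReal)} = 0 := by
    by_contra h
    exact hl (pos_iff_ne_zero.2 h)
  refine measure_mono_null (fun q hq => ?_) h0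
  have h1 := continuous_death_sub_birth.frontier_preimage_subset (Ioi (l : EReal)) hq
  rw [mem_preimage, ← compl_Iic, frontier_compl] at h1
  exact frontier_Iic_subset _ h1

/-- Convergence of the ALPS statistic. -/
theorem IsTypical.tendsto_ALPS (h : IsTypical y β p) (hp : 0 < p) [IsProbabilityMeasure ξ₀]
    (hξ : ∀ s t : ℚ, s ≤ t →
      ξ₀.real (quadrant ((s : ℝ) : EReal) ((t : ℝ) : EReal)) = β s t / p)
    {L : ℝ} (hL : 0 < L) (hξL : 0 < ξ₀ (DeltaGT L)) :
    Tendsto (fun n => L * Real.log ((diagramMeasure (extend y n)).real univ) -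
      truncatedALPS (extend y n) L) atTop
      (𝓝 (-∫ l in (0 : ℝ)..L, Real.log (ξ₀.real (DeltaGT l)))) := by
  have hw := h.weaklyTendsto hp hξ
  have hprob := h.eventually_isProbabilityMeasure hp
  -- As `Δ_L` is open, its mass is eventually at least `c`. By monotonicity in `l` all masses on
  -- `[0, L]` then lie between `c` and 1, and `|log c|` dominates their logarithms.
  obtain ⟨c, hc0, hc⟩ := exists_between hξL
  have hctop : c ≠ ⊤ := (hc.trans (measure_lt_top _ _)).ne
  have hδ : 0 < c.toReal := ENNReal.toReal_pos hc0.ne' hctop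
  have hlow : ∀ᶠ n in atTop,
      c.toReal ≤ (normalized (diagramMeasure (extend y n))).real (DeltaGT L) := by
    filter_upwards [eventually_lt_of_lt_liminf
      (hc.trans_le (hw.le_liminf_of_isOpen hprob (isOpen_DeltaGT L))), hprob] with n h1 h2
    exact ENNReal.toReal_mono (measure_ne_top _ _) h1.le
  have hlow₀ : c.toReal ≤ ξ₀.real (DeltaGT L) :=
    ENNReal.toReal_mono (measure_ne_top _ _) hc.le
  have hmain : Tendsto (fun n => ∫ l in (0 : ℝ)..L,
      Real.log ((normalized (diagramMeasure (extend y n))).real (DeltaGT l))) atTop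
      (𝓝 (∫ l in (0 : ℝ)..L, Real.log (ξ₀.real (DeltaGT l)))) := by
    refine intervalIntegral.tendsto_integral_filter_of_dominated_convergence
      (fun _ => |Real.log c.toReal|) ?_ ?_ intervalIntegrable_const ?_
    · filter_upwards [hprob] with n hn
      exact (Real.measurable_log.comp
        (antitone_measureReal_DeltaGT _).measurable).aestronglyMeasurable
    · filter_upwards [hprob, hlow] with n hn h1
      refine ae_of_all _ fun l hl => ?_
      rw [uIoc_of_le hL.le] at hl
      have h2 := h1.trans (antitone_measureReal_DeltaGT _ hl.2)
      rw [Real.norm_eq_abs, abs_of_nonpos (Real.log_nonpos measureReal_nonneg measureReal_le_one)]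
      have h3 := Real.log_le_log hδ h2
      have h4 := neg_abs_le (Real.log c.toReal)
      linarith
    · filter_upwards [ae_null_frontier_DeltaGT ξ₀] with l hl hl'
      rw [uIoc_of_le hL.le] at hl'
      have h2 := hδ.trans_le (hlow₀.trans (antitone_measureReal_DeltaGT _ hl'.2))
      exact (hw.tendsto_of_null_frontier hprob hl).log h2.ne'
  refine hmain.neg.congr' ?_
  filter_upwards [hprob, hlow, h.eventually_le_card hp] with n hn h1 h2
  set μ := diagramMeasure (extend y n) with hμ
  have hN : 0 < μ.real univ := by
    rw [hμ, diagramMeasure_real_univ]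
    exact_mod_cast h2.1.trans_le card_finBars_le
  have hpos : ∀ l ≤ L, 0 < μ.real (DeltaGT l) := by
    intro l hl
    have h3 : 0 < (normalized μ).real (DeltaGT l) :=
      hδ.trans_le (h1.trans (antitone_measureReal_DeltaGT _ hl))
    rw [normalized_real] at h3
    exact (div_pos_iff_of_pos_right hN).1 h3
  have hint : IntervalIntegrable (fun l => Real.log (μ.real (DeltaGT l))) volume 0 L := by
    refine AntitoneOn.intervalIntegrable fun a _ b hb hab => ?_
    rw [uIcc_of_le hL.le] at hb
    exact Real.log_le_log (hpos b hb.2) (antitone_measureReal_DeltaGT μ hab)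
  have heq : ∫ l in (0 : ℝ)..L, Real.log ((normalized μ).real (DeltaGT l)) =
      ∫ l in (0 : ℝ)..L, (Real.log (μ.real (DeltaGT l)) - Real.log (μ.real univ)) := by
    refine intervalIntegral.integral_congr fun l hl => ?_
    rw [uIcc_of_le hL.le] at hl
    rw [normalized_real, Real.log_div (hpos l hl.2).ne' hN.ne']
  rw [heq, intervalIntegral.integral_sub hint intervalIntegrable_const,
    intervalIntegral.integral_const, truncatedALPS, smul_eq_mul, sub_zero]
  ring

end

end SublevelPH

namespace SublevelPH

noncomputable section

/-! ### Sequences of a stationary and ergodic process are typical -/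

theorem measurableSet_upcrossing (s t : ℝ) : MeasurableSet (upcrossing s t) := by
  unfold upcrossing
  measurability

theorem measurableSet_shallowMin (F : Finset ℝ) : MeasurableSet (shallowMin F) := by
  have h : ∀ i j, MeasurableSet {y : ℕ → ℝ | y i < y j} := fun i j =>
    measurableSet_lt (measurable_pi_apply i) (measurable_pi_apply j)
  have : shallowMin F = {y | y 1 < y 0} ∩ {y | y 1 < y 2} ∩
      ⋂ q ∈ F, ({y | y 1 ≤ q} ∩ {y | q < y 0} ∩ {y | q < y 2})ᶜ := by
    ext y
    simp only [shallowMin, mem_ofPred_eq, mem_inter_iff, mem_iInter, mem_compl_iff, and_assoc]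
  rw [this]
  refine ((h _ _).inter (h _ _)).inter (Finset.measurableSet_biInter _ fun q _ => ?_)
  exact (((measurableSet_le (measurable_pi_apply 1) measurable_const).inter
    (measurableSet_lt measurable_const (measurable_pi_apply 0))).inter
    (measurableSet_lt measurable_const (measurable_pi_apply 2))).compl

variable {Q : Measure (ℕ → ℝ)}

theorem ae_ne_succ (hQ : Ergodic shift Q) (h1 : ∀ᵐ y ∂Q, y 0 ≠ y 1) :
    ∀ᵐ y ∂Q, ∀ i, y i ≠ y (i + 1) := by
  refine ae_all_iff.2 fun i => ?_
  have := (hQ.toMeasurePreserving.iterate i).quasiMeasurePreserving.ae h1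
  filter_upwards [this] with y hy
  simpa [iterate_shift, add_comm] using hy

variable [IsProbabilityMeasure Q]

theorem ae_tendsto_visits (hQ : Ergodic shift Q) {A : Set (ℕ → ℝ)} (hA : MeasurableSet A) :
    ∀ᵐ y ∂Q, Tendsto (fun n : ℕ => (visits A y n : ℝ) / n) atTop (𝓝 (Q.real A)) := by
  have := ae_tendsto_birkhoffSum_div hQ (f := A.indicator fun _ => (1 : ℝ))
    (measurable_const.indicator hA) ((integrable_const _).indicator hA)
  rw [integral_indicator hA] at this
  simpa [birkhoffSum_indicator] using this

theorem le_mul_of_div_lt {a ε : ℝ} {n : ℕ} (h : a / n < ε) (hn : 0 < n) : a ≤ ε * n :=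
  ((div_lt_iff₀ (by exact_mod_cast hn)).1 h).le

theorem ae_eventually_sum_le (hQ : Ergodic shift Q) {f : ℝ → ℝ} (hf : Measurable f)
    (hint : Integrable (fun y : ℕ → ℝ => f (y 0)) Q) {ε : ℝ} (hε : ∫ y, f (y 0) ∂Q < ε) :
    ∀ᵐ y ∂Q, ∀ᶠ n : ℕ in atTop, ∑ i ∈ Finset.range n, f (y i) ≤ ε * n := by
  filter_upwards [ae_eventually_birkhoffSum_le hQ (hf.comp (measurable_pi_apply 0)) hint hε]
    with y hy
  filter_upwards [hy, eventually_gt_atTop 0] with n hn hn0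
  have := le_mul_of_div_lt hn hn0
  simpa [birkhoffSum, iterate_shift] using this

/-- To find a property with an error `ε > 0` almost surely, it suffices to do so for each `ε`. -/
theorem ae_forall_pos {α : Type*} [MeasurableSpace α] {μ : Measure α} {R : α → ℝ → Prop}
    (hmono : ∀ a δ ε, δ ≤ ε → R a δ → R a ε) (h : ∀ ε > 0, ∀ᵐ a ∂μ, R a ε) :
    ∀ᵐ a ∂μ, ∀ ε > 0, R a ε := by
  have : ∀ᵐ a ∂μ, ∀ m : ℕ, R a (1 / ((m : ℝ) + 1)) :=
    ae_all_iff.2 fun m => h _ (by positivity)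
  filter_upwards [this] with a ha ε hε
  obtain ⟨m, hm⟩ := exists_nat_one_div_lt hε
  exact hmono a _ _ hm.le (ha m)

/-- Some rational lies between a strict local minimum and both of its neighbours, so these sets
decrease to the empty set along an enumeration of the rationals. -/
theorem exists_measure_shallowMin_lt {ε : ℝ} (hε : 0 < ε) :
    ∃ F : Finset ℚ, Q.real (shallowMin (F.image (↑))) < ε := by
  obtain ⟨e, he⟩ := exists_surjective_nat ℚ
  let A : ℕ → Set (ℕ → ℝ) := fun J => shallowMin (((Finset.range J).image e).image (↑))
  have hanti : Antitone A := by
    intro J K hJK y hy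
    refine ⟨hy.1, hy.2.1, fun q hq => hy.2.2 q ?_⟩
    exact Finset.image_subset_image (Finset.image_subset_image (Finset.range_subset_range.2 hJK)) hq
  have hempty : ⋂ J, A J = ∅ := by
    refine eq_empty_of_forall_notMem fun y hy => ?_
    rw [mem_iInter] at hy
    obtain ⟨q, hq1, hq2⟩ := exists_rat_btwn (lt_min (hy 0).1 (hy 0).2.1)
    obtain ⟨J, rfl⟩ := he q
    refine (hy (J + 1)).2.2 (e J) ?_ ⟨hq1.le, lt_min_iff.1 hq2⟩
    exact Finset.mem_image_of_mem _ (Finset.mem_image_of_mem _ (by simp))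
  have hlim := tendsto_measure_iInter_atTop (μ := Q) (s := A)
    (fun J => (measurableSet_shallowMin _).nullMeasurableSet) hanti ⟨0, measure_ne_top _ _⟩
  rw [hempty, measure_empty] at hlim
  have hlim' := (ENNReal.tendsto_toReal ENNReal.zero_ne_top).comp hlim
  obtain ⟨J, hJ⟩ := (hlim'.eventually (gt_mem_nhds (by simpa using hε))).exists
  exact ⟨_, hJ⟩

theorem ae_shallow (hQ : Ergodic shift Q) : ∀ᵐ y ∂Q, ∀ ε > 0, ∃ F : Finset ℚ,
    ∀ᶠ n : ℕ in atTop, (visits (shallowMin (F.image (↑))) y n : ℝ) ≤ ε * n := by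
  refine ae_forall_pos (fun y δ ε hδ ⟨F, hF⟩ => ⟨F, ?_⟩) fun ε hε => ?_
  · filter_upwards [hF] with n hn
    exact hn.trans (by gcongr)
  · obtain ⟨F, hF⟩ := exists_measure_shallowMin_lt (Q := Q) hε
    filter_upwards [ae_tendsto_visits hQ (measurableSet_shallowMin (F.image (↑)))] with y hy
    refine ⟨F, ?_⟩
    filter_upwards [hy.eventually (gt_mem_nhds hF), eventually_gt_atTop 0] with n hn hn0
    exact le_mul_of_div_lt hn hn0

theorem countable_ratPoints : ratPoints.Countable := by
  have : ratPoints ⊆ {⊤, ⊥} ∪ range fun q : ℚ => ((q : ℝ) : EReal) := by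
    rintro v (h | h | ⟨q, h⟩)
    · exact Or.inl (Or.inl h)
    · exact Or.inl (Or.inr h)
    · exact Or.inr ⟨q, h.symm⟩
  exact (((countable_singleton _).insert _).union (countable_range _)).mono this

/-- The law of `y 0` on `[-∞, ∞]` has no atoms, so by outer regularity `v` has an open neighbourhood
of mass below `ε`, whose visits the ergodic theorem counts. -/
theorem ae_atom (hQ : Ergodic shift Q) (h0 : ∀ a : ℝ, Q {y | y 0 = a} = 0) :
    ∀ᵐ y ∂Q, ∀ v ∈ ratPoints, ∀ ε > 0, ∃ O : Set EReal, IsOpen O ∧ v ∈ O ∧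
      ∀ᶠ n : ℕ in atTop,
        ∑ i ∈ Finset.range n, O.indicator (fun _ => (1 : ℝ)) (y i : EReal) ≤ ε * n := by
  refine (ae_ball_iff countable_ratPoints).2 fun v _ => ?_
  refine ae_forall_pos (fun y δ ε hδ ⟨O, hO, hv, h⟩ => ⟨O, hO, hv, ?_⟩) fun ε hε => ?_
  · filter_upwards [h] with n hn
    exact hn.trans (by gcongr)
  have hm : Measurable fun y : ℕ → ℝ => (y 0 : EReal) :=
    measurable_coe_real_ereal.comp (measurable_pi_apply 0)
  let ν := Q.map fun y => (y 0 : EReal)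
  have : IsProbabilityMeasure ν := Measure.isProbabilityMeasure_map hm.aemeasurable
  have hν : ν {v} < ENNReal.ofReal ε := by
    rw [Measure.map_apply hm (measurableSet_singleton v)]
    refine lt_of_eq_of_lt ?_ (ENNReal.ofReal_pos.2 hε)
    induction v with
    | bot => exact measure_mono_null (fun y hy => EReal.coe_ne_bot _ hy) measure_empty
    | top => exact measure_mono_null (fun y hy => EReal.coe_ne_top _ hy) measure_empty
    | coe a => simpa [preimage] using h0 a
  obtain ⟨O, hvO, hO, hlt⟩ := Set.exists_isOpen_lt_of_lt {v} _ hν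
  have hO' : MeasurableSet {y : ℕ → ℝ | (y 0 : EReal) ∈ O} := hm hO.measurableSet
  have hf : Measurable fun a : ℝ => O.indicator (fun _ => (1 : ℝ)) (a : EReal) :=
    (measurable_const.indicator hO.measurableSet).comp measurable_coe_real_ereal
  have heq : (fun y : ℕ → ℝ => O.indicator (fun _ => (1 : ℝ)) (y 0 : EReal)) =
      {y : ℕ → ℝ | (y 0 : EReal) ∈ O}.indicator fun _ => 1 := rfl
  have := ae_eventually_sum_le hQ hf (ε := ε)
    (by rw [heq]; exact (integrable_const _).indicator hO') (by
      rw [heq, integral_indicator hO']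
      rw [Measure.map_apply hm hO.measurableSet] at hlt
      rw [setIntegral_const, smul_eq_mul, mul_one]
      exact (ENNReal.lt_ofReal_iff_toReal_lt (measure_ne_top _ _)).1 hlt)
  filter_upwards [this] with y hy
  exact ⟨O, hO, hvO rfl, hy⟩

/-- The excess tends to 0 as `M` grows, dominated by the integrable `2 + 2 |y 0| log (1 + 2 |y 0|)`;
choose `M` with mean below `ε` and apply the ergodic theorem. -/
theorem ae_tail (hQ : Ergodic shift Q)
    (h2 : Integrable (fun y : ℕ → ℝ => 2 * |y 0| * Real.log (1 + 2 * |y 0|)) Q) :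
    ∀ᵐ y ∂Q, ∀ ε > 0, ∃ M : ℝ, 2 ≤ M ∧ ∀ᶠ n : ℕ in atTop,
      ∑ i ∈ Finset.range n, excess M (y i) ≤ ε * n := by
  refine ae_forall_pos (fun y δ ε hδ ⟨M, hM, h⟩ => ⟨M, hM, ?_⟩) fun ε hε => ?_
  · filter_upwards [h] with n hn
    exact hn.trans (by gcongr)
  have hmeas : ∀ M, Measurable (excess M) := fun M => by unfold excess; fun_prop
  have hbd : ∀ M, 0 ≤ M → ∀ y : ℕ → ℝ,
      ‖excess M (y 0)‖ ≤ 2 + 2 * |y 0| * Real.log (1 + 2 * |y 0|) := by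
    intro M hM y
    have : 0 ≤ 2 * |y 0| * Real.log (1 + 2 * |y 0|) :=
      mul_nonneg (by positivity) (Real.log_nonneg (by linarith [abs_nonneg (y 0)]))
    rw [Real.norm_eq_abs, abs_of_nonneg (excess_nonneg _ _)]
    exact max_le (by linarith) (by linarith)
  have hint2 := (integrable_const (μ := Q) (2 : ℝ)).add h2
  have hlim : Tendsto (fun M : ℕ => ∫ y : ℕ → ℝ, excess M (y 0) ∂Q) atTop (𝓝 (∫ _, 0 ∂Q)) := by
    refine tendsto_integral_of_dominated_convergence _
      (fun M => ((hmeas M).comp (measurable_pi_apply 0)).aestronglyMeasurable) hint2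
      (fun M => ae_of_all _ fun y => hbd M (by positivity) y) (ae_of_all _ fun y => ?_)
    refine tendsto_const_nhds.congr' ?_
    filter_upwards [tendsto_natCast_atTop_atTop.eventually
      (eventually_ge_atTop (2 + 2 * |y 0| * Real.log (1 + 2 * |y 0|)))] with M hM
    exact (max_eq_right (by linarith)).symm
  rw [integral_zero] at hlim
  obtain ⟨M, hM, hM2⟩ := ((hlim.eventually (gt_mem_nhds hε)).and (eventually_ge_atTop 2)).exists
  filter_upwards [ae_eventually_sum_le hQ (hmeas M) (hint2.mono'
    ((hmeas M).comp (measurable_pi_apply 0)).aestronglyMeasurable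
    (ae_of_all _ fun y => hbd M (by positivity) y)) hM] with y hy
  exact ⟨M, by exact_mod_cast hM2, hy⟩

/-- A stationary sequence that takes different values at `0` and `1` is not monotone there. -/
theorem not_ae_monotone (hQ : MeasurePreserving shift Q Q) (h1 : ∀ᵐ y ∂Q, y 0 ≠ y 1) :
    ¬(∀ᵐ y ∂Q, y 0 ≤ y 1) ∧ ¬∀ᵐ y ∂Q, y 1 ≤ y 0 := by
  -- The arctangent is bounded and strictly increasing, so means can be compared without a moment
  -- assumption: ordered variables with equal means coincide almost surely.
  have hm : ∀ i, Measurable fun y : ℕ → ℝ => Real.arctan (y i) := fun i =>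
    Real.measurable_arctan.comp (measurable_pi_apply i)
  have hint : ∀ i, Integrable (fun y : ℕ → ℝ => Real.arctan (y i)) Q := fun i =>
    Integrable.of_bound (hm i).aestronglyMeasurable (Real.pi / 2) (ae_of_all _ fun y =>
      abs_le.2 ⟨(Real.neg_pi_div_two_lt_arctan _).le, (Real.arctan_lt_pi_div_two _).le⟩)
  have heq : ∫ y, Real.arctan (y 1) ∂Q = ∫ y, Real.arctan (y 0) ∂Q := by
    conv_rhs => rw [← hQ.map_eq]
    rw [integral_map hQ.aemeasurable (hm 0).aestronglyMeasurable]
    rfl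
  have key : ∀ i j, (∫ y, Real.arctan (y i) ∂Q = ∫ y, Real.arctan (y j) ∂Q) →
      (∀ᵐ y ∂Q, y i ≤ y j) → ∀ᵐ y ∂Q, y i = y j := by
    intro i j hij h
    have h0 : (0 : (ℕ → ℝ) → ℝ) ≤ᵐ[Q] fun y => Real.arctan (y j) - Real.arctan (y i) := by
      filter_upwards [h] with y hy
      exact sub_nonneg.2 (Real.arctan_strictMono.monotone hy)
    have := (integral_eq_zero_iff_of_nonneg_ae h0 ((hint j).sub (hint i))).1 (by
      rw [integral_sub (hint j) (hint i), hij, sub_self])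
    filter_upwards [this] with y hy
    exact (Real.arctan_injective (sub_eq_zero.1 hy)).symm
  constructor
  · intro h
    obtain ⟨y, hy, hy'⟩ := ((key 0 1 heq.symm h).and h1).exists
    exact hy' hy
  · intro h
    obtain ⟨y, hy, hy'⟩ := ((key 1 0 heq h).and h1).exists
    exact hy' hy.symm

/-- Without local minima a descent is almost surely followed by a descent. The set of descents at
the start is then contained in its preimage under the shift, so it is trivial by ergodicity, and the
sequence would be almost surely monotone there. -/
theorem measure_localMin_pos (hQ : Ergodic shift Q) (h1 : ∀ᵐ y ∂Q, y 0 ≠ y 1) :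
    0 < Q.real (shallowMin ∅) := by
  refine ENNReal.toReal_pos (fun h => ?_) (measure_ne_top _ _)
  have hnot := not_ae_monotone hQ.toMeasurePreserving h1
  have hA : MeasurableSet {y : ℕ → ℝ | y 1 < y 0} :=
    measurableSet_lt (measurable_pi_apply 1) (measurable_pi_apply 0)
  have hle : {y : ℕ → ℝ | y 1 < y 0} ≤ᵐ[Q] shift ⁻¹' {y | y 1 < y 0} := by
    filter_upwards [measure_eq_zero_iff_ae_notMem.1 h, ae_ne_succ hQ h1] with y hy hne hy1
    by_contra hy2
    have hy3 : ¬ y 2 < y 1 := hy2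
    exact hy ⟨hy1, lt_of_le_of_ne (not_lt.1 hy3) (hne 1), by simp⟩
  rcases hQ.ae_empty_or_univ_of_ae_le_preimage' hA.nullMeasurableSet hle (measure_ne_top _ _)
    with h | h
  · refine hnot.1 ?_
    filter_upwards [h.mem_iff] with y hy
    simpa using hy
  · refine hnot.2 ?_
    filter_upwards [h.mem_iff] with y hy
    exact le_of_lt (hy.2 trivial)

theorem ae_isTypical (hQ : Ergodic shift Q) (h0 : ∀ a : ℝ, Q {y | y 0 = a} = 0)
    (h1 : ∀ᵐ y ∂Q, y 0 ≠ y 1)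
    (h2 : Integrable (fun y : ℕ → ℝ => 2 * |y 0| * Real.log (1 + 2 * |y 0|)) Q) :
    ∀ᵐ y ∂Q, IsTypical y (fun s t => Q.real (upcrossing s t)) (Q.real (shallowMin ∅)) := by
  have hup : ∀ᵐ y ∂Q, ∀ s t : ℚ, Tendsto (fun n : ℕ => (visits (upcrossing s t) y n : ℝ) / n)
      atTop (𝓝 (Q.real (upcrossing s t))) :=
    ae_all_iff.2 fun s => ae_all_iff.2 fun t => ae_tendsto_visits hQ (measurableSet_upcrossing s t)
  filter_upwards [ae_ne_succ hQ h1, hup, ae_tendsto_visits hQ (measurableSet_shallowMin ∅),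
    ae_shallow hQ, ae_atom hQ h0, ae_tail hQ h2] with y a b c d e f
  exact ⟨a, fun s t _ => b s t, c, d, e, f⟩

/-! ### The moment condition -/

theorem mul_log_one_add_le {u : ℝ} (hu : 0 ≤ u) :
    u * Real.log (1 + u) ≤ u * Real.log u + 1 := by
  rcases hu.eq_or_lt with rfl | hu
  · simp
  have h : Real.log (1 + u) - Real.log u ≤ 1 / u := by
    rw [← Real.log_div (by positivity) hu.ne']
    refine (Real.log_le_sub_one_of_pos (by positivity)).trans_eq ?_
    field_simp
    ring
  have := mul_le_mul_of_nonneg_left h hu.le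
  rw [mul_one_div_cancel hu.ne'] at this
  linarith

/-- With `g = u log u + 1` one has `0 ≤ u log (1 + u) ≤ g ≤ 1 + g ^ (1 + ε)`. -/
theorem MomentCondition.integrable {Ω : Type*} [MeasurableSpace Ω] {P : Measure Ω}
    [IsProbabilityMeasure P] {X : ℕ → Ω → ℝ} (hX : Measurable (X 0))
    (h : MomentCondition X P fun u => u * Real.log u + 1) :
    Integrable (fun ω => 2 * |X 0 ω| * Real.log (1 + 2 * |X 0 ω|)) P := by
  obtain ⟨ε, hε, h⟩ := h
  refine ((integrable_const (1 : ℝ)).add h).mono' (by fun_prop) (ae_of_all _ fun ω => ?_)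
  have hu : 0 ≤ 2 * |X 0 ω| := by positivity
  have hn : 0 ≤ 2 * |X 0 ω| * Real.log (1 + 2 * |X 0 ω|) :=
    mul_nonneg hu (Real.log_nonneg (by linarith))
  rw [Real.norm_eq_abs, abs_of_nonneg hn]
  refine (mul_log_one_add_le hu).trans ?_
  have hg := hn.trans (mul_log_one_add_le hu)
  simp only [Pi.add_apply]
  rcases le_total (2 * |X 0 ω| * Real.log (2 * |X 0 ω|) + 1) 1 with h1 | h1
  · exact h1.trans (le_add_of_nonneg_right (Real.rpow_nonneg hg _))
  · exact (Real.self_le_rpow_of_one_le h1 (by linarith)).trans (le_add_of_nonneg_left zero_le_one)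

theorem ae_isTypical_of_isStationaryErgodic {Ω : Type*} [MeasurableSpace Ω] {P : Measure Ω}
    [IsProbabilityMeasure P] {X : ℕ → Ω → ℝ} (hX : ∀ i, Measurable (X i))
    (hstat : IsStationaryErgodic X P) (hdens : HasPDF (X 0) P volume)
    (hne : P {ω | X 0 ω = X 1 ω} = 0) (hmom : MomentCondition X P fun u => u * Real.log u + 1) :
    ∃ (β : ℚ → ℚ → ℝ) (p : ℝ), 0 < p ∧ ∀ᵐ ω ∂P, IsTypical (fun i => X i ω) β p := by
  have hm : Measurable fun ω i => X i ω := measurable_pi_lambda _ hX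
  have := Measure.isProbabilityMeasure_map (μ := P) hm.aemeasurable
  have h1 : ∀ᵐ y ∂P.map fun ω i => X i ω, y 0 ≠ y 1 := by
    refine (ae_map_iff hm.aemeasurable ?_).2 (measure_eq_zero_iff_ae_notMem.1 hne)
    exact (measurableSet_eq_fun (measurable_pi_apply 0) (measurable_pi_apply 1)).compl
  refine ⟨_, _, measure_localMin_pos hstat h1, ae_of_ae_map hm.aemeasurable
    (ae_isTypical hstat (fun a => ?_) h1 ?_)⟩
  · have hm0 : Measurable fun y : ℕ → ℝ => y 0 := measurable_pi_apply 0
    have hac := hdens.absolutelyContinuous (measure_singleton a)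
    rw [Measure.map_apply (hX 0) (measurableSet_singleton a)] at hac
    exact (Measure.map_apply hm (hm0 (measurableSet_singleton a))).trans hac
  · refine (integrable_map_measure (by fun_prop) hm.aemeasurable).2 ?_
    exact hmom.integrable (hX 0)

end

end SublevelPH

/-! ### The main theorem -/

theorem mainTheorem5 {Ω : Type*} [MeasurableSpace Ω] (P : Measure Ω) [IsProbabilityMeasure P]
    (X : ℕ → Ω → ℝ) (hX : ∀ i, Measurable (X i))
    (hstat : SublevelPH.IsStationaryErgodic X P)
    (hdens : HasPDF (X 0) P volume)
    (hne : P {ω | X 0 ω = X 1 ω} = 0)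
    (hmomI : SublevelPH.MomentCondition X P fun u => u)
    (hmomE : SublevelPH.MomentCondition X P fun u => u * Real.log u + 1) :
    ∃ ξ₀ : Measure SublevelPH.Delta, IsProbabilityMeasure ξ₀ ∧
      (∀ᵐ ω ∂P, SublevelPH.WeaklyTendsto
        (fun n => SublevelPH.normalized
          (SublevelPH.diagramMeasure (SublevelPH.sample X n ω))) ξ₀) ∧
      (∀ᵐ ω ∂P, SublevelPH.WeaklyTendsto
        (fun n => SublevelPH.normalized
          (SublevelPH.finPart (SublevelPH.diagramMeasure (SublevelPH.sample X n ω))))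
        (SublevelPH.finPart ξ₀)) ∧
      Integrable (fun p : SublevelPH.DeltaFin => SublevelPH.lifetime p)
        (SublevelPH.finPart ξ₀) ∧
      Integrable (fun p : SublevelPH.DeltaFin =>
        SublevelPH.lifetime p * Real.log (SublevelPH.lifetime p)) (SublevelPH.finPart ξ₀) ∧
      (∀ᵐ ω ∂P, Tendsto
        (fun n : ℕ => SublevelPH.persistentEntropy (SublevelPH.sample X n ω) -
          Real.log ((SublevelPH.finPart
            (SublevelPH.diagramMeasure (SublevelPH.sample X n ω))).real univ))
        atTop
        (𝓝 (-(∫ p : SublevelPH.DeltaFin, SublevelPH.lifetime p *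
                Real.log (SublevelPH.lifetime p) ∂SublevelPH.finPart ξ₀) /
              (∫ p : SublevelPH.DeltaFin, SublevelPH.lifetime p ∂SublevelPH.finPart ξ₀) +
            Real.log
              (∫ p : SublevelPH.DeltaFin, SublevelPH.lifetime p ∂SublevelPH.finPart ξ₀)))) ∧
      (∀ L : ℝ, 0 < L → 0 < ξ₀ (SublevelPH.DeltaGT L) →
        ∀ᵐ ω ∂P, Tendsto
          (fun n : ℕ => L * Real.log
              ((SublevelPH.diagramMeasure (SublevelPH.sample X n ω)).real univ) -
            SublevelPH.truncatedALPS (SublevelPH.sample X n ω) L)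
          atTop
          (𝓝 (-∫ l in (0 : ℝ)..L, Real.log (ξ₀.real (SublevelPH.DeltaGT l))))) := by
  obtain ⟨β, p, hp, htyp⟩ :=
    SublevelPH.ae_isTypical_of_isStationaryErgodic hX hstat hdens hne hmomE
  -- The limit is built from one typical path. Its values on rational quadrants involve only `β` and
  -- `p`, so it serves almost every path; `sample X n ω` unfolds to `extend` of the path of `ω`.
  obtain ⟨ω₀, h₀⟩ := htyp.exists
  obtain ⟨ξ₀, hprob, hfin, hξ⟩ := h₀.exists_limit hp
  refine ⟨ξ₀, hprob, ?_, ?_, (h₀.tendsto_lifetime hp hfin hξ).1,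
    (h₀.tendsto_lifetime_mul_log hp hfin hξ).1, ?_, fun L hL hξL => ?_⟩
  · filter_upwards [htyp] with ω h
    exact h.weaklyTendsto hp hξ
  · filter_upwards [htyp] with ω h
    exact h.weaklyTendsto_finPart hp hfin hξ
  · filter_upwards [htyp] with ω h
    exact h.tendsto_entropy hp hfin hξ
  · filter_upwards [htyp] with ω h
    exact h.tendsto_ALPS hp hξ hL hξL
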